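/- Let $(\Omega,g)$ be a compact connected smooth Riemannian manifold of dimension $n\ge 1$ with smooth boundary $\partial\Omega$ (allowed to be empty), with nonnegative Ricci curvature and convex boundary, i.e. the second fundamental form $h(X,X)=\langle\nabla_X\nu,X\rangle$ of $\partial\Omega$ with respect to the outward unit normal $\nu$ is nonnegative on vectors $X$ tangent to $\partial\Omega$. Let $\lambda_1,\lambda_2,c$ be real numbers with $\sqrt{c/2}>0$, let $W$ be a smooth vector field on the interior of $\Omega$ such that $$\langle\nabla_X W,X\rangle\ \ge\ \sqrt{\tfrac{c}{2}}\;|X|^2\qquad\text{for all tangent vectors } X \text{ at interior points of }\Omega ,$$ and let $u$ be a nonconstant real function, smooth on $\Omega$ up to the boundary, with $$\Delta u=-(\lambda_2-\lambda_1)u+2\,W\cdot\nabla u\ \text{ in the interior of }\Omega,\qquad \frac{\partial u}{\partial\nu}=0\ \text{ on }\partial\Omega .$$ Then for every $\beta$ with $0<\beta<\sqrt2$, $$\lambda_2-\lambda_1\ \ge\ \frac{\theta(\beta)^2}{\operatorname{diam}(\Omega)^2}+\beta\sqrt c,\qquad \theta(\beta)=\arcsin\frac{1}{\sqrt{1+\frac{\beta}{\sqrt2-\beta}}},$$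 where $\operatorname{diam}(\Omega)$ is the diameter with respect to the Riemannian distance of $\Omega$. Moreover $\lambda_2-\lambda_1\ge\sqrt{2c}$. -/

import Mathlib

open scoped Manifold ContDiff Bundle

noncomputable section

namespace RiemannianGap

/-! ### Riemannian geometry in one coordinate system

Coordinates live in the closed half-space `{y | 0 ≤ y 0}` of `ℝⁿ` (the range of `𝓡∂ n`); all
derivatives are taken within that half-space, so that they make sense up to its boundary.
Throughout, `g y i j` is the matrix of the metric at the coordinate point `y`. -/

section Coordinates

variable {n : ℕ} [NeZero n]

/-- The partial derivative `∂ᵢ f`, within the half-space. -/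
def pd (i : Fin n) (f : EuclideanSpace ℝ (Fin n) → ℝ) (y : EuclideanSpace ℝ (Fin n)) : ℝ :=
  fderivWithin ℝ f (Set.range (𝓡∂ n)) y (EuclideanSpace.single i 1)

variable (g : EuclideanSpace ℝ (Fin n) → Matrix (Fin n) (Fin n) ℝ)

/-- The Christoffel symbols `Γᵏᵢⱼ = ½ gᵏˡ (∂ᵢ gⱼₗ + ∂ⱼ gᵢₗ - ∂ₗ gᵢⱼ)`
of the Levi-Civita connection. -/
def christoffel (k i j : Fin n) (y : EuclideanSpace ℝ (Fin n)) : ℝ :=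
  (1 / 2) * ∑ l, (g y)⁻¹ k l *
    (pd i (fun z => g z j l) y + pd j (fun z => g z i l) y - pd l (fun z => g z i j) y)

/-- The Ricci curvature
`Rⱼₖ = ∂ᵢ Γⁱⱼₖ - ∂ⱼ Γⁱᵢₖ + Γⁱᵢₚ Γᵖⱼₖ - Γⁱⱼₚ Γᵖᵢₖ` (positive on round spheres). -/
def ricci (j k : Fin n) (y : EuclideanSpace ℝ (Fin n)) : ℝ :=
  ∑ i, (pd i (christoffel g i j k) y - pd j (christoffel g i i k) y +
    ∑ p, (christoffel g i i p y * christoffel g p j k y -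
      christoffel g i j p y * christoffel g p i k y))

/-- The Laplace-Beltrami operator `Δ f = gⁱʲ (∂ᵢ ∂ⱼ f - Γᵏᵢⱼ ∂ₖ f)`. -/
def laplacian (f : EuclideanSpace ℝ (Fin n) → ℝ) (y : EuclideanSpace ℝ (Fin n)) : ℝ :=
  ∑ i, ∑ j, (g y)⁻¹ i j * (pd i (pd j f) y - ∑ k, christoffel g k i j y * pd k f y)

/-- The components `(∇ⱼ X)ᵏ = ∂ⱼ Xᵏ + Γᵏⱼₗ Xˡ` of the covariant derivative of a vector field. -/
def covDeriv (X : EuclideanSpace ℝ (Fin n) → Fin n → ℝ) (j k : Fin n)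
    (y : EuclideanSpace ℝ (Fin n)) : ℝ :=
  pd j (fun z => X z k) y + ∑ l, christoffel g k j l y * X y l

/-- The quadratic form `v ↦ ⟨v, v⟩ = gᵢⱼ vⁱ vʲ`. -/
def metricForm (v : Fin n → ℝ) (y : EuclideanSpace ℝ (Fin n)) : ℝ :=
  ∑ i, ∑ j, g y i j * v i * v j

/-- The quadratic form `v ↦ ⟨∇ᵥ X, v⟩ = gᵢₖ (∇ⱼ X)ᵏ vʲ vⁱ`. -/
def covDerivForm (X : EuclideanSpace ℝ (Fin n) → Fin n → ℝ) (v : Fin n → ℝ)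
    (y : EuclideanSpace ℝ (Fin n)) : ℝ :=
  ∑ i, ∑ j, ∑ k, g y i k * covDeriv g X j k y * v j * v i

/-- The field `ν = -∇y⁰ / |∇y⁰|`; on the boundary `{y⁰ = 0}` of the half-space it is the outward
unit normal. -/
def outwardNormal (y : EuclideanSpace ℝ (Fin n)) (k : Fin n) : ℝ :=
  -((g y)⁻¹ k 0) / √((g y)⁻¹ 0 0)

end Coordinates

/-! ### Riemannian manifolds with boundary

The coordinate expressions above are evaluated in the smooth charts of the manifold. They are the
components of tensors (respectively scalars), so whether one of the conditions below holds at a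
point does not depend on the chart used there. -/

section Manifold

variable {n : ℕ} [NeZero n] {M : Type*} [TopologicalSpace M]
  [ChartedSpace (EuclideanHalfSpace n) M]

/-- The `i`-th coordinate vector of the chart `φ`, at the point with coordinates `y`. -/
def coordVec (φ : OpenPartialHomeomorph M (EuclideanHalfSpace n)) (i : Fin n)
    (y : EuclideanSpace ℝ (Fin n)) : TangentSpace (𝓡∂ n) ((φ.extend (𝓡∂ n)).symm y) :=
  mfderivWithin 𝓘(ℝ, EuclideanSpace ℝ (Fin n)) (𝓡∂ n) (φ.extend (𝓡∂ n)).symm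
    (Set.range (𝓡∂ n)) y (EuclideanSpace.single i (1 : ℝ) : EuclideanSpace ℝ (Fin n))

/-- The components in the chart `φ` of a vector field on the manifold. -/
def vecCoord (φ : OpenPartialHomeomorph M (EuclideanHalfSpace n))
    (W : ∀ x : M, TangentSpace (𝓡∂ n) x) (y : EuclideanSpace ℝ (Fin n)) (k : Fin n) : ℝ :=
  let w : EuclideanSpace ℝ (Fin n) :=
    mfderiv (𝓡∂ n) 𝓘(ℝ, EuclideanSpace ℝ (Fin n)) (φ.extend (𝓡∂ n))
      ((φ.extend (𝓡∂ n)).symm y) (W ((φ.extend (𝓡∂ n)).symm y))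
  w k

/-- The derivative `du(v) = ⟨v, ∇u⟩` of `u` at `x` in the direction `v`. -/
def dirDeriv (u : M → ℝ) (x : M) (v : TangentSpace (𝓡∂ n) x) : ℝ :=
  mfderiv (𝓡∂ n) 𝓘(ℝ, ℝ) u x v

variable [Bundle.RiemannianBundle (fun x : M => TangentSpace (𝓡∂ n) x)]

/-- The matrix `gᵢⱼ = ⟨∂ᵢ, ∂ⱼ⟩` of the Riemannian metric in the chart `φ`. -/
def gram (φ : OpenPartialHomeomorph M (EuclideanHalfSpace n)) (y : EuclideanSpace ℝ (Fin n)) :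
    Matrix (Fin n) (Fin n) ℝ :=
  Matrix.of fun i j => inner ℝ (coordVec φ i y) (coordVec φ j y)

variable (n M) in
/-- The Ricci curvature is nonnegative. -/
def RicciNonneg : Prop :=
  ∀ φ ∈ IsManifold.maximalAtlas (𝓡∂ n) ∞ M, ∀ x ∈ φ.source, ∀ v : Fin n → ℝ,
    0 ≤ ∑ j, ∑ k, ricci (gram φ) j k (φ.extend (𝓡∂ n) x) * v j * v k

variable (n M) in
/-- The boundary is convex: its second fundamental form `h(v, v) = ⟨∇ᵥ ν, v⟩`, for the outward unit
normal `ν` and vectors `v` tangent to the boundary, is nonnegative. -/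
def BoundaryConvex : Prop :=
  ∀ φ ∈ IsManifold.maximalAtlas (𝓡∂ n) ∞ M, ∀ x ∈ φ.source, x ∈ (𝓡∂ n).boundary M →
    ∀ v : Fin n → ℝ, v 0 = 0 →
      0 ≤ covDerivForm (gram φ) (outwardNormal (gram φ)) v (φ.extend (𝓡∂ n) x)

/-- The Laplace-Beltrami operator takes the value `L` on `u` at `x`. -/
def HasLaplacianAt (u : M → ℝ) (L : ℝ) (x : M) : Prop :=
  ∀ φ ∈ IsManifold.maximalAtlas (𝓡∂ n) ∞ M, x ∈ φ.source →
    laplacian (gram φ) (u ∘ (φ.extend (𝓡∂ n)).symm) (φ.extend (𝓡∂ n) x) = L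

variable (n) in
/-- The Neumann condition: the derivative of `u` along the outward unit normal vanishes at each
boundary point. -/
def NeumannCondition (u : M → ℝ) : Prop :=
  ∀ φ ∈ IsManifold.maximalAtlas (𝓡∂ n) ∞ M, ∀ x ∈ φ.source, x ∈ (𝓡∂ n).boundary M →
    ∑ k, outwardNormal (gram φ) (φ.extend (𝓡∂ n) x) k *
      pd k (u ∘ (φ.extend (𝓡∂ n)).symm) (φ.extend (𝓡∂ n) x) = 0

/-- `⟨∇ᵥ W, v⟩ ≥ κ |v|²` for all tangent vectors `v` at interior points. -/
def CovDerivBoundedBelow (W : ∀ x : M, TangentSpace (𝓡∂ n) x) (κ : ℝ) : Prop :=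
  ∀ φ ∈ IsManifold.maximalAtlas (𝓡∂ n) ∞ M, ∀ x ∈ φ.source, x ∈ (𝓡∂ n).interior M →
    ∀ v : Fin n → ℝ,
      κ * metricForm (gram φ) v (φ.extend (𝓡∂ n) x) ≤
        covDerivForm (gram φ) (vecCoord φ W) v (φ.extend (𝓡∂ n) x)

end Manifold

/-- `θ(β) = arcsin (1 / √(1 + β / (√2 - β)))`. -/
def theta (β : ℝ) : ℝ := Real.arcsin (1 / √(1 + β / (√2 - β)))

end RiemannianGap

end

noncomputable section

namespace RiemannianGap

open Set Filter Topology

/-! ### Calculus of partial derivatives within the half-space -/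

section PartialDerivatives

variable {n : ℕ} [NeZero n] {T : Set (EuclideanSpace ℝ (Fin n))}
  {f h : EuclideanSpace ℝ (Fin n) → ℝ} {y : EuclideanSpace ℝ (Fin n)}

/-- Relatively open subsets of the half-space. -/
structure RelOpen (T : Set (EuclideanSpace ℝ (Fin n))) : Prop where
  subset : T ⊆ range (𝓡∂ n)
  mem_nhdsWithin : ∀ y ∈ T, T ∈ 𝓝[range (𝓡∂ n)] y

theorem mem_halfSpace : y ∈ range (𝓡∂ n) ↔ 0 ≤ y 0 := by
  rw [range_modelWithCornersEuclideanHalfSpace]; rfl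

theorem RelOpen.nonneg (hT : RelOpen T) (hy : y ∈ T) : 0 ≤ y 0 :=
  mem_halfSpace.1 (hT.subset hy)

omit [NeZero n] in
theorem continuous_coord (i : Fin n) : Continuous fun y : EuclideanSpace ℝ (Fin n) => y i := by
  fun_prop

theorem RelOpen.pos (hT : RelOpen T) : RelOpen (T ∩ {y | 0 < y 0}) where
  subset := fun _ hy => hT.subset hy.1
  mem_nhdsWithin := fun y hy => inter_mem (hT.mem_nhdsWithin y hy.1)
    (mem_nhdsWithin_of_mem_nhds ((isOpen_lt continuous_const (continuous_coord 0)).mem_nhds hy.2))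

theorem RelOpen.mem_nhds (hT : RelOpen T) (hy : y ∈ T) (h0 : 0 < y 0) : T ∈ 𝓝 y := by
  have h1 : range (𝓡∂ n) ∈ 𝓝 y := by
    filter_upwards [(isOpen_lt continuous_const (continuous_coord 0)).mem_nhds h0] with z hz
    exact mem_halfSpace.2 (le_of_lt hz)
  have := hT.mem_nhdsWithin y hy
  rwa [nhdsWithin_eq_nhds.2 h1] at this

theorem RelOpen.eventuallyEq (hT : RelOpen T) (hy : y ∈ T) : T =ᶠ[𝓝 y] range (𝓡∂ n) := by
  have := hT.mem_nhdsWithin y hy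
  rw [mem_nhdsWithin_iff_eventually] at this
  filter_upwards [this] with z hz
  exact propext ⟨fun h => hT.subset h, fun h => hz h⟩

theorem RelOpen.uniqueDiffOn (hT : RelOpen T) : UniqueDiffOn ℝ T := fun y hy =>
  ((𝓡∂ n).uniqueDiffOn y (hT.subset hy)).mono_nhds
    (nhdsWithin_le_iff.2 (hT.mem_nhdsWithin y hy))

theorem RelOpen.pd_eq (hT : RelOpen T) (hy : y ∈ T) (i : Fin n) :
    pd i f y = fderivWithin ℝ f T y (EuclideanSpace.single i 1) := by
  rw [pd, fderivWithin_congr_set (hT.eventuallyEq hy)]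

theorem RelOpen.pd_eq_fderiv (hT : RelOpen T) (hy : y ∈ T) (h0 : 0 < y 0) (i : Fin n) :
    pd i f y = fderiv ℝ f y (EuclideanSpace.single i 1) := by
  rw [hT.pd_eq hy, fderivWithin_of_mem_nhds (hT.mem_nhds hy h0)]

theorem RelOpen.pd_congr (hT : RelOpen T) (hy : y ∈ T) (hfh : EqOn f h T) (i : Fin n) :
    pd i f y = pd i h y := by
  rw [hT.pd_eq hy, hT.pd_eq hy, fderivWithin_congr hfh (hfh hy)]

omit [NeZero n] in
theorem diffWithin (hf : ContDiffOn ℝ ∞ f T) (hy : y ∈ T) : DifferentiableWithinAt ℝ f T y :=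
  hf.differentiableOn (by simp) y hy

theorem RelOpen.pd_const (hT : RelOpen T) (hy : y ∈ T) (c : ℝ) (i : Fin n) :
    pd i (fun _ => c) y = 0 := by
  rw [hT.pd_eq hy]; simp

theorem RelOpen.pd_add (hT : RelOpen T) (hf : ContDiffOn ℝ ∞ f T) (hh : ContDiffOn ℝ ∞ h T)
    (hy : y ∈ T) (i : Fin n) : pd i (fun z => f z + h z) y = pd i f y + pd i h y := by
  simp only [hT.pd_eq hy]
  rw [fderivWithin_fun_add (hT.uniqueDiffOn y hy) (diffWithin hf hy) (diffWithin hh hy)]; rfl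

theorem RelOpen.pd_sub (hT : RelOpen T) (hf : ContDiffOn ℝ ∞ f T) (hh : ContDiffOn ℝ ∞ h T)
    (hy : y ∈ T) (i : Fin n) : pd i (fun z => f z - h z) y = pd i f y - pd i h y := by
  simp only [hT.pd_eq hy]
  rw [fderivWithin_fun_sub (hT.uniqueDiffOn y hy) (diffWithin hf hy) (diffWithin hh hy)]; rfl

theorem RelOpen.pd_mul (hT : RelOpen T) (hf : ContDiffOn ℝ ∞ f T) (hh : ContDiffOn ℝ ∞ h T)
    (hy : y ∈ T) (i : Fin n) :
    pd i (fun z => f z * h z) y = pd i f y * h y + f y * pd i h y := by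
  simp only [hT.pd_eq hy]
  rw [fderivWithin_fun_mul (hT.uniqueDiffOn y hy) (diffWithin hf hy) (diffWithin hh hy)]
  simp; ring

theorem RelOpen.pd_const_mul (hT : RelOpen T) (hf : ContDiffOn ℝ ∞ f T) (c : ℝ)
    (hy : y ∈ T) (i : Fin n) : pd i (fun z => c * f z) y = c * pd i f y := by
  rw [hT.pd_mul contDiffOn_const hf hy, hT.pd_const hy]; ring

theorem RelOpen.pd_neg (hT : RelOpen T) (hf : ContDiffOn ℝ ∞ f T)
    (hy : y ∈ T) (i : Fin n) : pd i (fun z => -f z) y = -pd i f y := by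
  have := hT.pd_const_mul hf (-1) hy i
  simpa using this

theorem RelOpen.pd_sum (hT : RelOpen T) {ι : Type*} (s : Finset ι)
    {F : ι → EuclideanSpace ℝ (Fin n) → ℝ}
    (hF : ∀ j ∈ s, ContDiffOn ℝ ∞ (F j) T) (hy : y ∈ T) (i : Fin n) :
    pd i (fun z => ∑ j ∈ s, F j z) y = ∑ j ∈ s, pd i (F j) y := by
  simp only [hT.pd_eq hy]
  rw [fderivWithin_fun_sum (hT.uniqueDiffOn y hy) fun j hj => diffWithin (hF j hj) hy]
  simp

theorem RelOpen.contDiffOn_pd (hT : RelOpen T) (hf : ContDiffOn ℝ ∞ f T) (i : Fin n) :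
    ContDiffOn ℝ ∞ (pd i f) T := by
  have h1 : ContDiffOn ℝ ∞ (fun z => fderivWithin ℝ f T z (EuclideanSpace.single i 1)) T :=
    (hf.fderivWithin hT.uniqueDiffOn (by simp)).clm_apply contDiffOn_const
  exact h1.congr fun z hz => hT.pd_eq hz i

theorem halfSpace_mem_closure_interior (hy : y ∈ range (𝓡∂ n)) :
    y ∈ closure (interior (range (𝓡∂ n))) := by
  rw [interior_range_modelWithCornersEuclideanHalfSpace, closure_open_halfSpace]
  exact mem_halfSpace.1 hy

theorem RelOpen.pd_comm (hT : RelOpen T) (hf : ContDiffOn ℝ ∞ f T) (hy : y ∈ T) (i j : Fin n) :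
    pd i (pd j f) y = pd j (pd i f) y := by
  have hcl : y ∈ closure (interior T) := by
    have h1 := halfSpace_mem_closure_interior (hT.subset hy)
    rw [mem_closure_iff_nhds] at h1 ⊢
    intro s hs
    have h2 := hT.eventuallyEq hy
    rw [Filter.eventuallyEq_set] at h2
    obtain ⟨o, ho, hoo, hyo⟩ := eventually_nhds_iff.1 h2
    obtain ⟨z, hz⟩ := h1 (s ∩ o) (inter_mem hs (hoo.mem_nhds hyo))
    refine ⟨z, hz.1.1, ?_⟩
    rw [mem_interior_iff_mem_nhds]
    filter_upwards [hoo.mem_nhds hz.1.2, mem_interior_iff_mem_nhds.1 hz.2] with w hw hw'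
    exact (ho w hw).2 hw'
  have h2 : minSmoothness ℝ 2 ≤ (∞ : ℕ∞ω) := by
    rw [minSmoothness_of_isRCLikeNormedField]; exact WithTop.coe_le_coe.2 (le_top : (2 : ℕ∞) ≤ ⊤)
  have hs := (hf y hy).isSymmSndFDerivWithinAt h2 hT.uniqueDiffOn hcl hy
  have key : ∀ i j : Fin n, pd i (pd j f) y = fderivWithin ℝ (fderivWithin ℝ f T) T y
      (EuclideanSpace.single i 1) (EuclideanSpace.single j 1) := by
    intro i j
    have e : EqOn (pd j f) (fun z => fderivWithin ℝ f T z (EuclideanSpace.single j 1)) T :=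
      fun z hz => hT.pd_eq hz j
    rw [hT.pd_congr hy e, hT.pd_eq hy]
    have hd : DifferentiableWithinAt ℝ (fderivWithin ℝ f T) T y :=
      (hf.fderivWithin (m := ∞) hT.uniqueDiffOn (by simp)).differentiableOn (by simp) y hy
    rw [fderivWithin_clm_apply (hT.uniqueDiffOn y hy) hd (differentiableWithinAt_const _)]
    simp
  rw [key, key]
  exact hs _ _

end PartialDerivatives

/-! ### Smoothness of the inverse matrix -/

section MatrixSmooth

variable {m : Type*} [Fintype m] [DecidableEq m] {E : Type*} [NormedAddCommGroup E]
  [NormedSpace ℝ E] {T : Set E} {A : E → Matrix m m ℝ}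

theorem contDiffOn_det {k : ℕ∞ω} (hA : ∀ i j, ContDiffOn ℝ k (fun y => A y i j) T) :
    ContDiffOn ℝ k (fun y => (A y).det) T := by
  simp only [Matrix.det_apply]
  refine ContDiffOn.sum fun σ _ => ?_
  exact (contDiffOn_prod fun i _ => hA _ _).const_smul _

theorem contDiffOn_matrix_inv {k : ℕ∞ω} (hA : ∀ i j, ContDiffOn ℝ k (fun y => A y i j) T)
    (hdet : ∀ y ∈ T, (A y).det ≠ 0) (i j : m) : ContDiffOn ℝ k (fun y => (A y)⁻¹ i j) T := by
  have : (fun y => (A y)⁻¹ i j) = fun y => (A y).det⁻¹ * (A y).adjugate i j := by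
    funext y
    simp [Matrix.inv_def]
  rw [this]
  refine ((contDiffOn_det hA).inv hdet).mul ?_
  simp only [Matrix.adjugate_apply]
  refine contDiffOn_det fun a b => ?_
  simp only [Matrix.updateRow_apply]
  split_ifs
  · exact contDiffOn_const
  · exact hA _ _

end MatrixSmooth

end RiemannianGap

namespace RiemannianGap

open Set Filter Topology

/-! ### Levi-Civita calculus in coordinates -/

section LeviCivita

variable {n : ℕ} [NeZero n] {T : Set (EuclideanSpace ℝ (Fin n))}
  {g : EuclideanSpace ℝ (Fin n) → Matrix (Fin n) (Fin n) ℝ}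
  {u : EuclideanSpace ℝ (Fin n) → ℝ} {y : EuclideanSpace ℝ (Fin n)}

/-- Smooth Riemannian metrics on a relatively open subset of the half-space. -/
structure MetricOn (T : Set (EuclideanSpace ℝ (Fin n)))
    (g : EuclideanSpace ℝ (Fin n) → Matrix (Fin n) (Fin n) ℝ) : Prop where
  relOpen : RelOpen T
  smooth : ∀ i j, ContDiffOn ℝ ∞ (fun y => g y i j) T
  posDef : ∀ y ∈ T, (g y).PosDef

theorem MetricOn.mono (hg : MetricOn T g) {S : Set (EuclideanSpace ℝ (Fin n))} (hS : RelOpen S)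
    (h : S ⊆ T) : MetricOn S g :=
  ⟨hS, fun i j => (hg.smooth i j).mono h, fun y hy => hg.posDef y (h hy)⟩

theorem MetricOn.symm (hg : MetricOn T g) (hy : y ∈ T) (i j : Fin n) : g y i j = g y j i := by
  have := (hg.posDef y hy).1.apply j i
  simpa using this

theorem MetricOn.isUnit_det (hg : MetricOn T g) (hy : y ∈ T) : IsUnit (g y).det :=
  (hg.posDef y hy).det_pos.ne'.isUnit

theorem MetricOn.inv_symm (hg : MetricOn T g) (hy : y ∈ T) (i j : Fin n) :
    (g y)⁻¹ i j = (g y)⁻¹ j i := by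
  have := (hg.posDef y hy).inv.1.apply j i
  simpa using this

theorem MetricOn.mul_inv (hg : MetricOn T g) (hy : y ∈ T) (i j : Fin n) :
    ∑ l, g y i l * (g y)⁻¹ l j = if i = j then 1 else 0 := by
  rw [← Matrix.mul_apply, Matrix.mul_nonsing_inv _ (hg.isUnit_det hy), Matrix.one_apply]

theorem MetricOn.inv_mul (hg : MetricOn T g) (hy : y ∈ T) (i j : Fin n) :
    ∑ l, (g y)⁻¹ i l * g y l j = if i = j then 1 else 0 := by
  rw [← Matrix.mul_apply, Matrix.nonsing_inv_mul _ (hg.isUnit_det hy), Matrix.one_apply]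

theorem MetricOn.smooth_inv (hg : MetricOn T g) (i j : Fin n) :
    ContDiffOn ℝ ∞ (fun y => (g y)⁻¹ i j) T :=
  contDiffOn_matrix_inv hg.smooth (fun _ hy => (hg.isUnit_det hy).ne_zero) i j

theorem MetricOn.smooth_christoffel (hg : MetricOn T g) (k i j : Fin n) :
    ContDiffOn ℝ ∞ (christoffel g k i j) T := by
  unfold christoffel
  have h := fun (a b c : Fin n) => hg.relOpen.contDiffOn_pd (hg.smooth a b) c
  exact contDiffOn_const.mul (ContDiffOn.sum fun l _ =>
    (hg.smooth_inv k l).mul (((h _ _ _).add (h _ _ _)).sub (h _ _ _)))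

theorem MetricOn.pd_symm (hg : MetricOn T g) (hy : y ∈ T) (k i j : Fin n) :
    pd k (fun z => g z i j) y = pd k (fun z => g z j i) y :=
  hg.relOpen.pd_congr hy (fun _ hz => hg.symm hz i j) k

theorem MetricOn.christoffel_symm (hg : MetricOn T g) (hy : y ∈ T) (k i j : Fin n) :
    christoffel g k i j y = christoffel g k j i y := by
  unfold christoffel
  congr 1
  refine Finset.sum_congr rfl fun l _ => ?_
  rw [hg.pd_symm hy l i j]
  ring

theorem MetricOn.lower_christoffel (hg : MetricOn T g) (hy : y ∈ T) (k i j : Fin n) :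
    ∑ l, g y k l * christoffel g l i j y = (1 / 2) * (pd i (fun z => g z j k) y +
      pd j (fun z => g z i k) y - pd k (fun z => g z i j) y) := by
  unfold christoffel
  simp only [Finset.mul_sum]
  rw [Finset.sum_comm]
  have : ∀ m, ∑ l, g y k l * (1 / 2 * ((g y)⁻¹ l m * (pd i (fun z => g z j m) y +
      pd j (fun z => g z i m) y - pd m (fun z => g z i j) y))) =
      (if k = m then 1 else 0) * ((1 / 2) * (pd i (fun z => g z j m) y +
      pd j (fun z => g z i m) y - pd m (fun z => g z i j) y)) := by
    intro m
    rw [← hg.mul_inv hy, Finset.sum_mul]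
    exact Finset.sum_congr rfl fun l _ => by ring
  simp only [this]
  simp

/-- The metric is parallel. -/
theorem MetricOn.pd_metric (hg : MetricOn T g) (hy : y ∈ T) (k i j : Fin n) :
    pd k (fun z => g z i j) y =
      ∑ l, (g y i l * christoffel g l k j y + g y j l * christoffel g l k i y) := by
  rw [Finset.sum_add_distrib, hg.lower_christoffel hy, hg.lower_christoffel hy,
    hg.pd_symm hy j k i, hg.pd_symm hy i k j, hg.pd_symm hy k j i]
  ring

/-- The inverse metric is parallel. -/
theorem MetricOn.pd_inv (hg : MetricOn T g) (hy : y ∈ T) (k i j : Fin n) :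
    pd k (fun z => (g z)⁻¹ i j) y =
      -∑ l, (christoffel g i k l y * (g y)⁻¹ l j + christoffel g j k l y * (g y)⁻¹ i l) := by
  have hT := hg.relOpen
  have h0 : ∀ m, ∑ l, (pd k (fun z => (g z)⁻¹ i l) y * g y l m +
      (g y)⁻¹ i l * pd k (fun z => g z l m) y) = 0 := by
    intro m
    have := hT.pd_congr hy (fun z hz => hg.inv_mul hz i m) k
    rw [hT.pd_const hy, hT.pd_sum _ (fun l _ => (hg.smooth_inv i l).mul (hg.smooth l m)) hy] at this
    rw [← this]
    exact Finset.sum_congr rfl fun l _ => (hT.pd_mul (hg.smooth_inv i l) (hg.smooth l m) hy k).symm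
  have h1 : pd k (fun z => (g z)⁻¹ i j) y =
      ∑ m, (∑ l, pd k (fun z => (g z)⁻¹ i l) y * g y l m) * (g y)⁻¹ m j := by
    simp only [Finset.sum_mul]
    rw [Finset.sum_comm]
    simp only [mul_assoc, ← Finset.mul_sum, hg.mul_inv hy]
    simp
  have h2 : ∀ m, ∑ l, (g y)⁻¹ i l * pd k (fun z => g z l m) y =
      christoffel g i k m y + ∑ l, ∑ p, (g y)⁻¹ i l * (g y m p * christoffel g p k l y) := by
    intro m
    simp only [hg.pd_metric hy, Finset.sum_add_distrib, mul_add, Finset.mul_sum]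
    congr 1
    rw [Finset.sum_comm]
    simp only [← mul_assoc, ← Finset.sum_mul, hg.inv_mul hy]
    simp
  have h3 : ∀ m, ∑ l, pd k (fun z => (g z)⁻¹ i l) y * g y l m =
      -(christoffel g i k m y + ∑ l, ∑ p, (g y)⁻¹ i l * (g y m p * christoffel g p k l y)) := by
    intro m
    have := h0 m
    rw [Finset.sum_add_distrib, h2] at this
    linarith
  rw [h1]
  simp only [h3, neg_mul, Finset.sum_neg_distrib, add_mul, Finset.sum_add_distrib]
  congr 2
  simp only [Finset.sum_mul]
  rw [Finset.sum_comm]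
  refine Finset.sum_congr rfl fun l _ => ?_
  rw [Finset.sum_comm]
  have : ∀ p, ∑ m, (g y)⁻¹ i l * (g y m p * christoffel g p k l y) * (g y)⁻¹ m j =
      (if p = j then 1 else 0) * (christoffel g p k l y * (g y)⁻¹ i l) := by
    intro p
    rw [← hg.mul_inv hy, Finset.sum_mul]
    exact Finset.sum_congr rfl fun m _ => by rw [hg.symm hy m p]; ring
  simp only [this]
  simp

/-- The components `gⁱʲ ∂ⱼ u` of the gradient. -/
def grad (g : EuclideanSpace ℝ (Fin n) → Matrix (Fin n) (Fin n) ℝ)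
    (u : EuclideanSpace ℝ (Fin n) → ℝ) (i : Fin n) (y : EuclideanSpace ℝ (Fin n)) : ℝ :=
  ∑ j, (g y)⁻¹ i j * pd j u y

/-- The squared length `gⁱʲ ∂ᵢ u ∂ⱼ u` of the gradient. -/
def gradSq (g : EuclideanSpace ℝ (Fin n) → Matrix (Fin n) (Fin n) ℝ)
    (u : EuclideanSpace ℝ (Fin n) → ℝ) (y : EuclideanSpace ℝ (Fin n)) : ℝ :=
  ∑ i, pd i u y * grad g u i y

/-- The Hessian `∇ᵢ ∇ⱼ u`. -/
def hess (g : EuclideanSpace ℝ (Fin n) → Matrix (Fin n) (Fin n) ℝ)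
    (u : EuclideanSpace ℝ (Fin n) → ℝ) (i j : Fin n) (y : EuclideanSpace ℝ (Fin n)) : ℝ :=
  pd i (pd j u) y - ∑ k, christoffel g k i j y * pd k u y

/-- The third covariant derivative `∇ₗ ∇ᵢ ∇ⱼ u`. -/
def covHess (g : EuclideanSpace ℝ (Fin n) → Matrix (Fin n) (Fin n) ℝ)
    (u : EuclideanSpace ℝ (Fin n) → ℝ) (l i j : Fin n) (y : EuclideanSpace ℝ (Fin n)) : ℝ :=
  pd l (hess g u i j) y - ∑ m, (christoffel g m l i y * hess g u m j y +
    christoffel g m l j y * hess g u i m y)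

/-- The Riemann curvature tensor `Rᵖₖₗᵢ = ∂ₗ Γᵖᵢₖ - ∂ᵢ Γᵖₗₖ + Γᵖₗₘ Γᵐᵢₖ - Γᵖᵢₘ Γᵐₗₖ`. -/
def riemann (g : EuclideanSpace ℝ (Fin n) → Matrix (Fin n) (Fin n) ℝ)
    (p k l i : Fin n) (y : EuclideanSpace ℝ (Fin n)) : ℝ :=
  pd l (christoffel g p i k) y - pd i (christoffel g p l k) y +
    ∑ m, (christoffel g p l m y * christoffel g m i k y -
      christoffel g p i m y * christoffel g m l k y)

theorem MetricOn.smooth_grad (hg : MetricOn T g) (hu : ContDiffOn ℝ ∞ u T) (i : Fin n) :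
    ContDiffOn ℝ ∞ (grad g u i) T :=
  ContDiffOn.sum fun j _ => (hg.smooth_inv i j).mul (hg.relOpen.contDiffOn_pd hu j)

theorem MetricOn.smooth_gradSq (hg : MetricOn T g) (hu : ContDiffOn ℝ ∞ u T) :
    ContDiffOn ℝ ∞ (gradSq g u) T :=
  ContDiffOn.sum fun j _ => (hg.relOpen.contDiffOn_pd hu j).mul (hg.smooth_grad hu j)

theorem MetricOn.smooth_hess (hg : MetricOn T g) (hu : ContDiffOn ℝ ∞ u T) (i j : Fin n) :
    ContDiffOn ℝ ∞ (hess g u i j) T :=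
  (hg.relOpen.contDiffOn_pd (hg.relOpen.contDiffOn_pd hu j) i).sub
    (ContDiffOn.sum fun k _ => (hg.smooth_christoffel k i j).mul (hg.relOpen.contDiffOn_pd hu k))

theorem laplacian_eq (u : EuclideanSpace ℝ (Fin n) → ℝ) (y : EuclideanSpace ℝ (Fin n)) :
    laplacian g u y = ∑ i, ∑ j, (g y)⁻¹ i j * hess g u i j y := rfl

theorem MetricOn.smooth_laplacian (hg : MetricOn T g) (hu : ContDiffOn ℝ ∞ u T) :
    ContDiffOn ℝ ∞ (laplacian g u) T :=
  ContDiffOn.sum fun i _ => ContDiffOn.sum fun j _ =>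
    (hg.smooth_inv i j).mul (hg.smooth_hess hu i j)

theorem MetricOn.lower_grad (hg : MetricOn T g) (hy : y ∈ T) (i : Fin n) :
    ∑ l, g y i l * grad g u l y = pd i u y := by
  unfold grad
  simp only [Finset.mul_sum]
  rw [Finset.sum_comm]
  simp only [← mul_assoc, ← Finset.sum_mul, hg.mul_inv hy]
  simp

theorem MetricOn.pd_grad (hg : MetricOn T g) (hu : ContDiffOn ℝ ∞ u T) (hy : y ∈ T)
    (k i : Fin n) : pd k (grad g u i) y =
      ∑ j, ((g y)⁻¹ i j * hess g u k j y - christoffel g i k j y * grad g u j y) := by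
  have hT := hg.relOpen
  have h1 : pd k (grad g u i) y = ∑ j, (pd k (fun z => (g z)⁻¹ i j) y * pd j u y +
      (g y)⁻¹ i j * pd k (pd j u) y) := by
    unfold grad
    rw [hT.pd_sum _ (fun j _ => (hg.smooth_inv i j).mul (hT.contDiffOn_pd hu j)) hy]
    exact Finset.sum_congr rfl fun j _ =>
      hT.pd_mul (hg.smooth_inv i j) (hT.contDiffOn_pd hu j) hy k
  rw [h1]
  simp only [hg.pd_inv hy, hess, grad, Finset.sum_add_distrib, Finset.sum_sub_distrib, mul_sub,
    Finset.mul_sum, neg_mul, add_mul, Finset.sum_mul, Finset.sum_neg_distrib]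
  have e1 : ∑ x, ∑ l, christoffel g i k l y * (g y)⁻¹ l x * pd x u y =
      ∑ l, ∑ x, christoffel g i k l y * ((g y)⁻¹ l x * pd x u y) := by
    rw [Finset.sum_comm]; simp only [mul_assoc]
  have e2 : ∑ x, ∑ l, christoffel g x k l y * (g y)⁻¹ i l * pd x u y =
      ∑ l, ∑ x, (g y)⁻¹ i l * (christoffel g x k l y * pd x u y) := by
    rw [Finset.sum_comm]
    exact Finset.sum_congr rfl fun l _ => Finset.sum_congr rfl fun x _ => by ring
  rw [e1, e2]
  ring

theorem MetricOn.pd_gradSq (hg : MetricOn T g) (hu : ContDiffOn ℝ ∞ u T) (hy : y ∈ T)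
    (k : Fin n) : pd k (gradSq g u) y = 2 * ∑ i, hess g u k i y * grad g u i y := by
  have hT := hg.relOpen
  have h1 : pd k (gradSq g u) y = ∑ i, (pd k (pd i u) y * grad g u i y +
      pd i u y * pd k (grad g u i) y) := by
    unfold gradSq
    rw [hT.pd_sum _ (fun j _ => (hT.contDiffOn_pd hu j).mul (hg.smooth_grad hu j)) hy]
    exact Finset.sum_congr rfl fun j _ =>
      hT.pd_mul (hT.contDiffOn_pd hu j) (hg.smooth_grad hu j) hy k
  have e1 : ∑ i, pd i u y * ∑ j, (g y)⁻¹ i j * hess g u k j y =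
      ∑ j, hess g u k j y * grad g u j y := by
    simp only [grad, Finset.mul_sum]
    rw [Finset.sum_comm]
    refine Finset.sum_congr rfl fun l _ => Finset.sum_congr rfl fun x _ => ?_
    rw [hg.inv_symm hy x l]; ring
  have e2 : ∑ i, pd i u y * ∑ j, christoffel g i k j y * grad g u j y =
      ∑ j, (∑ i, christoffel g i k j y * pd i u y) * grad g u j y := by
    simp only [Finset.mul_sum, Finset.sum_mul]
    rw [Finset.sum_comm]
    refine Finset.sum_congr rfl fun l _ => Finset.sum_congr rfl fun x _ => by ring
  rw [h1]
  simp only [hg.pd_grad hu hy, Finset.sum_sub_distrib, mul_sub, Finset.sum_add_distrib]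
  rw [e1, e2, two_mul]
  have e3 : ∑ i, pd k (pd i u) y * grad g u i y = ∑ i, hess g u k i y * grad g u i y +
      ∑ j, (∑ i, christoffel g i k j y * pd i u y) * grad g u j y := by
    rw [← Finset.sum_add_distrib]
    exact Finset.sum_congr rfl fun i _ => by unfold hess; ring
  rw [e3]; ring

theorem MetricOn.covHess_sub (hg : MetricOn T g) (hu : ContDiffOn ℝ ∞ u T) (hy : y ∈ T)
    (l i k : Fin n) : covHess g u l k i y - covHess g u i k l y =
      -∑ p, riemann g p k l i y * pd p u y := by
  have hT := hg.relOpen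
  have h1 : ∀ l k i, pd l (hess g u k i) y = pd l (pd k (pd i u)) y -
      ∑ p, (pd l (christoffel g p k i) y * pd p u y +
        christoffel g p k i y * pd l (pd p u) y) := by
    intro l k i
    unfold hess
    rw [hT.pd_sub (hT.contDiffOn_pd (hT.contDiffOn_pd hu i) k) (ContDiffOn.sum fun p _ =>
      (hg.smooth_christoffel p k i).mul (hT.contDiffOn_pd hu p)) hy,
      hT.pd_sum _ (fun p _ => (hg.smooth_christoffel p k i).mul (hT.contDiffOn_pd hu p)) hy]
    congr 1
    exact Finset.sum_congr rfl fun p _ =>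
      hT.pd_mul (hg.smooth_christoffel p k i) (hT.contDiffOn_pd hu p) hy l
  have h3 : pd l (pd k (pd i u)) y = pd i (pd k (pd l u)) y := by
    rw [hT.pd_congr hy (fun z hz => hT.pd_comm hu hz k i) l,
      hT.pd_comm (hT.contDiffOn_pd hu k) hy l i,
      hT.pd_congr hy (fun z hz => hT.pd_comm hu hz l k) i]
  have hc : ∀ p a b, pd a (christoffel g p k b) y = pd a (christoffel g p b k) y := fun p a b =>
    hT.pd_congr hy (fun z hz => hg.christoffel_symm hz p k b) a
  have e1 : ∀ a b, ∑ m, christoffel g m a k y * hess g u m b y =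
      ∑ m, christoffel g m a k y * pd b (pd m u) y -
      ∑ p, (∑ m, christoffel g p b m y * christoffel g m a k y) * pd p u y := by
    intro a b
    simp only [hess, mul_sub, Finset.sum_sub_distrib, Finset.mul_sum, Finset.sum_mul]
    congr 1
    · exact Finset.sum_congr rfl fun m _ => by rw [hT.pd_comm hu hy m b]
    · rw [Finset.sum_comm]
      refine Finset.sum_congr rfl fun p _ => Finset.sum_congr rfl fun m _ => ?_
      rw [hg.christoffel_symm hy p m b]; ring
  unfold covHess
  rw [h1, h1, h3]
  simp only [Finset.sum_add_distrib, e1, riemann, add_mul, sub_mul, Finset.sum_sub_distrib, hc,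
    hg.christoffel_symm hy _ k l, hg.christoffel_symm hy _ k i, hg.christoffel_symm hy _ i l]
  ring

theorem ricci_eq_riemann (j k : Fin n) : ricci g j k y = ∑ i, riemann g i k i j y := rfl

/-- `Rₚₖₗᵢ = -Rₖₚₗᵢ`. -/
theorem MetricOn.lower_riemann_antisymm (hg : MetricOn T g) (hy : y ∈ T) (q k l i : Fin n) :
    ∑ p, g y q p * riemann g p k l i y = -∑ p, g y k p * riemann g p q l i y := by
  have hT := hg.relOpen
  have h1 : ∀ l i, pd l (pd i (fun z => g z q k)) y =
      ∑ p, (g y q p * pd l (christoffel g p i k) y + g y k p * pd l (christoffel g p i q) y) +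
      (∑ p, (∑ m, g y q m * christoffel g m l p y) * christoffel g p i k y +
       ∑ p, (∑ m, g y k m * christoffel g m l p y) * christoffel g p i q y) +
      (∑ p, ∑ m, g y p m * (christoffel g m l q y * christoffel g p i k y) +
       ∑ p, ∑ m, g y p m * (christoffel g m l k y * christoffel g p i q y)) := by
    intro l i
    rw [hT.pd_congr hy (fun z hz => hg.pd_metric hz i q k) l, hT.pd_sum _ (fun p _ =>
      ((hg.smooth q p).mul (hg.smooth_christoffel p i k)).add
      ((hg.smooth k p).mul (hg.smooth_christoffel p i q))) hy]
    rw [← Finset.sum_add_distrib, ← Finset.sum_add_distrib, ← Finset.sum_add_distrib,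
      ← Finset.sum_add_distrib]
    refine Finset.sum_congr rfl fun p _ => ?_
    rw [hT.pd_add ((hg.smooth q p).mul (hg.smooth_christoffel p i k))
      ((hg.smooth k p).mul (hg.smooth_christoffel p i q)) hy,
      hT.pd_mul (hg.smooth q p) (hg.smooth_christoffel p i k) hy,
      hT.pd_mul (hg.smooth k p) (hg.smooth_christoffel p i q) hy, hg.pd_metric hy,
      hg.pd_metric hy]
    simp only [Finset.sum_add_distrib, add_mul, Finset.sum_mul]
    have : ∀ a b c : Fin n, ∑ m, g y p m * christoffel g m l a y * christoffel g p i b y =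
      ∑ m, g y p m * (christoffel g m l a y * christoffel g p i b y) := fun a b c =>
      Finset.sum_congr rfl fun m _ => by ring
    rw [this q k k, this k q k]
    ring
  have hs : ∀ l i, ∑ p, ∑ m, g y p m * (christoffel g m l q y * christoffel g p i k y) =
      ∑ p, ∑ m, g y p m * (christoffel g m i k y * christoffel g p l q y) := by
    intro l i
    rw [Finset.sum_comm]
    refine Finset.sum_congr rfl fun p _ => Finset.sum_congr rfl fun m _ => ?_
    rw [hg.symm hy m p]; ring
  have h2 := hT.pd_comm (hg.smooth q k) hy l i
  rw [h1, h1, hs l i, hs i l] at h2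
  have h3 : ∀ q k l i, ∑ p, g y q p * ∑ m, christoffel g p l m y * christoffel g m i k y =
      ∑ p, (∑ m, g y q m * christoffel g m l p y) * christoffel g p i k y := by
    intro q k l i
    simp only [Finset.mul_sum, Finset.sum_mul]
    rw [Finset.sum_comm]
    simp only [mul_assoc]
  simp only [riemann, mul_add, mul_sub, Finset.sum_add_distrib, Finset.sum_sub_distrib, h3] at h2 ⊢
  linarith

end LeviCivita

end RiemannianGap

namespace RiemannianGap

open Set Filter Topology

/-! ### Linear algebra of quadratic forms -/

section QuadraticForms

open Matrix

variable {m : Type*} [Fintype m] [DecidableEq m]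

open scoped MatrixOrder Matrix.Norms.L2Operator in
theorem exists_transpose_mul_self {A : Matrix m m ℝ} (hA : A.PosSemidef) :
    ∃ B : Matrix m m ℝ, A = Bᵀ * B := by
  obtain ⟨B, hB⟩ := CStarAlgebra.nonneg_iff_eq_star_mul_self.1 hA.nonneg
  exact ⟨B, by simpa [Matrix.star_eq_conjTranspose] using hB⟩

theorem sum_mul_nonneg_of_posSemidef {A D : Matrix m m ℝ} (hA : A.PosSemidef)
    (hD : ∀ v : m → ℝ, 0 ≤ ∑ i, ∑ j, D i j * v i * v j) : 0 ≤ ∑ i, ∑ j, A i j * D i j := by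
  obtain ⟨B, rfl⟩ := exists_transpose_mul_self hA
  have : ∑ i, ∑ j, (Bᵀ * B) i j * D i j = ∑ k, ∑ i, ∑ j, D i j * B k i * B k j := by
    simp only [Matrix.mul_apply, Matrix.transpose_apply, Finset.sum_mul]
    have : ∀ i, ∑ j, ∑ k, B k i * B k j * D i j = ∑ k, ∑ j, D i j * B k i * B k j := by
      intro i
      rw [Finset.sum_comm]
      exact Finset.sum_congr rfl fun _ _ => Finset.sum_congr rfl fun _ _ => by ring
    simp only [this]
    rw [Finset.sum_comm]
  rw [this]
  exact Finset.sum_nonneg fun k _ => hD fun i => B k i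

omit [DecidableEq m] in
theorem mulVec_dot_le_trace {C : Matrix m m ℝ} (z : m → ℝ) :
    (C *ᵥ z) ⬝ᵥ (C *ᵥ z) ≤ (C * Cᵀ).trace * (z ⬝ᵥ z) := by
  simp only [dotProduct, mulVec, Matrix.trace, Matrix.diag, Matrix.mul_apply,
    Matrix.transpose_apply, Finset.sum_mul]
  refine Finset.sum_le_sum fun i _ => ?_
  have := Finset.sum_mul_sq_le_sq_mul_sq Finset.univ (C i) z
  simp only [pow_two, Finset.sum_mul] at this ⊢
  exact this

theorem quadForm_mulVec_le {A H : Matrix m m ℝ} (hA : A.PosSemidef) (v : m → ℝ) :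
    (H *ᵥ (A *ᵥ v)) ⬝ᵥ (A *ᵥ (H *ᵥ (A *ᵥ v))) ≤ (A * H * A * Hᵀ).trace * (v ⬝ᵥ (A *ᵥ v)) := by
  obtain ⟨B, rfl⟩ := exists_transpose_mul_self hA
  have h := mulVec_dot_le_trace (C := B * H * Bᵀ) (B *ᵥ v)
  have e1 : ∀ x y : m → ℝ, x ⬝ᵥ ((Bᵀ * B) *ᵥ y) = (B *ᵥ x) ⬝ᵥ (B *ᵥ y) := by
    intro x y
    rw [← Matrix.mulVec_mulVec, Matrix.dotProduct_mulVec, Matrix.vecMul_transpose]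
  have e2 : (Bᵀ * B * H * (Bᵀ * B) * Hᵀ).trace =
      ((B * H * Bᵀ) * (B * H * Bᵀ)ᵀ).trace := by
    rw [show Bᵀ * B * H * (Bᵀ * B) * Hᵀ = Bᵀ * (B * H * (Bᵀ * B) * Hᵀ) by
      simp only [Matrix.mul_assoc], Matrix.trace_mul_comm]
    simp only [Matrix.transpose_mul, Matrix.transpose_transpose, Matrix.mul_assoc]
  rw [e1, e1, e2]
  simpa only [Matrix.mulVec_mulVec, Matrix.mul_assoc] using h

end QuadraticForms

/-! ### The Bochner formula -/

section Bochner

variable {n : ℕ} [NeZero n] {T : Set (EuclideanSpace ℝ (Fin n))}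
  {g : EuclideanSpace ℝ (Fin n) → Matrix (Fin n) (Fin n) ℝ}
  {u : EuclideanSpace ℝ (Fin n) → ℝ} {y : EuclideanSpace ℝ (Fin n)}

/-- The squared norm `gⁱᵏ gʲˡ ∇ᵢⱼu ∇ₖₗu` of the Hessian. -/
def hessSq (g : EuclideanSpace ℝ (Fin n) → Matrix (Fin n) (Fin n) ℝ)
    (u : EuclideanSpace ℝ (Fin n) → ℝ) (y : EuclideanSpace ℝ (Fin n)) : ℝ :=
  ∑ l, ∑ k, (g y)⁻¹ l k * ∑ i, ∑ j, hess g u k i y * (g y)⁻¹ i j * hess g u l j y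

theorem MetricOn.pd_laplacian (hg : MetricOn T g) (hu : ContDiffOn ℝ ∞ u T) (hy : y ∈ T)
    (m : Fin n) : pd m (laplacian g u) y = ∑ i, ∑ j, (g y)⁻¹ i j * covHess g u m i j y := by
  have hT := hg.relOpen
  have h1 : pd m (laplacian g u) y = ∑ i, ∑ j, (pd m (fun z => (g z)⁻¹ i j) y * hess g u i j y +
      (g y)⁻¹ i j * pd m (hess g u i j) y) := by
    have hs := fun i j => (hg.smooth_inv i j).mul (hg.smooth_hess hu i j)
    rw [show laplacian g u = fun z => ∑ i, ∑ j, (g z)⁻¹ i j * hess g u i j z from rfl,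
      hT.pd_sum _ (fun i _ => ContDiffOn.sum fun j _ => hs i j) hy]
    refine Finset.sum_congr rfl fun i _ => ?_
    rw [hT.pd_sum _ (fun j _ => hs i j) hy]
    exact Finset.sum_congr rfl fun j _ =>
      hT.pd_mul (hg.smooth_inv i j) (hg.smooth_hess hu i j) hy m
  have e1 : ∑ i, ∑ j, (∑ l, christoffel g i m l y * (g y)⁻¹ l j) * hess g u i j y =
      ∑ i, ∑ j, (g y)⁻¹ i j * ∑ l, christoffel g l m i y * hess g u l j y := by
    simp only [Finset.sum_mul, Finset.mul_sum]
    rw [Finset.sum_comm, Finset.sum_comm (γ := Fin n) (s := Finset.univ)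
      (f := fun i j => ∑ l, (g y)⁻¹ i j * (christoffel g l m i y * hess g u l j y))]
    refine Finset.sum_congr rfl fun j _ => ?_
    rw [Finset.sum_comm]
    exact Finset.sum_congr rfl fun _ _ => Finset.sum_congr rfl fun _ _ => by ring
  have e2 : ∑ i, ∑ j, (∑ l, christoffel g j m l y * (g y)⁻¹ i l) * hess g u i j y =
      ∑ i, ∑ j, (g y)⁻¹ i j * ∑ l, christoffel g l m j y * hess g u i l y := by
    simp only [Finset.sum_mul, Finset.mul_sum]
    refine Finset.sum_congr rfl fun i _ => ?_
    rw [Finset.sum_comm]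
    exact Finset.sum_congr rfl fun _ _ => Finset.sum_congr rfl fun _ _ => by ring
  rw [h1]
  simp only [hg.pd_inv hy, covHess, Finset.sum_add_distrib, mul_sub, mul_add, neg_mul, add_mul,
    Finset.sum_sub_distrib, Finset.sum_neg_distrib]
  rw [e1, e2]
  ring

theorem MetricOn.hess_gradSq (hg : MetricOn T g) (hu : ContDiffOn ℝ ∞ u T) (hy : y ∈ T)
    (l k : Fin n) : hess g (gradSq g u) l k y =
      2 * (∑ i, covHess g u l k i y * grad g u i y +
        ∑ i, ∑ j, hess g u k i y * (g y)⁻¹ i j * hess g u l j y) := by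
  have hT := hg.relOpen
  have hs := fun i => (hg.smooth_hess hu k i).mul (hg.smooth_grad hu i)
  have h1 : pd l (pd k (gradSq g u)) y = 2 * ∑ i, (pd l (hess g u k i) y * grad g u i y +
      hess g u k i y * pd l (grad g u i) y) := by
    rw [hT.pd_congr hy (fun z hz => hg.pd_gradSq hu hz k) l,
      hT.pd_const_mul (ContDiffOn.sum fun i _ => hs i) _ hy, hT.pd_sum _ (fun i _ => hs i) hy]
    congr 1
    exact Finset.sum_congr rfl fun i _ =>
      hT.pd_mul (hg.smooth_hess hu k i) (hg.smooth_grad hu i) hy l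
  have e1 : ∑ i, hess g u k i y * ∑ j, christoffel g i l j y * grad g u j y =
      ∑ i, (∑ m, christoffel g m l i y * hess g u k m y) * grad g u i y := by
    simp only [Finset.sum_mul, Finset.mul_sum]
    rw [Finset.sum_comm]
    exact Finset.sum_congr rfl fun _ _ => Finset.sum_congr rfl fun _ _ => by ring
  have e2 : ∑ m, christoffel g m l k y * (2 * ∑ i, hess g u m i y * grad g u i y) =
      2 * ∑ i, (∑ m, christoffel g m l k y * hess g u m i y) * grad g u i y := by
    simp only [Finset.sum_mul, Finset.mul_sum]
    rw [Finset.sum_comm]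
    exact Finset.sum_congr rfl fun _ _ => Finset.sum_congr rfl fun _ _ => by ring
  have e3 : ∑ i, hess g u k i y * ∑ j, (g y)⁻¹ i j * hess g u l j y =
      ∑ i, ∑ j, hess g u k i y * (g y)⁻¹ i j * hess g u l j y := by
    simp only [Finset.mul_sum, mul_assoc]
  rw [show hess g (gradSq g u) l k y = pd l (pd k (gradSq g u)) y -
    ∑ m, christoffel g m l k y * pd m (gradSq g u) y from rfl, h1]
  simp only [hg.pd_gradSq hu hy, hg.pd_grad hu hy, e2]
  simp only [covHess, Finset.sum_add_distrib, Finset.sum_sub_distrib, mul_sub, add_mul, sub_mul,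
    e1, e3]
  ring

theorem MetricOn.contract_riemann (hg : MetricOn T g) (hy : y ∈ T)
    (l i : Fin n) : ∑ k, (g y)⁻¹ l k * ∑ p, riemann g p k l i y * pd p u y =
      -∑ q, riemann g l q l i y * grad g u q y := by
  have h1 : ∀ k, ∑ p, riemann g p k l i y * pd p u y =
      -∑ q, ∑ p, g y k p * (riemann g p q l i y * grad g u q y) := by
    intro k
    simp only [← hg.lower_grad (u := u) hy, Finset.mul_sum]
    rw [Finset.sum_comm, ← Finset.sum_neg_distrib]
    refine Finset.sum_congr rfl fun q _ => ?_
    have := hg.lower_riemann_antisymm hy q k l i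
    simp only [← mul_assoc, ← Finset.sum_mul]
    rw [← neg_mul, ← this]
    congr 1
    exact Finset.sum_congr rfl fun p _ => by rw [hg.symm hy p q]; ring
  simp only [h1, mul_neg, Finset.sum_neg_distrib]
  congr 1
  simp only [Finset.mul_sum]
  rw [Finset.sum_comm]
  refine Finset.sum_congr rfl fun q _ => ?_
  rw [Finset.sum_comm]
  simp only [← mul_assoc, ← Finset.sum_mul, hg.inv_mul hy]
  simp

/-- The Bochner formula. -/
theorem MetricOn.bochner (hg : MetricOn T g) (hu : ContDiffOn ℝ ∞ u T) (hy : y ∈ T) :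
    laplacian g (gradSq g u) y = 2 * (hessSq g u y +
      ∑ j, ∑ k, ricci g j k y * grad g u j y * grad g u k y +
      ∑ i, grad g u i y * pd i (laplacian g u) y) := by
  have h1 : laplacian g (gradSq g u) y = 2 * (hessSq g u y +
      ∑ i, grad g u i y * ∑ l, ∑ k, (g y)⁻¹ l k * covHess g u l k i y) := by
    rw [laplacian_eq]
    simp only [hg.hess_gradSq hu hy, hessSq]
    rw [mul_add, add_comm (2 * _)]
    have : ∀ l k : Fin n, (g y)⁻¹ l k * (2 * (∑ i, covHess g u l k i y * grad g u i y +
        ∑ i, ∑ j, hess g u k i y * (g y)⁻¹ i j * hess g u l j y)) =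
        2 * ((g y)⁻¹ l k * ∑ i, covHess g u l k i y * grad g u i y) +
        2 * ((g y)⁻¹ l k * ∑ i, ∑ j, hess g u k i y * (g y)⁻¹ i j * hess g u l j y) := by
      intro l k; ring
    simp only [this, Finset.sum_add_distrib, ← Finset.mul_sum]
    congr 2
    simp only [Finset.mul_sum]
    rw [Finset.sum_comm (γ := Fin n) (s := Finset.univ) (f := fun i l =>
      ∑ k, grad g u i y * ((g y)⁻¹ l k * covHess g u l k i y))]
    refine Finset.sum_congr rfl fun l _ => ?_
    rw [Finset.sum_comm]
    exact Finset.sum_congr rfl fun _ _ => Finset.sum_congr rfl fun _ _ => by ring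
  have h2 : ∀ i, ∑ l, ∑ k, (g y)⁻¹ l k * covHess g u l k i y =
      pd i (laplacian g u) y + ∑ q, ricci g i q y * grad g u q y := by
    intro i
    have e1 : ∀ l k, covHess g u l k i y = covHess g u i k l y -
        ∑ p, riemann g p k l i y * pd p u y := by
      intro l k
      linarith [hg.covHess_sub hu hy l i k]
    simp only [e1, mul_sub, Finset.sum_sub_distrib, hg.contract_riemann hy,
      sub_neg_eq_add, Finset.sum_add_distrib]
    congr 1
    · rw [hg.pd_laplacian hu hy, Finset.sum_comm]
      exact Finset.sum_congr rfl fun _ _ => Finset.sum_congr rfl fun _ _ => by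
        rw [hg.inv_symm hy]
    · simp only [ricci_eq_riemann, Finset.sum_mul]
      rw [Finset.sum_comm]
  rw [h1]
  simp only [h2, mul_add, Finset.sum_add_distrib]
  have e : ∑ i, grad g u i y * ∑ q, ricci g i q y * grad g u q y =
      ∑ j, ∑ k, ricci g j k y * grad g u j y * grad g u k y := by
    simp only [Finset.mul_sum]
    exact Finset.sum_congr rfl fun _ _ => Finset.sum_congr rfl fun _ _ => by ring
  rw [e]; ring

theorem MetricOn.gradSq_nonneg (hg : MetricOn T g) (hy : y ∈ T) : 0 ≤ gradSq g u y := by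
  have := (hg.posDef y hy).inv.posSemidef.dotProduct_mulVec_nonneg (fun i => pd i u y)
  simpa [gradSq, grad, dotProduct, Matrix.mulVec] using this

theorem MetricOn.metricForm_grad (hg : MetricOn T g) (hy : y ∈ T) :
    metricForm g (fun i => grad g u i y) y = gradSq g u y := by
  simp only [metricForm, gradSq, ← hg.lower_grad (u := u) hy]
  simp only [Finset.sum_mul]
  refine Finset.sum_congr rfl fun i _ => Finset.sum_congr rfl fun j _ => ?_
  ring

/-- `|∇|∇u|²|² ≤ 4 |∇²u|² |∇u|²`. -/
theorem MetricOn.quadForm_pd_gradSq_le (hg : MetricOn T g) (hu : ContDiffOn ℝ ∞ u T)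
    (hy : y ∈ T) : ∑ i, ∑ j, (g y)⁻¹ i j * (pd i (gradSq g u) y / 2) * (pd j (gradSq g u) y / 2) ≤
      hessSq g u y * gradSq g u y := by
  have h := quadForm_mulVec_le (H := Matrix.of fun i j => hess g u i j y)
    (hg.posDef y hy).inv.posSemidef (fun i => pd i u y)
  have e0 : ((g y)⁻¹).mulVec (fun i => pd i u y) = fun i => grad g u i y := rfl
  have e1 : (Matrix.of fun i j => hess g u i j y).mulVec (fun i => grad g u i y) =
      fun i => pd i (gradSq g u) y / 2 := by
    funext k
    rw [hg.pd_gradSq hu hy]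
    simp [Matrix.mulVec, dotProduct]
  rw [e0, e1] at h
  have e2 : ((g y)⁻¹ * (Matrix.of fun i j => hess g u i j y) * (g y)⁻¹ *
      (Matrix.of fun i j => hess g u i j y).transpose).trace = hessSq g u y := by
    rw [Matrix.mul_assoc, Matrix.mul_assoc]
    simp only [Matrix.trace, Matrix.diag, Matrix.mul_apply, Matrix.transpose_apply,
      Matrix.of_apply, hessSq, Finset.mul_sum]
    refine Finset.sum_congr rfl fun l _ => Finset.sum_congr rfl fun k _ =>
      Finset.sum_congr rfl fun i _ => Finset.sum_congr rfl fun j _ => by ring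
  rw [e2] at h
  refine le_trans (le_of_eq ?_) h
  simp only [dotProduct, Matrix.mulVec, Finset.mul_sum]
  refine Finset.sum_congr rfl fun i _ => Finset.sum_congr rfl fun j _ => by ring

variable {w : EuclideanSpace ℝ (Fin n) → Fin n → ℝ}

theorem MetricOn.covDerivForm_grad (hg : MetricOn T g) (hy : y ∈ T) :
    covDerivForm g w (fun i => grad g u i y) y =
      ∑ j, ∑ k, pd k u y * covDeriv g w j k y * grad g u j y := by
  unfold covDerivForm
  rw [Finset.sum_comm]
  refine Finset.sum_congr rfl fun j _ => ?_
  rw [Finset.sum_comm]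
  refine Finset.sum_congr rfl fun k _ => ?_
  rw [← hg.lower_grad (u := u) hy k]
  simp only [Finset.sum_mul]
  exact Finset.sum_congr rfl fun i _ => by rw [hg.symm hy i k]; ring

/-- `⟨∇u, ∇⟨w, ∇u⟩⟩ = ⟨∇_{∇u} w, ∇u⟩ + ½ ⟨w, ∇|∇u|²⟩`. -/
theorem MetricOn.grad_pd_drift (hg : MetricOn T g) (hu : ContDiffOn ℝ ∞ u T)
    (hw : ∀ k, ContDiffOn ℝ ∞ (fun z => w z k) T) (hy : y ∈ T) :
    ∑ i, grad g u i y * pd i (fun z => ∑ k, w z k * pd k u z) y =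
      covDerivForm g w (fun i => grad g u i y) y +
        (∑ k, w y k * pd k (gradSq g u) y) / 2 := by
  have hT := hg.relOpen
  have h1 : ∀ i, pd i (fun z => ∑ k, w z k * pd k u z) y =
      ∑ k, (pd i (fun z => w z k) y * pd k u y + w y k * pd i (pd k u) y) := by
    intro i
    rw [hT.pd_sum _ (fun k _ => (hw k).mul (hT.contDiffOn_pd hu k)) hy]
    exact Finset.sum_congr rfl fun k _ => hT.pd_mul (hw k) (hT.contDiffOn_pd hu k) hy i
  rw [hg.covDerivForm_grad hy]
  simp only [h1, hg.pd_gradSq hu hy, covDeriv]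
  have e1 : (∑ k, w y k * (2 * ∑ i, hess g u k i y * grad g u i y)) / 2 =
      ∑ i, grad g u i y * ∑ k, w y k * hess g u k i y := by
    rw [Finset.sum_div]
    simp only [Finset.mul_sum, Finset.sum_div]
    rw [Finset.sum_comm]
    exact Finset.sum_congr rfl fun _ _ => Finset.sum_congr rfl fun _ _ => by ring
  rw [e1, ← Finset.sum_add_distrib]
  refine Finset.sum_congr rfl fun j _ => ?_
  have e2 : ∑ k, w y k * hess g u k j y = ∑ k, w y k * pd j (pd k u) y -
      ∑ k, pd k u y * ∑ l, christoffel g k j l y * w y l := by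
    simp only [hess, mul_sub, Finset.sum_sub_distrib, Finset.mul_sum]
    congr 1
    · exact Finset.sum_congr rfl fun k _ => by rw [hT.pd_comm hu hy]
    · rw [Finset.sum_comm]
      exact Finset.sum_congr rfl fun k _ => Finset.sum_congr rfl fun l _ => by
        rw [hg.christoffel_symm hy k j l]; ring
  rw [e2]
  simp only [← Finset.sum_mul, mul_add, Finset.sum_add_distrib]
  have e3 : ∑ k, pd j (fun z => w z k) y * pd k u y = ∑ k, pd k u y * pd j (fun z => w z k) y :=
    Finset.sum_congr rfl fun k _ => mul_comm _ _
  rw [e3]; ring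

/-- The Laplacian with drift, `Δ - 2 ⟨w, ∇ ·⟩`. -/
def driftLaplacian (g : EuclideanSpace ℝ (Fin n) → Matrix (Fin n) (Fin n) ℝ)
    (w : EuclideanSpace ℝ (Fin n) → Fin n → ℝ) (f : EuclideanSpace ℝ (Fin n) → ℝ)
    (y : EuclideanSpace ℝ (Fin n)) : ℝ :=
  laplacian g f y - 2 * ∑ k, w y k * pd k f y

/-- The Bochner inequality for a solution of `Δu - 2 ⟨w, ∇u⟩ = -μ u`. -/
theorem MetricOn.drift_bochner (hg : MetricOn T g) (hu : ContDiffOn ℝ ∞ u T)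
    (hw : ∀ k, ContDiffOn ℝ ∞ (fun z => w z k) T) {μ κ : ℝ}
    (hpde : ∀ z ∈ T, driftLaplacian g w u z = -μ * u z) (hy : y ∈ T)
    (hric : ∀ v : Fin n → ℝ, 0 ≤ ∑ j, ∑ k, ricci g j k y * v j * v k)
    (hcov : ∀ v : Fin n → ℝ, κ * metricForm g v y ≤ covDerivForm g w v y) :
    2 * hessSq g u y + (4 * κ - 2 * μ) * gradSq g u y ≤ driftLaplacian g w (gradSq g u) y := by
  have hT := hg.relOpen
  have hs : ContDiffOn ℝ ∞ (fun z => ∑ k, w z k * pd k u z) T :=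
    ContDiffOn.sum fun k _ => (hw k).mul (hT.contDiffOn_pd hu k)
  have h1 : ∀ i, pd i (laplacian g u) y =
      -μ * pd i u y + 2 * pd i (fun z => ∑ k, w z k * pd k u z) y := by
    intro i
    have e : EqOn (laplacian g u) (fun z => -μ * u z + 2 * ∑ k, w z k * pd k u z) T := by
      intro z hz
      have := hpde z hz
      unfold driftLaplacian at this
      simp only
      linarith
    rw [hT.pd_congr hy e, hT.pd_add (contDiffOn_const.mul hu) (contDiffOn_const.mul hs) hy,
      hT.pd_const_mul hu _ hy, hT.pd_const_mul hs _ hy]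
  have h2 : ∑ i, grad g u i y * pd i (laplacian g u) y = -μ * gradSq g u y +
      2 * (covDerivForm g w (fun i => grad g u i y) y +
        (∑ k, w y k * pd k (gradSq g u) y) / 2) := by
    rw [← hg.grad_pd_drift hu hw hy, gradSq, Finset.mul_sum, Finset.mul_sum,
      ← Finset.sum_add_distrib]
    exact Finset.sum_congr rfl fun i _ => by rw [h1]; ring
  have h3 := hcov fun i => grad g u i y
  rw [hg.metricForm_grad hy] at h3
  have h4 := hric fun i => grad g u i y
  unfold driftLaplacian
  rw [hg.bochner hu hy, h2]
  linarith

end Bochner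

end RiemannianGap

namespace RiemannianGap

open Set Filter Topology

/-! ### First and second order conditions at a maximum -/

theorem nonneg_of_hasDerivWithinAt_of_eventually_le {ψ : ℝ → ℝ} {d t₀ : ℝ}
    (h : HasDerivWithinAt ψ d (Ioi t₀) t₀) (hm : ∀ᶠ t in 𝓝[>] t₀, ψ t₀ ≤ ψ t) : 0 ≤ d := by
  rw [hasDerivWithinAt_iff_tendsto_slope' (by simp)] at h
  refine ge_of_tendsto h ?_
  filter_upwards [hm, self_mem_nhdsWithin] with t ht ht'
  rw [slope_def_field]
  exact div_nonneg (sub_nonneg.2 ht) (sub_nonneg.2 (le_of_lt ht'))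

theorem deriv_deriv_nonpos_of_isLocalMax {φ : ℝ → ℝ} {t₀ : ℝ} (h : IsLocalMax φ t₀)
    (hc : ContinuousAt φ t₀) : deriv (deriv φ) t₀ ≤ 0 := by
  by_contra hpos
  have hmin := isLocalMin_of_deriv_deriv_pos (not_le.1 hpos) h.deriv_eq_zero hc
  have heq : φ =ᶠ[𝓝 t₀] fun _ => φ t₀ := by
    filter_upwards [h, hmin] with t h1 h2 using le_antisymm h1 h2
  have := heq.deriv.deriv.eq_of_nhds
  simp only [deriv_const'] at this
  exact hpos this.le

section CoordinateMax

variable {n : ℕ} [NeZero n] {T : Set (EuclideanSpace ℝ (Fin n))}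
  {g : EuclideanSpace ℝ (Fin n) → Matrix (Fin n) (Fin n) ℝ}
  {f u : EuclideanSpace ℝ (Fin n) → ℝ} {y p : EuclideanSpace ℝ (Fin n)}

theorem RelOpen.fderivWithin_apply (hT : RelOpen T) (hy : y ∈ T)
    (v : EuclideanSpace ℝ (Fin n)) : fderivWithin ℝ f T y v = ∑ i, v i * pd i f y := by
  have hv : v = ∑ i, v i • (EuclideanSpace.single i 1 : EuclideanSpace ℝ (Fin n)) := by
    ext j
    simp [Pi.single_apply]
  conv_lhs => rw [hv]
  simp only [map_sum, map_smul, smul_eq_mul, hT.pd_eq hy]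

theorem RelOpen.hasDerivWithinAt_line (hT : RelOpen T) (hf : ContDiffOn ℝ ∞ f T) (hy : y ∈ T)
    (v : EuclideanSpace ℝ (Fin n)) {s : Set ℝ} (hs : ∀ᶠ t in 𝓝[s] (0 : ℝ), y + t • v ∈ T) :
    HasDerivWithinAt (fun t : ℝ => f (y + t • v)) (∑ i, v i * pd i f y) s 0 := by
  have h1 : HasDerivWithinAt (fun t : ℝ => y + t • v) v (s ∩ {t | y + t • v ∈ T}) 0 := by
    have : HasDerivAt (fun t : ℝ => y + t • v) v 0 := by
      simpa using ((hasDerivAt_id (0 : ℝ)).smul_const v).const_add y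
    exact this.hasDerivWithinAt
  have hy' : y = y + (0 : ℝ) • v := by simp
  have h2 : HasFDerivWithinAt f (fderivWithin ℝ f T y) T (y + (0 : ℝ) • v) := by
    rw [← hy']
    exact (diffWithin hf hy).hasFDerivWithinAt
  have h3 := h2.comp_hasDerivWithinAt (0 : ℝ) h1 (fun t ht => ht.2)
  rw [hT.fderivWithin_apply hy] at h3
  exact h3.mono_of_mem_nhdsWithin (inter_mem self_mem_nhdsWithin hs)

omit [NeZero n] in
theorem continuous_line (y v : EuclideanSpace ℝ (Fin n)) :
    Continuous fun t : ℝ => y + t • v := by fun_prop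

theorem RelOpen.eventually_line_mem (hT : RelOpen T) (hy : y ∈ T)
    (v : EuclideanSpace ℝ (Fin n)) {s : Set ℝ}
    (hs : ∀ᶠ t in 𝓝[s] (0 : ℝ), 0 ≤ (y + t • v) 0) : ∀ᶠ t in 𝓝[s] (0 : ℝ), y + t • v ∈ T := by
  have h1 := mem_nhdsWithin_iff_eventually.1 (hT.mem_nhdsWithin y hy)
  have h2 : Tendsto (fun t : ℝ => y + t • v) (𝓝[s] 0) (𝓝 y) := by
    have := (continuous_line y v).tendsto 0
    simp only [zero_smul, add_zero] at this
    exact this.mono_left nhdsWithin_le_nhds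
  filter_upwards [h2.eventually h1, hs] with t ht ht'
  exact ht (mem_halfSpace.2 ht')

theorem RelOpen.sum_pd_eq_zero_of_tangent (hT : RelOpen T) (hf : ContDiffOn ℝ ∞ f T)
    (hf0 : ∀ z ∈ T, z 0 = 0 → f z = 0) (hy : y ∈ T) (hy0 : y 0 = 0)
    (v : EuclideanSpace ℝ (Fin n)) (hv : v 0 = 0) : ∑ i, v i * pd i f y = 0 := by
  have hz : ∀ t : ℝ, (y + t • v) 0 = 0 := fun t => by simp [hy0, hv]
  have hs : ∀ᶠ t in 𝓝[univ] (0 : ℝ), y + t • v ∈ T :=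
    hT.eventually_line_mem hy v (Eventually.of_forall fun t => (hz t).ge)
  have h1 := hT.hasDerivWithinAt_line hf hy v hs
  rw [hasDerivWithinAt_univ] at h1
  rw [nhdsWithin_univ] at hs
  have h2 : (fun t : ℝ => f (y + t • v)) =ᶠ[𝓝 0] fun _ => 0 := by
    filter_upwards [hs] with t ht using hf0 _ ht (hz t)
  rw [← h1.deriv, h2.deriv_eq]
  simp

theorem RelOpen.pd_eq_zero_of_boundary_max (hT : RelOpen T) (hf : ContDiffOn ℝ ∞ f T)
    (hy : y ∈ T) (hmax : ∀ z ∈ T, f z ≤ f y) {k : Fin n} (hk : k ≠ 0) : pd k f y = 0 := by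
  set v : EuclideanSpace ℝ (Fin n) := EuclideanSpace.single k 1
  have hz : ∀ t : ℝ, 0 ≤ (y + t • v) 0 := fun t => by
    simpa [v, hk.symm] using hT.nonneg hy
  have hs := hT.eventually_line_mem hy v (s := univ) (Eventually.of_forall hz)
  have h1 := hT.hasDerivWithinAt_line hf hy v hs
  rw [hasDerivWithinAt_univ] at h1
  rw [nhdsWithin_univ] at hs
  have h2 : IsLocalMax (fun t : ℝ => f (y + t • v)) 0 := by
    filter_upwards [hs] with t ht
    simpa using hmax _ ht
  have h3 := h2.hasDerivAt_eq_zero h1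
  rw [Finset.sum_eq_single k] at h3
  · simpa [v] using h3
  · intro b _ hb; simp [v, hb]
  · simp

theorem RelOpen.interior_max (hT : RelOpen T) (hf : ContDiffOn ℝ ∞ f T) (hy : y ∈ T)
    (hy0 : 0 < y 0) (hmax : IsLocalMax f y) : (∀ k, pd k f y = 0) ∧
      ∀ v : Fin n → ℝ, ∑ i, ∑ j, pd i (pd j f) y * v i * v j ≤ 0 := by
  have hfd : fderiv ℝ f y = 0 := hmax.fderiv_eq_zero
  refine ⟨fun k => by rw [hT.pd_eq_fderiv hy hy0, hfd]; rfl, fun v' => ?_⟩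
  set v : EuclideanSpace ℝ (Fin n) := WithLp.toLp 2 v'
  have hVo : ∀ᶠ t in 𝓝 (0 : ℝ), y + t • v ∈ T ∩ {z | 0 < z 0} := by
    have h2 : Tendsto (fun t : ℝ => y + t • v) (𝓝 0) (𝓝 y) := by
      simpa using (continuous_line y v).tendsto 0
    exact h2.eventually (inter_mem (hT.mem_nhds hy hy0)
      ((isOpen_lt continuous_const (continuous_coord 0)).mem_nhds hy0))
  have hderiv : ∀ {F : EuclideanSpace ℝ (Fin n) → ℝ}, ContDiffOn ℝ ∞ F T →
      ∀ z ∈ T ∩ {z | 0 < z 0}, HasDerivAt (fun t : ℝ => F (z + t • v))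
        (∑ i, v i * pd i F z) 0 := by
    intro F hF z hz
    rw [← hasDerivWithinAt_univ]
    refine hT.hasDerivWithinAt_line hF hz.1 v ?_
    rw [nhdsWithin_univ]
    have h2 : Tendsto (fun t : ℝ => z + t • v) (𝓝 0) (𝓝 z) := by
      simpa using (continuous_line z v).tendsto 0
    exact h2.eventually (hT.mem_nhds hz.1 hz.2)
  have h1 : deriv (fun t : ℝ => f (y + t • v)) =ᶠ[𝓝 0]
      fun t => ∑ j, v j * pd j f (y + t • v) := by
    filter_upwards [hVo] with t ht
    have h := hderiv hf _ ht
    have h' : HasDerivAt (fun s : ℝ => f (y + s • v)) (∑ i, v i * pd i f (y + t • v)) t := by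
      have := HasDerivAt.comp_sub_const (f := fun s : ℝ => f (y + t • v + s • v)) t t
        (by rw [sub_self]; exact h)
      refine this.congr_of_eventuallyEq (Eventually.of_forall fun s => ?_)
      simp only [add_assoc, ← add_smul]
      congr 3; ring
    exact h'.deriv
  have hG : ContDiffOn ℝ ∞ (fun z => ∑ j, v j * pd j f z) T :=
    ContDiffOn.sum fun j _ => contDiffOn_const.mul (hT.contDiffOn_pd hf j)
  have h2 : deriv (deriv fun t : ℝ => f (y + t • v)) 0 =
      ∑ i, v i * pd i (fun z => ∑ j, v j * pd j f z) y := by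
    rw [h1.deriv_eq]
    exact (hderiv hG y ⟨hy, hy0⟩).deriv
  have h3 : IsLocalMax (fun t : ℝ => f (y + t • v)) 0 := by
    have h2 : Tendsto (fun t : ℝ => y + t • v) (𝓝 0) (𝓝 y) := by
      simpa using (continuous_line y v).tendsto 0
    filter_upwards [h2.eventually hmax] with t ht
    simpa using ht
  have h4 := deriv_deriv_nonpos_of_isLocalMax h3 (hderiv hf y ⟨hy, hy0⟩).continuousAt
  rw [h2] at h4
  refine le_trans (le_of_eq ?_) h4
  refine Finset.sum_congr rfl fun i _ => ?_
  rw [hT.pd_sum _ (fun j _ => contDiffOn_const.mul (hT.contDiffOn_pd hf j)) hy, Finset.mul_sum]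
  refine Finset.sum_congr rfl fun j _ => ?_
  rw [hT.pd_const_mul (hT.contDiffOn_pd hf j) _ hy]
  simp only [v]
  ring

theorem MetricOn.laplacian_nonpos_of_max (hg : MetricOn T g) (hf : ContDiffOn ℝ ∞ f T)
    (hy : y ∈ T) (hy0 : 0 < y 0) (hmax : IsLocalMax f y) : laplacian g f y ≤ 0 := by
  obtain ⟨h1, h2⟩ := hg.relOpen.interior_max hf hy hy0 hmax
  have h3 := sum_mul_nonneg_of_posSemidef (hg.posDef y hy).inv.posSemidef
    (D := Matrix.of fun i j => -pd i (pd j f) y) (fun v => by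
      have := h2 v
      simp only [Matrix.of_apply, neg_mul, Finset.sum_neg_distrib]
      linarith)
  simp only [Matrix.of_apply, mul_neg, Finset.sum_neg_distrib] at h3
  simp only [laplacian, h1, mul_zero, Finset.sum_const_zero, sub_zero]
  linarith

/-! ### The normal derivative at a convex boundary -/

theorem MetricOn.inv_zero_zero_pos (hg : MetricOn T g) (hy : y ∈ T) : 0 < (g y)⁻¹ 0 0 :=
  (hg.posDef y hy).inv.diag_pos

theorem MetricOn.smooth_outwardNormal (hg : MetricOn T g) (k : Fin n) :
    ContDiffOn ℝ ∞ (fun z => outwardNormal g z k) T := by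
  unfold outwardNormal
  exact ((hg.smooth_inv k 0).neg).div ((hg.smooth_inv 0 0).sqrt
    fun z hz => (hg.inv_zero_zero_pos hz).ne') fun z hz =>
      (Real.sqrt_pos.2 (hg.inv_zero_zero_pos hz)).ne'

theorem MetricOn.sum_outwardNormal (hg : MetricOn T g) (hy : y ∈ T) :
    ∑ k, outwardNormal g y k * pd k u y = -grad g u 0 y / √((g y)⁻¹ 0 0) := by
  simp only [outwardNormal, grad]
  rw [← Finset.sum_neg_distrib, Finset.sum_div]
  exact Finset.sum_congr rfl fun k _ => by rw [hg.inv_symm hy k 0]; ring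

theorem MetricOn.normal_pd_gradSq_nonpos (hg : MetricOn T g) (hu : ContDiffOn ℝ ∞ u T)
    (hy : y ∈ T) (hy0 : y 0 = 0)
    (hNeu : ∀ z ∈ T, z 0 = 0 → ∑ k, outwardNormal g z k * pd k u z = 0)
    (hconv : ∀ v : Fin n → ℝ, v 0 = 0 → 0 ≤ covDerivForm g (outwardNormal g) v y) :
    ∑ k, outwardNormal g y k * pd k (gradSq g u) y ≤ 0 := by
  have hT := hg.relOpen
  have h0 : grad g u 0 y = 0 := by
    have := hNeu y hy hy0
    rw [hg.sum_outwardNormal hy, neg_div, neg_eq_zero, div_eq_zero_iff] at this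
    exact this.resolve_right (Real.sqrt_pos.2 (hg.inv_zero_zero_pos hy)).ne'
  have h1 := hg.grad_pd_drift hu hg.smooth_outwardNormal hy
  have h2 := hT.sum_pd_eq_zero_of_tangent (ContDiffOn.sum fun k _ =>
    (hg.smooth_outwardNormal k).mul (hT.contDiffOn_pd hu k)) hNeu hy hy0
    (WithLp.toLp 2 fun i => grad g u i y) h0
  have h3 := hconv (fun i => grad g u i y) h0
  simp only at h2
  rw [h2] at h1
  linarith

theorem MetricOn.pd_zero_nonneg_of_boundary_max (hg : MetricOn T g) (hf : ContDiffOn ℝ ∞ f T)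
    (hy : y ∈ T) (hmax : ∀ z ∈ T, f z ≤ f y)
    (hn : ∑ k, outwardNormal g y k * pd k f y ≤ 0) : 0 ≤ pd 0 f y := by
  rw [Finset.sum_eq_single 0 (fun k _ hk => by
    rw [hg.relOpen.pd_eq_zero_of_boundary_max hf hy hmax hk, mul_zero]) (by simp)] at hn
  have hpos := hg.inv_zero_zero_pos hy
  have : outwardNormal g y 0 < 0 := by
    unfold outwardNormal
    exact div_neg_of_neg_of_pos (neg_lt_zero.2 hpos) (Real.sqrt_pos.2 hpos)
  by_contra hlt
  exact absurd hn (not_le.2 (mul_pos_of_neg_of_neg this (not_le.1 hlt)))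

end CoordinateMax

end RiemannianGap

namespace RiemannianGap

open Set Filter Topology

/-! ### Lower bound for monotone covector fields along inward cones -/

section Cone

variable {n : ℕ} [NeZero n]

/-- The projection onto the boundary hyperplane. -/
def tangential (y : EuclideanSpace ℝ (Fin n)) : EuclideanSpace ℝ (Fin n) :=
  y - y 0 • EuclideanSpace.single 0 1

theorem tangential_zero (y : EuclideanSpace ℝ (Fin n)) : tangential y 0 = 0 := by
  simp [tangential]

omit [NeZero n] in
theorem abs_coord_le (y : EuclideanSpace ℝ (Fin n)) (i : Fin n) : |y i| ≤ ‖y‖ := by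
  simpa using PiLp.norm_apply_le y i

theorem norm_coord_smul_single (y : EuclideanSpace ℝ (Fin n)) :
    ‖y 0 • (EuclideanSpace.single 0 1 : EuclideanSpace ℝ (Fin n))‖ = |y 0| := by
  simp [norm_smul]

theorem norm_tangential_le (y : EuclideanSpace ℝ (Fin n)) : ‖tangential y‖ ≤ 2 * ‖y‖ := by
  have h1 := norm_sub_le y (y 0 • (EuclideanSpace.single 0 1 : EuclideanSpace ℝ (Fin n)))
  rw [norm_coord_smul_single] at h1
  have h2 := abs_coord_le y 0
  unfold tangential
  linarith

theorem continuous_tangential :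
    Continuous (tangential : EuclideanSpace ℝ (Fin n) → EuclideanSpace ℝ (Fin n)) := by
  unfold tangential; fun_prop

/-- A truncated cone at `p`, which widens in the inward direction. -/
def frustum (p : EuclideanSpace ℝ (Fin n)) (A R ε r : ℝ) : Set (EuclideanSpace ℝ (Fin n)) :=
  {y | ε ≤ y 0 ∧ y 0 ≤ r ∧ ‖tangential y - p‖ ≤ R + A * y 0}

/-- Unit ball of the boundary hyperplane. -/
def tangentBall (n : ℕ) [NeZero n] : Set (EuclideanSpace ℝ (Fin n)) :=
  {σ | σ 0 = 0 ∧ ‖σ‖ ≤ 1}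

theorem norm_sub_le_of_mem_frustum {p y : EuclideanSpace ℝ (Fin n)} {A R ε r : ℝ} (hA : 0 ≤ A)
    (hε : 0 ≤ ε) (hy : y ∈ frustum p A R ε r) : ‖y - p‖ ≤ R + (A + 1) * r := by
  obtain ⟨h1, h2, h3⟩ := hy
  have e : y - p = (tangential y - p) + y 0 • (EuclideanSpace.single 0 1) := by
    unfold tangential; abel
  have h4 := norm_add_le (tangential y - p)
    (y 0 • (EuclideanSpace.single 0 1 : EuclideanSpace ℝ (Fin n)))
  rw [norm_coord_smul_single, ← e, abs_of_nonneg (hε.trans h1)] at h4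
  have := mul_le_mul_of_nonneg_left h2 hA
  linarith

theorem isCompact_frustum {p : EuclideanSpace ℝ (Fin n)} {A R ε r : ℝ} (hA : 0 ≤ A)
    (hε : 0 ≤ ε) : IsCompact (frustum p A R ε r) := by
  refine Metric.isCompact_of_isClosed_isBounded ?_ ?_
  · exact (isClosed_le continuous_const (continuous_coord 0)).inter
      ((isClosed_le (continuous_coord 0) continuous_const).inter
      (isClosed_le (continuous_tangential.sub continuous_const).norm
        (continuous_const.add (continuous_const.mul (continuous_coord 0)))))
  · refine (Metric.isBounded_closedBall (x := p) (r := R + (A + 1) * r)).subset fun y hy => ?_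
    rw [mem_closedBall_iff_norm]
    exact norm_sub_le_of_mem_frustum hA hε hy

theorem isCompact_tangentBall : IsCompact (tangentBall n) := by
  refine Metric.isCompact_of_isClosed_isBounded ?_ ?_
  · exact (isClosed_singleton.preimage (continuous_coord (n := n) 0)).inter
      (isClosed_le continuous_norm continuous_const)
  · refine (Metric.isBounded_closedBall (x := 0) (r := 1)).subset fun y hy => ?_
    simpa using hy.2

/-- The outward directions of slope at most `A + b y⁰`. -/
def coneDir (A b : ℝ) (y σ : EuclideanSpace ℝ (Fin n)) : EuclideanSpace ℝ (Fin n) :=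
  -EuclideanSpace.single 0 1 + (A + b * y 0) • σ

theorem coneDir_zero {A b : ℝ} {y σ : EuclideanSpace ℝ (Fin n)} (hσ : σ 0 = 0) :
    coneDir A b y σ 0 = -1 := by
  simp [coneDir, hσ]

theorem continuous_coneDir (A b : ℝ) : Continuous
    fun z : EuclideanSpace ℝ (Fin n) × EuclideanSpace ℝ (Fin n) => coneDir A b z.1 z.2 := by
  unfold coneDir; fun_prop

/-- The acceleration `Q` perturbs the cone of slope `a` only by directions that a tilt of rate `b`
and a rescaling of rate `μ` absorb. -/
theorem exists_coneDir_eq {a b μ q : ℝ} (ha : 0 < a) {Q σ : EuclideanSpace ℝ (Fin n)}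
    (hQ : ‖Q‖ ≤ q) (hσ : σ ∈ tangentBall n) (hb : (2 + a) * q ≤ b) (hμ : b ≤ μ * a)
    (hμq : q < μ) : ∃ s, 0 < s ∧ s ≤ μ + q ∧ ∃ σ' ∈ tangentBall n,
      Q - b • σ = s • (-EuclideanSpace.single 0 1 + a • σ') -
        μ • (-EuclideanSpace.single 0 1 + a • σ) := by
  have hQ0 := abs_le.1 ((abs_coord_le Q 0).trans hQ)
  have hs : 0 < μ - Q 0 := by linarith
  set s := μ - Q 0
  set τ : EuclideanSpace ℝ (Fin n) := tangential Q + (μ * a - b) • σ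
  refine ⟨s, hs, by simp only [s]; linarith, (s * a)⁻¹ • τ, ⟨?_, ?_⟩, ?_⟩
  · simp [τ, tangential_zero, hσ.1]
  · rw [norm_smul, norm_inv, Real.norm_of_nonneg (by positivity), inv_mul_le_iff₀ (by positivity)]
    have h1 := norm_add_le (tangential Q) ((μ * a - b) • σ)
    rw [norm_smul, Real.norm_of_nonneg (by linarith)] at h1
    have h2 := norm_tangential_le Q
    have h3 := mul_le_mul_of_nonneg_left hσ.2 (show 0 ≤ μ * a - b by linarith)
    have h4 := mul_le_mul_of_nonneg_right hQ0.2 ha.le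
    simp only [s, τ] at *
    nlinarith
  · have h5 : s • a • (s * a)⁻¹ • τ = τ := by
      rw [smul_smul, smul_smul, mul_inv_cancel₀ (by positivity), one_smul]
    rw [smul_add, h5]
    simp only [τ, s, tangential, smul_add, smul_neg, sub_smul, mul_smul]
    abel

/-- First order condition for sliding inward along a cone direction. -/
theorem coneDir_slide {A b k : ℝ} {y σ : EuclideanSpace ℝ (Fin n)} (hσ : σ 0 = 0)
    {η : EuclideanSpace ℝ (Fin n) → EuclideanSpace ℝ (Fin n) →L[ℝ] ℝ}
    (hη : DifferentiableAt ℝ η y)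
    (hmin : ∀ᶠ t in 𝓝[>] (0 : ℝ), η y (coneDir A b y σ) - k * y 0 ≤
      η (y + t • (-coneDir A b y σ)) (coneDir A b (y + t • (-coneDir A b y σ)) σ) -
        k * (y + t • (-coneDir A b y σ)) 0) :
    0 ≤ -fderiv ℝ η y (coneDir A b y σ) (coneDir A b y σ) + b * η y σ - k := by
  set N := coneDir A b y σ with hN
  have hN0 : N 0 = -1 := coneDir_zero hσ
  have hl : HasDerivAt (fun t : ℝ => y + t • (-N)) (-N) 0 := by
    simpa using ((hasDerivAt_id (0 : ℝ)).smul_const (-N)).const_add y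
  have h1 : HasDerivAt (fun t : ℝ => η (y + t • (-N))) (fderiv ℝ η y (-N)) 0 := by
    have h2 : HasFDerivAt η (fderiv ℝ η y) (y + (0 : ℝ) • (-N)) := by
      simpa using hη.hasFDerivAt
    exact h2.comp_hasDerivAt (0 : ℝ) hl
  have h3 : HasDerivAt (fun t : ℝ => (-EuclideanSpace.single 0 1 : EuclideanSpace ℝ (Fin n))
      + (A + b * (y 0 + t)) • σ) (b • σ) 0 := by
    have : HasDerivAt (fun t : ℝ => A + b * (y 0 + t)) b 0 := by
      simpa using (((hasDerivAt_id (0 : ℝ)).const_add (y 0)).const_mul b).const_add A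
    exact (this.smul_const σ).const_add _
  have h5 : HasDerivAt (fun t : ℝ => k * (y 0 + t)) k 0 := by
    simpa using ((hasDerivAt_id (0 : ℝ)).const_add (y 0)).const_mul k
  have h6 := (h1.clm_apply h3).sub h5
  have e0 : -EuclideanSpace.single 0 1 + (A + b * (y 0 + 0)) • σ = N := by rw [add_zero]; rfl
  have e1 : ∀ t : ℝ, (y + t • (-N)) 0 = y 0 + t := fun t => by simp [hN0]
  have e2 : ∀ t : ℝ, coneDir A b (y + t • (-N)) σ =
      -EuclideanSpace.single 0 1 + (A + b * (y 0 + t)) • σ := fun t => by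
    rw [coneDir, e1]
  rw [e0, zero_smul, add_zero, map_neg, neg_apply, map_smul,
    smul_eq_mul] at h6
  refine nonneg_of_hasDerivWithinAt_of_eventually_le h6.hasDerivWithinAt ?_
  filter_upwards [hmin] with t ht
  simp only [e1, e2] at ht
  simp only [Pi.sub_apply, zero_smul, add_zero]
  exact ht

theorem frustum_slide {p y σ : EuclideanSpace ℝ (Fin n)} {A b R ε r t : ℝ}
    (hy : y ∈ frustum p (A + 1) R ε r) (hσ : σ ∈ tangentBall n) (ha0 : 0 ≤ A + b * y 0)
    (ha1 : b * y 0 ≤ 1) (ht0 : 0 ≤ t) (ht : t ≤ r - y 0) :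
    y + t • (-coneDir A b y σ) ∈ frustum p (A + 1) R ε r := by
  have hy'0 : (y + t • (-coneDir A b y σ)) 0 = y 0 + t := by simp [coneDir_zero hσ.1]
  refine ⟨?_, ?_, ?_⟩
  · rw [hy'0]; linarith [hy.1]
  · rw [hy'0]; linarith
  · have e : tangential (y + t • (-coneDir A b y σ)) - p =
        (tangential y - p) - (t * (A + b * y 0)) • σ := by
      unfold tangential
      rw [hy'0, coneDir]
      simp only [smul_add, smul_neg, neg_add, neg_neg, add_smul, mul_smul]
      abel
    rw [hy'0, e]
    refine (norm_sub_le _ _).trans ?_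
    rw [norm_smul, Real.norm_of_nonneg (mul_nonneg ht0 ha0)]
    have h1 : t * (A + b * y 0) * ‖σ‖ ≤ t * (A + b * y 0) * 1 :=
      mul_le_mul_of_nonneg_left hσ.2 (mul_nonneg ht0 ha0)
    have h2 : t * (A + b * y 0) ≤ t * (A + 1) := mul_le_mul_of_nonneg_left (by linarith) ht0
    have h3 := hy.2.2
    linarith

theorem norm_coneDir_le {A b : ℝ} {y σ : EuclideanSpace ℝ (Fin n)} (hσ : σ ∈ tangentBall n)
    (ha0 : 0 ≤ A + b * y 0) (ha1 : b * y 0 ≤ 1) : ‖coneDir A b y σ‖ ≤ A + 2 := by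
  refine (norm_add_le _ _).trans ?_
  rw [norm_neg, norm_smul, Real.norm_of_nonneg ha0]
  have : (A + b * y 0) * ‖σ‖ ≤ (A + b * y 0) * 1 := mul_le_mul_of_nonneg_left hσ.2 ha0
  simp only [PiLp.norm_single, norm_one]
  linarith

/-- Where a covector is negative on a cone direction and at least `-m` on the whole cone, it is at
least `-sm` on the corresponding acceleration. -/
theorem acceleration_lower_bound {A b q m : ℝ} {y σ Q : EuclideanSpace ℝ (Fin n)}
    (hA : 0 < A) (hq0 : 0 ≤ q) (hb : b = (A + 3) * q) (hy0 : 0 ≤ y 0) (hby : b * y 0 ≤ 1)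
    (hσ : σ ∈ tangentBall n) (hQ : ‖Q‖ ≤ q) (hm : 0 < m) {l : EuclideanSpace ℝ (Fin n) →L[ℝ] ℝ}
    (hl : ∀ σ' ∈ tangentBall n, -m ≤ l (coneDir A b y σ')) (hneg : l (coneDir A b y σ) < 0) :
    -((b / A + q + 1 + q) * m) ≤ l Q - b * l σ := by
  have hb0 : 0 ≤ b := by rw [hb]; positivity
  have hby0 : 0 ≤ b * y 0 := mul_nonneg hb0 hy0
  have hbA : b / A * A = b := div_mul_cancel₀ b hA.ne'
  have hbA0 : 0 ≤ b / A := by positivity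
  obtain ⟨s', hs'0, hs's, σ', hσ', hdec⟩ := exists_coneDir_eq (a := A + b * y 0) (b := b)
    (μ := b / A + q + 1) (by linarith) hQ hσ (by rw [hb] at hby ⊢; nlinarith) (by
      have h1 : (b / A + q + 1) * A ≤ (b / A + q + 1) * (A + b * y 0) :=
        mul_le_mul_of_nonneg_left (by linarith) (by linarith)
      have h2 : (b / A + q + 1) * A = b + (q + 1) * A := by linear_combination hbA
      nlinarith) (by linarith)
  have hval := congrArg l hdec
  simp only [map_sub, map_smul, smul_eq_mul] at hval
  rw [hval]
  have h1 := mul_le_mul_of_nonneg_left (hl σ' hσ') hs'0.le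
  have h2 := mul_le_mul_of_nonneg_right hs's hm.le
  have h3 : (b / A + q + 1) * l (coneDir A b y σ) ≤ 0 :=
    mul_nonpos_of_nonneg_of_nonpos (by linarith) hneg.le
  simp only [coneDir] at h1 h3
  linarith

/-- Let `η` be a covector field on a half-ball, possibly unbounded near the flat boundary, with
`∂ᵥη(v) ≥ η(Q(v))` for a quadratically bounded `Q`. Then `η` is bounded below on outward
directions of bounded slope. -/
theorem cone_lower_bound {p : EuclideanSpace ℝ (Fin n)} (hp : p 0 = 0) {ρ K A : ℝ}
    (hρ : 0 < ρ) (hK : 0 ≤ K) (hA : 0 < A)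
    {η : EuclideanSpace ℝ (Fin n) → EuclideanSpace ℝ (Fin n) →L[ℝ] ℝ}
    {Q : EuclideanSpace ℝ (Fin n) → EuclideanSpace ℝ (Fin n) → EuclideanSpace ℝ (Fin n)}
    (h_η : ∀ y, 0 < y 0 → ‖y - p‖ < ρ → DifferentiableAt ℝ η y)
    (hQ : ∀ y v, 0 < y 0 → ‖y - p‖ < ρ → ‖Q y v‖ ≤ K * ‖v‖ ^ 2)
    (hmon : ∀ y v, 0 < y 0 → ‖y - p‖ < ρ → η y (Q y v) ≤ fderiv ℝ η y v v) :
    ∃ r > 0, ∃ C ≥ 0, ∀ y, 0 < y 0 → ‖y - p‖ < r → ∀ τ, τ 0 = 0 → ‖τ‖ ≤ A →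
      -C ≤ η y (-EuclideanSpace.single 0 1 + τ) := by
  set q := K * (A + 2) ^ 2 with hq
  have hq0 : 0 ≤ q := by positivity
  set b := (A + 3) * q with hb
  have hb0 : 0 ≤ b := by positivity
  set μ := b / A + q + 1 with hμ
  have hμ0 : 0 < μ := by positivity
  set s := μ + q with hs
  have hs0 : 0 < s := by positivity
  set R := ρ / 4 with hR
  obtain ⟨r, hr0, hrb, hrs, hrρ⟩ : ∃ r, 0 < r ∧ b * r ≤ 1 ∧ 4 * s * r ≤ 1 ∧
      (A + 2) * r ≤ ρ / 4 := by
    refine ⟨min (1 / (b + 1)) (min (1 / (4 * s)) (ρ / 4 / (A + 2))), by positivity, ?_, ?_, ?_⟩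
    · have := min_le_left (1 / (b + 1)) (min (1 / (4 * s)) (ρ / 4 / (A + 2)))
      rw [le_div_iff₀ (by positivity)] at this
      have h0 : 0 ≤ min (1 / (b + 1)) (min (1 / (4 * s)) (ρ / 4 / (A + 2))) := by positivity
      nlinarith
    · have := (min_le_right (1 / (b + 1)) _).trans (min_le_left (1 / (4 * s)) (ρ / 4 / (A + 2)))
      rw [le_div_iff₀ (by positivity)] at this
      linarith
    · have := (min_le_right (1 / (b + 1)) _).trans (min_le_right (1 / (4 * s)) (ρ / 4 / (A + 2)))
      rw [le_div_iff₀ (by positivity)] at this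
      linarith
  set D := fun ε => frustum p (A + 1) R ε r with hD
  have hDin : ∀ ε, 0 < ε → ∀ y ∈ D ε, 0 < y 0 ∧ ‖y - p‖ < ρ := by
    intro ε hε y hy
    refine ⟨hε.trans_le hy.1, ?_⟩
    have := norm_sub_le_of_mem_frustum (by positivity) hε.le hy
    have e : (A + 1 + 1) * r = (A + 2) * r := by ring
    rw [e] at this
    linarith
  have hp' : tangential p = p := by simp [tangential, hp]
  have hDne : ∀ ε, 0 < ε → ε ≤ r → (D ε ×ˢ tangentBall n).Nonempty := by
    intro ε hε hεr
    refine ⟨(p + ε • EuclideanSpace.single 0 1, 0), ⟨?_, ?_, ?_⟩, ?_, ?_⟩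
    · simp [hp]
    · simp [hp, hεr]
    · have : tangential (p + ε • EuclideanSpace.single 0 1) = p := by simp [tangential, hp]
      rw [this, sub_self, norm_zero]
      simp only [PiLp.add_apply, hp, PiLp.smul_apply]
      simp
      positivity
    · simp
    · simp
  have hqc : ∀ ε, 0 < ε → ContinuousOn (fun z : EuclideanSpace ℝ (Fin n) ×
      EuclideanSpace ℝ (Fin n) => η z.1 (coneDir A b z.1 z.2)) (D ε ×ˢ tangentBall n) := by
    intro ε hε
    have h1 : ContinuousOn η (D ε) := fun y hy =>
      (h_η y (hDin ε hε y hy).1 (hDin ε hε y hy).2).continuousAt.continuousWithinAt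
    have h2 := h1.comp (continuous_fst (Y := EuclideanSpace ℝ (Fin n))).continuousOn
      (fun z (hz : z ∈ D ε ×ˢ tangentBall n) => hz.1)
    exact h2.clm_apply (continuous_coneDir A b).continuousOn
  have hcomp : ∀ ε, 0 < ε → IsCompact (D ε ×ˢ tangentBall n) := fun ε hε =>
    (isCompact_frustum (by positivity) hε.le).prod isCompact_tangentBall
  obtain ⟨C₀, hC₀, hC₀'⟩ : ∃ C₀ ≥ 0, ∀ y ∈ D r, ∀ σ ∈ tangentBall n,
      -C₀ ≤ η y (coneDir A b y σ) := by
    obtain ⟨z, hz, hzm⟩ := (hcomp r hr0).exists_isMinOn (hDne r hr0 le_rfl) (hqc r hr0)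
    refine ⟨|η z.1 (coneDir A b z.1 z.2)|, abs_nonneg _, fun y hy σ hσ => ?_⟩
    have h1 := hzm (show (y, σ) ∈ D r ×ˢ tangentBall n from ⟨hy, hσ⟩)
    simp only [mem_ofPred_eq] at h1
    linarith [neg_abs_le (η z.1 (coneDir A b z.1 z.2))]
  have key : ∀ ε, 0 < ε → ε ≤ r → ∀ y ∈ D ε, ∀ σ ∈ tangentBall n,
      -(2 * C₀) ≤ η y (coneDir A b y σ) := by
    intro ε hε hεr
    obtain ⟨z₁, hz₁, hmin₁⟩ := (hcomp ε hε).exists_isMinOn (hDne ε hε hεr) (hqc ε hε)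
    have hm₁ : ∀ y ∈ D ε, ∀ σ ∈ tangentBall n,
        η z₁.1 (coneDir A b z₁.1 z₁.2) ≤ η y (coneDir A b y σ) := fun y hy σ hσ =>
      hmin₁ (show (y, σ) ∈ D ε ×ˢ tangentBall n from ⟨hy, hσ⟩)
    set m := -η z₁.1 (coneDir A b z₁.1 z₁.2) with hm
    suffices h : m ≤ 2 * C₀ by
      intro y hy σ hσ
      have := hm₁ y hy σ hσ
      linarith
    by_cases hmpos : m ≤ 0
    · linarith
    push Not at hmpos
    set k := 2 * s * m with hk
    have hk0 : 0 < k := by positivity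
    obtain ⟨⟨y, σ⟩, ⟨hyD, hσ⟩, hmin⟩ := (hcomp ε hε).exists_isMinOn (hDne ε hε hεr)
      ((hqc ε hε).sub (f := fun z : EuclideanSpace ℝ (Fin n) × EuclideanSpace ℝ (Fin n) =>
        η z.1 (coneDir A b z.1 z.2)) (g := fun z => k * z.1 0) (by fun_prop))
    have hm₂ : ∀ y' ∈ D ε, ∀ σ' ∈ tangentBall n, η y (coneDir A b y σ) - k * y 0 ≤
        η y' (coneDir A b y' σ') - k * y' 0 := fun y' hy' σ' hσ' =>
      hmin (show (y', σ') ∈ D ε ×ˢ tangentBall n from ⟨hy', hσ'⟩)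
    have hlow : -C₀ - k * r ≤ η y (coneDir A b y σ) - k * y 0 := by
      have hky : k * y 0 ≤ k * r := mul_le_mul_of_nonneg_left hyD.2.1 hk0.le
      rcases hyD.2.1.lt_or_eq with hyr | hyr
      · by_cases hqpos : 0 ≤ η y (coneDir A b y σ)
        · linarith
        push Not at hqpos
        exfalso
        obtain ⟨hy0, hyρ⟩ := hDin ε hε y hyD
        have hby0 : 0 ≤ b * y 0 := mul_nonneg hb0 hy0.le
        have hby : b * y 0 ≤ 1 :=
          (mul_le_mul_of_nonneg_left hyr.le hb0).trans hrb
        have hNn := norm_coneDir_le (A := A) (b := b) hσ (by linarith) hby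
        have hQn : ‖Q y (coneDir A b y σ)‖ ≤ q := by
          refine (hQ y _ hy0 hyρ).trans ?_
          rw [hq]
          gcongr
        have hge : 0 ≤ -fderiv ℝ η y (coneDir A b y σ) (coneDir A b y σ) + b * η y σ - k := by
          refine coneDir_slide hσ.1 (h_η y hy0 hyρ) ?_
          have hr' : ∀ᶠ t in 𝓝[>] (0 : ℝ), t < r - y 0 :=
            nhdsWithin_le_nhds (Iio_mem_nhds (by linarith))
          filter_upwards [hr', self_mem_nhdsWithin] with t ht ht0
          exact hm₂ _ (frustum_slide hyD hσ (by linarith) hby (le_of_lt ht0) ht.le) σ hσ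
        have hmo := hmon y (coneDir A b y σ) hy0 hyρ
        have hacc := acceleration_lower_bound hA hq0 hb hy0.le hby hσ hQn hmpos
          (l := η y) (fun σ' hσ' => by simpa [hm] using hm₁ y hyD σ' hσ') hqpos
        have h11 : 0 < s * m := by positivity
        have h12 : k = 2 * (s * m) := by rw [hk]; ring
        linarith
      · have := hC₀' y ⟨hyr.ge, hyr.le, hyD.2.2⟩ σ hσ
        linarith
    have h1 := hm₂ z₁.1 hz₁.1 z₁.2 hz₁.2
    have h2 : 0 ≤ k * z₁.1 0 := mul_nonneg hk0.le (hDin ε hε z₁.1 hz₁.1).1.le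
    have h3 : k * r ≤ m / 2 := by
      have : 4 * s * r * m ≤ 1 * m := mul_le_mul_of_nonneg_right hrs hmpos.le
      rw [hk]; linarith
    linarith
  refine ⟨min r (R / 2), by positivity, 2 * C₀, by positivity, fun y hy0 hy τ hτ hτA => ?_⟩
  have hyr : y 0 ≤ r := by
    have h1 := abs_coord_le (y - p) 0
    simp only [PiLp.sub_apply, hp, sub_zero] at h1
    exact (le_abs_self _).trans (h1.trans (hy.le.trans (min_le_left _ _)))
  have hyD : y ∈ D (y 0) := by
    refine ⟨le_rfl, hyr, ?_⟩
    have e : tangential y - p = tangential (y - p) := by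
      have : tangential (y - p) = tangential y - tangential p := by
        unfold tangential
        simp only [PiLp.sub_apply, sub_smul]; abel
      rw [this, hp']
    rw [e]
    have h1 := norm_tangential_le (y - p)
    have h2 := hy.le.trans (min_le_right _ _)
    have h3 : 0 ≤ (A + 1) * y 0 := by positivity
    linarith
  have hpos : 0 < A + b * y 0 := by positivity
  have h := key (y 0) hy0 hyr y hyD ((A + b * y 0)⁻¹ • τ) ⟨by simp [hτ], by
    rw [norm_smul, norm_inv, Real.norm_of_nonneg hpos.le, inv_mul_le_iff₀ hpos]
    have : 0 ≤ b * y 0 := by positivity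
    linarith⟩
  rwa [coneDir, smul_smul, mul_inv_cancel₀ hpos.ne', one_smul] at h

end Cone

end RiemannianGap

namespace RiemannianGap

open Set Filter Topology

/-! ### The maximum principle at a boundary point, for a drift that may blow up there -/

section BoundaryMax

variable {n : ℕ} [NeZero n] {T : Set (EuclideanSpace ℝ (Fin n))}
  {g : EuclideanSpace ℝ (Fin n) → Matrix (Fin n) (Fin n) ℝ}
  {w : EuclideanSpace ℝ (Fin n) → Fin n → ℝ}
  {P u : EuclideanSpace ℝ (Fin n) → ℝ} {y p : EuclideanSpace ℝ (Fin n)}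

/-- The covector field `v ↦ ⟨w, v⟩`. -/
def lowerField (g : EuclideanSpace ℝ (Fin n) → Matrix (Fin n) (Fin n) ℝ)
    (w : EuclideanSpace ℝ (Fin n) → Fin n → ℝ) (y : EuclideanSpace ℝ (Fin n)) :
    EuclideanSpace ℝ (Fin n) →L[ℝ] ℝ :=
  ∑ j, (∑ i, g y i j * w y i) • EuclideanSpace.proj (𝕜 := ℝ) j

omit [NeZero n] in
theorem lowerField_apply (y v : EuclideanSpace ℝ (Fin n)) :
    lowerField g w y v = ∑ j, (∑ i, g y i j * w y i) * v j := by
  simp [lowerField]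

/-- The vector `Γᵏᵢⱼ vⁱ vʲ`. -/
def christoffelQuad (g : EuclideanSpace ℝ (Fin n) → Matrix (Fin n) (Fin n) ℝ)
    (y v : EuclideanSpace ℝ (Fin n)) : EuclideanSpace ℝ (Fin n) :=
  WithLp.toLp 2 fun k => ∑ i, ∑ j, christoffel g k i j y * v i * v j

omit [NeZero n] in
theorem norm_le_sum_abs (v : EuclideanSpace ℝ (Fin n)) : ‖v‖ ≤ ∑ i, |v i| := by
  have hv : v = ∑ i, v i • (EuclideanSpace.single i 1 : EuclideanSpace ℝ (Fin n)) := by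
    ext j
    simp [Pi.single_apply]
  conv_lhs => rw [hv]
  refine (norm_sum_le _ _).trans (le_of_eq ?_)
  exact Finset.sum_congr rfl fun i _ => by simp [norm_smul]

theorem norm_christoffelQuad_le (y v : EuclideanSpace ℝ (Fin n)) :
    ‖christoffelQuad g y v‖ ≤ (∑ k, ∑ i, ∑ j, |christoffel g k i j y|) * ‖v‖ ^ 2 := by
  refine (norm_le_sum_abs _).trans ?_
  simp only [Finset.sum_mul]
  refine Finset.sum_le_sum fun k _ => ?_
  change |∑ i, ∑ j, christoffel g k i j y * v i * v j| ≤ _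
  refine (Finset.abs_sum_le_sum_abs _ _).trans (Finset.sum_le_sum fun i _ => ?_)
  refine (Finset.abs_sum_le_sum_abs _ _).trans (Finset.sum_le_sum fun j _ => ?_)
  rw [abs_mul, abs_mul, mul_assoc, pow_two]
  gcongr
  · exact abs_coord_le v i
  · exact abs_coord_le v j

theorem MetricOn.contDiffOn_lowerField (hg : MetricOn T g)
    (hw : ∀ k, ContDiffOn ℝ ∞ (fun z => w z k) T) : ContDiffOn ℝ ∞ (lowerField g w) T :=
  ContDiffOn.sum fun j _ => (ContDiffOn.sum fun i _ => (hg.smooth i j).mul (hw i)).smul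
    contDiffOn_const

theorem MetricOn.fderiv_lowerField (hg : MetricOn T g)
    (hw : ∀ k, ContDiffOn ℝ ∞ (fun z => w z k) T) (hy : y ∈ T) (hy0 : 0 < y 0)
    (v : EuclideanSpace ℝ (Fin n)) : fderiv ℝ (lowerField g w) y v v =
      covDerivForm g w v y + lowerField g w y (christoffelQuad g y v) := by
  have hT := hg.relOpen
  have hd : DifferentiableAt ℝ (lowerField g w) y :=
    ((hg.contDiffOn_lowerField hw).contDiffAt (hT.mem_nhds hy hy0)).differentiableAt (by simp)
  have h1 : fderiv ℝ (lowerField g w) y v v = fderiv ℝ (fun z => lowerField g w z v) y v := by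
    rw [fderiv_clm_apply hd (differentiableAt_const v)]
    simp
  have hs := fun i j => ((hg.smooth i j).mul (hw i)).mul (contDiffOn_const (c := v j))
  rw [h1, ← fderivWithin_of_mem_nhds (hT.mem_nhds hy hy0), hT.fderivWithin_apply hy]
  have h2 : (fun z => lowerField g w z v) = fun z => ∑ j, ∑ i, g z i j * w z i * v j := by
    funext z
    simp only [lowerField_apply, Finset.sum_mul]
  have h3 : ∀ k, pd k (fun z => lowerField g w z v) y = ∑ j, ∑ i,
      (pd k (fun z => g z i j) y * w y i + g y i j * pd k (fun z => w z i) y) * v j := by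
    intro k
    rw [h2, hT.pd_sum _ (fun j _ => ContDiffOn.sum fun i _ => hs i j) hy]
    refine Finset.sum_congr rfl fun j _ => ?_
    rw [hT.pd_sum _ (fun i _ => hs i j) hy]
    refine Finset.sum_congr rfl fun i _ => ?_
    rw [hT.pd_mul ((hg.smooth i j).mul (hw i)) contDiffOn_const hy, hT.pd_const hy,
      hT.pd_mul (hg.smooth i j) (hw i) hy]
    ring
  simp only [h3]
  simp only [hg.pd_metric hy, lowerField_apply, christoffelQuad, covDerivForm, covDeriv]
  simp only [add_mul, mul_add, Finset.sum_add_distrib, Finset.sum_mul, Finset.mul_sum]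
  have e1 : ∑ k, ∑ j, ∑ i, v k * (g y i j * pd k (fun z => w z i) y * v j) =
      ∑ i, ∑ j, ∑ k, g y i k * pd j (fun z => w z k) y * v j * v i := by
    rw [Finset.sum_comm]
    refine Finset.sum_congr rfl fun j _ => Finset.sum_congr rfl fun k _ =>
      Finset.sum_congr rfl fun i _ => ?_
    rw [hg.symm hy i j]; ring
  have e2 : ∑ k, ∑ j, ∑ i, ∑ l, v k * (g y j l * christoffel g l k i y * w y i * v j) =
      ∑ i, ∑ j, ∑ k, ∑ l, g y i k * (christoffel g k j l y * w y l) * v j * v i := by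
    rw [Finset.sum_comm]
    refine Finset.sum_congr rfl fun j _ => Finset.sum_congr rfl fun k _ => ?_
    rw [Finset.sum_comm]
    refine Finset.sum_congr rfl fun l _ => Finset.sum_congr rfl fun i _ => by ring
  have e3 : ∑ k, ∑ j, ∑ i, ∑ l, v k * (g y i l * christoffel g l k j y * w y i * v j) =
      ∑ j, ∑ k, ∑ l, ∑ i, g y i j * w y i * (christoffel g j k l y * v k * v l) := by
    have : ∀ k, ∑ j, ∑ i, ∑ l, v k * (g y i l * christoffel g l k j y * w y i * v j) =
        ∑ l, ∑ j, ∑ i, g y i l * w y i * (christoffel g l k j y * v k * v j) := by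
      intro k
      rw [Finset.sum_comm (s := Finset.univ) (γ := Fin n) (f := fun l j =>
        ∑ i, g y i l * w y i * (christoffel g l k j y * v k * v j))]
      refine Finset.sum_congr rfl fun j _ => ?_
      rw [Finset.sum_comm]
      refine Finset.sum_congr rfl fun l _ => Finset.sum_congr rfl fun i _ => by ring
    simp only [this]
    rw [Finset.sum_comm]
  rw [e1, e2, e3]
  ring

/-- The barrier `y⁰ - |y - p|²`. -/
def barrier (p y : EuclideanSpace ℝ (Fin n)) : ℝ := y 0 - ‖y - p‖ ^ 2

theorem contDiff_barrier : ContDiff ℝ ∞ (barrier p) := by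
  unfold barrier
  have h1 : ContDiff ℝ ∞ fun y : EuclideanSpace ℝ (Fin n) => y 0 :=
    (EuclideanSpace.proj (𝕜 := ℝ) (0 : Fin n)).contDiff
  exact h1.sub ((contDiff_id.sub contDiff_const).norm_sq ℝ)

/-- The differential of the barrier. -/
def barrierGrad (p y : EuclideanSpace ℝ (Fin n)) : EuclideanSpace ℝ (Fin n) :=
  EuclideanSpace.single 0 1 - (2 : ℝ) • (y - p)

theorem RelOpen.pd_barrier (hT : RelOpen T) (hy : y ∈ T) (k : Fin n) :
    pd k (barrier p) y = barrierGrad p y k := by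
  have h1 : HasFDerivAt (fun y : EuclideanSpace ℝ (Fin n) => y 0)
      (EuclideanSpace.proj (𝕜 := ℝ) (0 : Fin n)) y :=
    (EuclideanSpace.proj (𝕜 := ℝ) (0 : Fin n)).hasFDerivAt
  have h2 := h1.sub (((hasFDerivAt_id y).sub_const p).norm_sq)
  rw [hT.pd_eq hy]
  have h3 : fderivWithin ℝ (barrier p) T y = _ :=
    h2.hasFDerivWithinAt.fderivWithin (hT.uniqueDiffOn y hy)
  rw [h3]
  simp [barrierGrad, EuclideanSpace.inner_single_right, eq_comm]

theorem continuous_barrierGrad : Continuous (barrierGrad p) := by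
  unfold barrierGrad; fun_prop

theorem RelOpen.exists_closedBall_subset (hT : RelOpen T) (hp : p ∈ T) :
    ∃ ρ > 0, ∀ y, 0 ≤ y 0 → ‖y - p‖ ≤ ρ → y ∈ T := by
  obtain ⟨ρ, hρ, h⟩ := Metric.mem_nhdsWithin_iff.1 (hT.mem_nhdsWithin p hp)
  refine ⟨ρ / 2, by positivity, fun y hy0 hy => h ⟨?_, mem_halfSpace.2 hy0⟩⟩
  rw [mem_ball_iff_norm]
  linarith

theorem isCompact_halfBall (p : EuclideanSpace ℝ (Fin n)) (ρ : ℝ) :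
    IsCompact {y : EuclideanSpace ℝ (Fin n) | 0 ≤ y 0 ∧ ‖y - p‖ ≤ ρ} := by
  have : {y : EuclideanSpace ℝ (Fin n) | 0 ≤ y 0 ∧ ‖y - p‖ ≤ ρ} =
      {y | 0 ≤ y 0} ∩ Metric.closedBall p ρ := by
    ext y; simp [dist_eq_norm]
  rw [this]
  exact (isCompact_closedBall p ρ).inter_left
    (isClosed_le continuous_const (continuous_coord 0))

theorem MetricOn.pair_barrierGrad (hg : MetricOn T g) (hy : y ∈ T)
    (v : EuclideanSpace ℝ (Fin n)) : ∑ k, w y k * v k =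
      lowerField g w y (WithLp.toLp 2 fun k => ∑ j, (g y)⁻¹ k j * v j) := by
  rw [lowerField_apply]
  simp only [Finset.sum_mul_sum]
  rw [Finset.sum_comm]
  refine Finset.sum_congr rfl fun i _ => ?_
  rw [Finset.sum_comm]
  have : ∀ j, ∑ x, g y i x * w y i * ((g y)⁻¹ x j * v j) =
      (if i = j then 1 else 0) * (w y i * v j) := by
    intro j
    rw [← hg.mul_inv hy, Finset.sum_mul]
    exact Finset.sum_congr rfl fun _ _ => by ring
  simp only [this]
  simp

/-- The derivative of the barrier along the drift is bounded above near the boundary. -/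
theorem MetricOn.exists_drift_barrier_le (hg : MetricOn T g) (hp : p ∈ T) (hp0 : p 0 = 0)
    (hw : ∀ k, ContDiffOn ℝ ∞ (fun z => w z k) (T ∩ {y | 0 < y 0}))
    (hcov : ∀ y ∈ T, 0 < y 0 → ∀ v : Fin n → ℝ, 0 ≤ covDerivForm g w v y) :
    ∃ ρ > 0, ∃ C ≥ 0, ∀ y ∈ T, 0 < y 0 → ‖y - p‖ < ρ → ∑ k, w y k * barrierGrad p y k ≤ C := by
  have hT := hg.relOpen
  have hgV := hg.mono hT.pos inter_subset_left
  obtain ⟨ρ₀, hρ₀, hball⟩ := hT.exists_closedBall_subset hp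
  obtain ⟨K, hK⟩ : ∃ K, ∀ y ∈ {y : EuclideanSpace ℝ (Fin n) | 0 ≤ y 0 ∧ ‖y - p‖ ≤ ρ₀},
      ‖∑ k, ∑ i, ∑ j, |christoffel g k i j y|‖ ≤ K := by
    refine (isCompact_halfBall p ρ₀).exists_bound_of_continuousOn ?_
    refine ContinuousOn.mono ?_ (fun y hy => hball y hy.1 hy.2 : _ ⊆ T)
    exact continuousOn_finsetSum _ fun k _ => continuousOn_finsetSum _ fun i _ =>
      continuousOn_finsetSum _ fun j _ => (hg.smooth_christoffel k i j).continuousOn.abs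
  set X : EuclideanSpace ℝ (Fin n) → EuclideanSpace ℝ (Fin n) := fun y =>
    WithLp.toLp 2 fun k => ∑ j, (g y)⁻¹ k j * barrierGrad p y j with hX
  have hXc : ContinuousOn X T := by
    refine (PiLp.continuous_toLp 2 _).comp_continuousOn (continuousOn_pi.2 fun k => ?_)
    exact continuousOn_finsetSum _ fun j _ => (hg.smooth_inv k j).continuousOn.mul
      ((continuous_coord j).comp continuous_barrierGrad).continuousOn
  have hXp : X p 0 = (g p)⁻¹ 0 0 := by
    simp [hX, barrierGrad]
  have hc0 := hg.inv_zero_zero_pos hp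
  set c := (g p)⁻¹ 0 0
  obtain ⟨ρ₁, hρ₁, h₁⟩ : ∃ ρ₁ > 0, ∀ y ∈ T, ‖y - p‖ < ρ₁ → c / 2 < X y 0 ∧ ‖X y‖ < ‖X p‖ + 1 := by
    have h1 : ∀ᶠ y in 𝓝[T] p, c / 2 < X y 0 ∧ ‖X y‖ < ‖X p‖ + 1 := by
      have h2 : ContinuousWithinAt (fun y => X y 0) T p :=
        ((continuous_coord 0).comp_continuousOn hXc) p hp
      have h3 : ContinuousWithinAt (fun y => ‖X y‖) T p := hXc.norm p hp
      exact (h2.eventually_const_lt (show c / 2 < X p 0 by rw [hXp]; linarith)).and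
        (h3.eventually_lt_const (by linarith))
    obtain ⟨ρ₁, hρ₁, h⟩ := Metric.mem_nhdsWithin_iff.1 h1
    exact ⟨ρ₁, hρ₁, fun y hy hy' => h ⟨mem_ball_iff_norm.2 hy', hy⟩⟩
  set C₁ := ‖X p‖ + 1
  have hC₁ : 0 < C₁ := by positivity
  obtain ⟨r, hr, C, hC, hcone⟩ := cone_lower_bound hp0 hρ₀ (abs_nonneg K)
    (A := (c / 2)⁻¹ * (2 * C₁)) (by positivity) (η := lowerField g w) (Q := christoffelQuad g)
    (fun y hy0 hy => ((hgV.contDiffOn_lowerField hw).contDiffAt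
      (hT.pos.mem_nhds ⟨hball y hy0.le hy.le, hy0⟩ hy0)).differentiableAt (by simp))
    (fun y v hy0 hy => (norm_christoffelQuad_le y v).trans (by
      have h1 := hK y ⟨hy0.le, hy.le⟩
      gcongr
      exact (le_abs_self _).trans (h1.trans (le_abs_self K))))
    (fun y v hy0 hy => by
      have hyT := hball y hy0.le hy.le
      rw [hgV.fderiv_lowerField hw ⟨hyT, hy0⟩ hy0]
      linarith [hcov y hyT hy0 v])
  refine ⟨min r ρ₁, by positivity, C₁ * C, by positivity, fun y hy hy0 hyr => ?_⟩
  obtain ⟨hX0, hXn⟩ := h₁ y hy (hyr.trans_le (min_le_right _ _))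
  have hX0' : 0 < X y 0 := lt_trans (by positivity) hX0
  rw [hg.pair_barrierGrad hy]
  change lowerField g w y (X y) ≤ _
  have hτ := hcone y hy0 (hyr.trans_le (min_le_left _ _)) (-((X y 0)⁻¹ • tangential (X y)))
    (by simp [tangential_zero]) (by
      rw [norm_neg, norm_smul, norm_inv, Real.norm_of_nonneg hX0'.le]
      have h1 : (X y 0)⁻¹ ≤ (c / 2)⁻¹ := inv_anti₀ (by positivity) hX0.le
      have h2 : ‖tangential (X y)‖ ≤ 2 * C₁ :=
        (norm_tangential_le _).trans (by linarith)
      gcongr)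
  have hdec : X y = (-X y 0) • (-EuclideanSpace.single 0 1 + -((X y 0)⁻¹ • tangential (X y))) := by
    rw [smul_add, smul_neg, neg_smul, neg_neg, smul_neg, neg_smul, neg_neg, smul_smul,
      mul_inv_cancel₀ hX0'.ne', one_smul, tangential]
    abel
  have hval := congrArg (lowerField g w y) hdec
  rw [map_smul, smul_eq_mul] at hval
  rw [hval]
  have h3 : X y 0 ≤ C₁ := (le_abs_self _).trans ((abs_coord_le _ 0).trans hXn.le)
  have h4 := mul_le_mul_of_nonneg_left hτ hX0'.le
  have h5 := mul_le_mul_of_nonneg_right h3 hC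
  linarith

theorem MetricOn.laplacian_add_const_mul (hg : MetricOn T g) {f h : EuclideanSpace ℝ (Fin n) → ℝ}
    (hf : ContDiffOn ℝ ∞ f T) (hh : ContDiffOn ℝ ∞ h T) (c : ℝ) (hy : y ∈ T) :
    laplacian g (fun z => f z + c * h z) y = laplacian g f y + c * laplacian g h y := by
  have hT := hg.relOpen
  have hch : ContDiffOn ℝ ∞ (fun z => c * h z) T := contDiffOn_const.mul hh
  have h1 : ∀ z ∈ T, ∀ k, pd k (fun z => f z + c * h z) z = pd k f z + c * pd k h z := by
    intro z hz k
    rw [hT.pd_add hf hch hz, hT.pd_const_mul hh _ hz]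
  have h2 : ∀ i j, pd i (pd j (fun z => f z + c * h z)) y =
      pd i (pd j f) y + c * pd i (pd j h) y := by
    intro i j
    rw [hT.pd_congr hy (fun z hz => h1 z hz j) i, hT.pd_add (hT.contDiffOn_pd hf j)
      (contDiffOn_const.mul (hT.contDiffOn_pd hh j)) hy,
      hT.pd_const_mul (hT.contDiffOn_pd hh j) _ hy]
  simp only [laplacian, h1 y hy, h2, Finset.mul_sum, ← Finset.sum_add_distrib]
  refine Finset.sum_congr rfl fun i _ => Finset.sum_congr rfl fun j _ => ?_
  simp only [mul_add, Finset.sum_add_distrib]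
  have : ∑ x, christoffel g x i j y * (c * pd x h y) =
      c * ∑ x, christoffel g x i j y * pd x h y := by
    rw [Finset.mul_sum]; exact Finset.sum_congr rfl fun _ _ => by ring
  rw [this]; ring

/-- At a boundary maximum with nonpositive outward derivative, there are interior points nearby
with almost vanishing differential and almost nonpositive drift Laplacian. -/
theorem MetricOn.boundary_max_principle (hg : MetricOn T g) (hp : p ∈ T) (hp0 : p 0 = 0)
    (hw : ∀ k, ContDiffOn ℝ ∞ (fun z => w z k) (T ∩ {y | 0 < y 0}))
    (hcov : ∀ y ∈ T, 0 < y 0 → ∀ v : Fin n → ℝ, 0 ≤ covDerivForm g w v y)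
    (hP : ContDiffOn ℝ ∞ P T) (hmax : ∀ y ∈ T, P y ≤ P p)
    (hlt : ∀ y ∈ T, 0 < y 0 → P y < P p) (hpd : 0 ≤ pd 0 P p) {δ : ℝ} (hδ : 0 < δ) :
    ∃ y ∈ T, 0 < y 0 ∧ ‖y - p‖ < δ ∧ (∀ k, |pd k P y| < δ) ∧ driftLaplacian g w P y < δ := by
  have hT := hg.relOpen
  have hbs : ContDiffOn ℝ ∞ (barrier p) T := contDiff_barrier.contDiffOn
  obtain ⟨ρ₀, hρ₀, hball⟩ := hT.exists_closedBall_subset hp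
  obtain ⟨ρ₁, hρ₁, C₁, hC₁, hdrift⟩ := hg.exists_drift_barrier_le hp hp0 hw hcov
  obtain ⟨C₂, hC₂⟩ : ∃ C, ∀ y ∈ {y : EuclideanSpace ℝ (Fin n) | 0 ≤ y 0 ∧ ‖y - p‖ ≤ ρ₀},
      ‖laplacian g (barrier p) y‖ ≤ C := by
    refine (isCompact_halfBall p ρ₀).exists_bound_of_continuousOn ?_
    exact (hg.smooth_laplacian hbs).continuousOn.mono (fun y hy => hball y hy.1 hy.2)
  have hC₂0 : 0 ≤ C₂ := (norm_nonneg _).trans (hC₂ p ⟨hp0.ge, by simpa using hρ₀.le⟩)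
  obtain ⟨ρ, hρ, hρ0', hρ1', hρδ, hρ1⟩ : ∃ ρ > 0, ρ ≤ ρ₀ ∧ ρ ≤ ρ₁ ∧ ρ < δ ∧ ρ < 1 := by
    refine ⟨min (min ρ₀ ρ₁) (min (δ / 2) (1 / 2)), by positivity,
      (min_le_left _ _).trans (min_le_left _ _), (min_le_left _ _).trans (min_le_right _ _),
      ?_, ?_⟩
    · exact lt_of_le_of_lt ((min_le_right _ _).trans (min_le_left _ _)) (by linarith)
    · exact lt_of_le_of_lt ((min_le_right _ _).trans (min_le_right _ _)) (by norm_num)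
  set A : Set (EuclideanSpace ℝ (Fin n)) := {y | 0 ≤ barrier p y ∧ ‖y - p‖ ≤ ρ} with hA
  have hA0 : ∀ y ∈ A, ‖y - p‖ ^ 2 ≤ y 0 := fun y hy => by
    have := hy.1; unfold barrier at this; linarith
  have hA0' : ∀ y ∈ A, 0 ≤ y 0 := fun y hy => (sq_nonneg _).trans (hA0 y hy)
  have hAT : A ⊆ T := fun y hy => hball y (hA0' y hy) (hy.2.trans hρ0')
  have hbc : Continuous (barrier p) := contDiff_barrier.continuous
  have hAc : IsCompact A := by
    have : A = {y | 0 ≤ barrier p y} ∩ Metric.closedBall p ρ := by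
      ext y; simp [hA, dist_eq_norm]
    rw [this]
    exact (isCompact_closedBall p ρ).inter_left (isClosed_le continuous_const hbc)
  have hble : ∀ y ∈ A, barrier p y ≤ ρ := fun y hy => by
    have h1 := abs_coord_le (y - p) 0
    simp only [PiLp.sub_apply, hp0, sub_zero] at h1
    have h2 := (le_abs_self _).trans (h1.trans hy.2)
    unfold barrier
    linarith [sq_nonneg ‖y - p‖]
  obtain ⟨d, hd, hdS⟩ : ∃ d > 0, ∀ y ∈ A, ‖y - p‖ = ρ → P y ≤ P p - d := by
    have hSc : IsCompact (A ∩ {y | ‖y - p‖ = ρ}) :=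
      hAc.inter_right (isClosed_eq (by fun_prop) continuous_const)
    rcases (A ∩ {y | ‖y - p‖ = ρ}).eq_empty_or_nonempty with he | hne
    · exact ⟨1, one_pos, fun y hy hy' => absurd (show y ∈ A ∩ {y | ‖y - p‖ = ρ} from ⟨hy, hy'⟩)
        (by rw [he]; simp)⟩
    · obtain ⟨z, hz, hzm⟩ := hSc.exists_isMaxOn hne
        (hP.continuousOn.mono (inter_subset_left.trans hAT))
      have hz0 : 0 < z 0 := lt_of_lt_of_le (by rw [hz.2]; positivity) (hA0 z hz.1)
      refine ⟨P p - P z, sub_pos.2 (hlt z (hAT hz.1) hz0), fun y hy hy' => ?_⟩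
      have : P y ≤ P z := hzm (show y ∈ A ∩ {y | ‖y - p‖ = ρ} from ⟨hy, hy'⟩)
      linarith
  obtain ⟨ε, hε, hερ, hεδ, hεC⟩ : ∃ ε > 0, ε * ρ < d ∧ ε * 3 < δ ∧ ε * (C₂ + 2 * C₁) < δ := by
    set m := min d δ with hm
    have hm0 : 0 < m := lt_min hd hδ
    set D := ρ + 3 + C₂ + 2 * C₁ + 1 with hD
    have hD0 : 0 < D := by positivity
    have key : ∀ x, x < D → m / D * x < m := fun x hx => by
      rw [div_mul_eq_mul_div, div_lt_iff₀ hD0]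
      exact mul_lt_mul_of_pos_left hx hm0
    exact ⟨m / D, by positivity, (key _ (by linarith)).trans_le (min_le_left _ _),
      (key _ (by linarith)).trans_le (min_le_right _ _),
      (key _ (by linarith)).trans_le (min_le_right _ _)⟩
  have hex : ∃ y ∈ A, P p < P y + ε * barrier p y := by
    by_contra hcon
    push Not at hcon
    set e : EuclideanSpace ℝ (Fin n) := EuclideanSpace.single 0 1
    have hcoord : ∀ t : ℝ, (p + t • e) 0 = t := fun t => by simp [e, hp0]
    have hnorm : ∀ t : ℝ, ‖p + t • e - p‖ = |t| := fun t => by simp [e, norm_smul]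
    have hev : ∀ᶠ t in 𝓝[>] (0 : ℝ), p + t • e ∈ A := by
      filter_upwards [self_mem_nhdsWithin, nhdsWithin_le_nhds (Iio_mem_nhds hρ)] with t ht ht'
      rw [mem_Ioi] at ht
      rw [mem_Iio] at ht'
      refine ⟨?_, ?_⟩
      · rw [barrier, hnorm, hcoord, sq_abs]
        nlinarith
      · rw [hnorm, abs_of_pos ht]; exact ht'.le
    have hF : ContDiffOn ℝ ∞ (fun z => -(P z + ε * barrier p z)) T :=
      (hP.add (contDiffOn_const.mul hbs)).neg
    have h1 := hT.hasDerivWithinAt_line hF hp e (s := Ioi 0) (hev.mono fun t ht => hAT ht)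
    have h2 := nonneg_of_hasDerivWithinAt_of_eventually_le h1 (by
      filter_upwards [hev] with t ht
      have := hcon _ ht
      have hb0 : barrier p p = 0 := by simp [barrier, hp0]
      simp only [zero_smul, add_zero, hb0, mul_zero]
      linarith)
    rw [Finset.sum_eq_single 0 (fun k _ hk => by simp [e, hk]) (by simp),
      hT.pd_neg (hP.add (contDiffOn_const.mul hbs)) hp,
      hT.pd_add hP (contDiffOn_const.mul hbs) hp, hT.pd_const_mul hbs _ hp,
      hT.pd_barrier hp] at h2
    simp [e, barrierGrad] at h2
    linarith
  obtain ⟨z, hzA, hz⟩ := hex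
  have hFc : ContinuousOn (fun y => P y + ε * barrier p y) A :=
    (hP.continuousOn.mono hAT).add (continuous_const.mul hbc).continuousOn
  obtain ⟨y, hyA, hym⟩ := hAc.exists_isMaxOn ⟨z, hzA⟩ hFc
  have hyz : P p < P y + ε * barrier p y := hz.trans_le (hym hzA)
  have hyT := hAT hyA
  have hbpos : 0 < barrier p y := by
    by_contra h
    have h1 := mul_nonpos_of_nonneg_of_nonpos hε.le (not_lt.1 h)
    linarith [hmax y hyT]
  have hyρ : ‖y - p‖ < ρ := by
    refine lt_of_le_of_ne hyA.2 fun h => ?_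
    have h1 := hdS y hyA h
    have h2 := mul_le_mul_of_nonneg_left (hble y hyA) hε.le
    linarith
  have hy0 : 0 < y 0 := by
    unfold barrier at hbpos
    linarith [sq_nonneg ‖y - p‖]
  have hloc : IsLocalMax (fun y => P y + ε * barrier p y) y := by
    have h1 : A ∈ 𝓝 y := by
      filter_upwards [(isOpen_lt continuous_const hbc).mem_nhds hbpos,
        (isOpen_lt (f := fun y => ‖y - p‖) (by fun_prop) continuous_const).mem_nhds hyρ]
        with x hx hx' using ⟨le_of_lt hx, le_of_lt hx'⟩
    filter_upwards [h1] with x hx using hym hx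
  have hFs : ContDiffOn ℝ ∞ (fun y => P y + ε * barrier p y) T :=
    hP.add (contDiffOn_const.mul hbs)
  have hpdP : ∀ k, pd k P y = -(ε * barrierGrad p y k) := by
    intro k
    have h1 := (hT.interior_max hFs hyT hy0 hloc).1 k
    rw [hT.pd_add hP (contDiffOn_const.mul hbs) hyT, hT.pd_const_mul hbs _ hyT,
      hT.pd_barrier hyT] at h1
    linarith
  have hlap := hg.laplacian_nonpos_of_max hFs hyT hy0 hloc
  rw [hg.laplacian_add_const_mul hP hbs ε hyT] at hlap
  refine ⟨y, hyT, hy0, hyρ.trans hρδ, fun k => ?_, ?_⟩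
  · rw [hpdP, abs_neg, abs_mul, abs_of_pos hε]
    have h1 : |barrierGrad p y k| ≤ 3 := by
      refine (abs_coord_le _ k).trans ((norm_sub_le _ _).trans ?_)
      rw [norm_smul]
      simp
      linarith
    exact (mul_le_mul_of_nonneg_left h1 hε.le).trans_lt hεδ
  · have h1 := (abs_le.1 (hC₂ y ⟨hy0.le, hyρ.le.trans hρ0'⟩)).1
    have h2 := hdrift y hyT hy0 (hyρ.trans_le hρ1')
    have h3 : ∑ k, w y k * pd k P y = -(ε * ∑ k, w y k * barrierGrad p y k) := by
      rw [Finset.mul_sum, ← Finset.sum_neg_distrib]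
      exact Finset.sum_congr rfl fun k _ => by rw [hpdP]; ring
    unfold driftLaplacian
    rw [h3]
    have h4 := mul_le_mul_of_nonneg_left h1 hε.le
    have h5 := mul_le_mul_of_nonneg_left h2 hε.le
    linarith

end BoundaryMax

end RiemannianGap

namespace RiemannianGap

open Set Filter Topology

/-! ### From the manifold to its charts -/

section Charts

variable {n : ℕ} [NeZero n] {M : Type*} [TopologicalSpace M]
  [ChartedSpace (EuclideanHalfSpace n) M]

theorem relOpen_target (x₀ : M) : RelOpen (extChartAt (𝓡∂ n) x₀).target where
  subset := extChartAt_target_subset_range x₀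
  mem_nhdsWithin := fun _ hy => extChartAt_target_mem_nhdsWithin_of_mem hy

theorem continuous_of_continuousOn_charts {f : M → ℝ}
    (hf : ∀ x₀ : M, ContinuousOn (f ∘ (extChartAt (𝓡∂ n) x₀).symm)
      (extChartAt (𝓡∂ n) x₀).target) : Continuous f := by
  refine continuous_iff_continuousAt.2 fun x₀ => ?_
  have h1 : ContinuousOn (f ∘ (extChartAt (𝓡∂ n) x₀).symm ∘ extChartAt (𝓡∂ n) x₀)
      (extChartAt (𝓡∂ n) x₀).source :=
    (hf x₀).comp (continuousOn_extChartAt x₀) (extChartAt (𝓡∂ n) x₀).mapsTo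
  have h2 : ContinuousOn f (extChartAt (𝓡∂ n) x₀).source :=
    h1.congr fun x hx => by
      simp only [Function.comp_apply]
      rw [(extChartAt (𝓡∂ n) x₀).left_inv hx]
  exact h2.continuousAt (extChartAt_source_mem_nhds x₀)

variable [IsManifold (𝓡∂ n) ∞ M]

theorem chartAt_mem_maximalAtlas (x₀ : M) :
    chartAt (EuclideanHalfSpace n) x₀ ∈ IsManifold.maximalAtlas (𝓡∂ n) ∞ M :=
  IsManifold.chart_mem_maximalAtlas x₀

theorem isInteriorPoint_iff_pos {x₀ x : M} (hx : x ∈ (extChartAt (𝓡∂ n) x₀).source) :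
    x ∈ (𝓡∂ n).interior M ↔ 0 < extChartAt (𝓡∂ n) x₀ x 0 := by
  have : IsManifold (𝓡∂ n) 1 M := IsManifold.of_le (n := ∞) (by simp)
  rw [extChartAt_source] at hx
  have h1 := ModelWithCorners.isInteriorPoint_iff_of_mem_atlas (I := 𝓡∂ n) (n := 1) one_ne_zero
    (chart_mem_atlas (EuclideanHalfSpace n) x₀) hx
  have h2 : extChartAt (𝓡∂ n) x₀ x ∈ interior (range (𝓡∂ n)) ↔ 0 < extChartAt (𝓡∂ n) x₀ x 0 := by
    rw [interior_range_modelWithCornersEuclideanHalfSpace]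
    rfl
  refine h1.trans (Iff.trans ⟨fun h => ?_, fun h => ?_⟩ h2)
  · exact interior_mono (extChartAt_target_subset_range x₀) h
  · exact (chartAt (EuclideanHalfSpace n) x₀).mem_interior_extend_target
      ((chartAt (EuclideanHalfSpace n) x₀).map_source hx) h

theorem isBoundaryPoint_iff_zero {x₀ x : M} (hx : x ∈ (extChartAt (𝓡∂ n) x₀).source) :
    x ∈ (𝓡∂ n).boundary M ↔ extChartAt (𝓡∂ n) x₀ x 0 = 0 := by
  have h0 : 0 ≤ extChartAt (𝓡∂ n) x₀ x 0 :=
    (relOpen_target x₀).nonneg ((extChartAt (𝓡∂ n) x₀).map_source hx)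
  rw [← ModelWithCorners.compl_interior, mem_compl_iff, isInteriorPoint_iff_pos hx, not_lt]
  exact ⟨fun h => le_antisymm h h0, fun h => h.le⟩

theorem contDiffOn_comp_symm {u : M → ℝ} (hu : ContMDiff (𝓡∂ n) 𝓘(ℝ, ℝ) ∞ u) (x₀ : M) :
    ContDiffOn ℝ ∞ (u ∘ (extChartAt (𝓡∂ n) x₀).symm) (extChartAt (𝓡∂ n) x₀).target := by
  rw [← contMDiffOn_iff_contDiffOn]
  exact hu.comp_contMDiffOn (contMDiffOn_extChartAt_symm x₀)

omit [IsManifold (𝓡∂ n) ∞ M] in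
theorem mfderivWithin_symm_eq {x₀ : M} {y : EuclideanSpace ℝ (Fin n)}
    (hy : y ∈ (extChartAt (𝓡∂ n) x₀).target) :
    mfderivWithin 𝓘(ℝ, EuclideanSpace ℝ (Fin n)) (𝓡∂ n) (extChartAt (𝓡∂ n) x₀).symm
      (extChartAt (𝓡∂ n) x₀).target y =
    mfderivWithin 𝓘(ℝ, EuclideanSpace ℝ (Fin n)) (𝓡∂ n) (extChartAt (𝓡∂ n) x₀).symm
      (range (𝓡∂ n)) y :=
  mfderivWithin_congr_set ((relOpen_target x₀).eventuallyEq hy)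

theorem contMDiffOn_coordVec (x₀ : M) (i : Fin n) :
    ContMDiffOn 𝓘(ℝ, EuclideanSpace ℝ (Fin n)) (𝓡∂ n).tangent ∞
      (fun y => (⟨(extChartAt (𝓡∂ n) x₀).symm y,
        coordVec (chartAt (EuclideanHalfSpace n) x₀) i y⟩ : TangentBundle (𝓡∂ n) M))
      (extChartAt (𝓡∂ n) x₀).target := by
  have h1 := (contMDiffOn_extChartAt_symm (I := 𝓡∂ n) (n := ∞) x₀).contMDiffOn_tangentMapWithin
    (m := ∞) (by simp) (relOpen_target x₀).uniqueDiffOn.uniqueMDiffOn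
  have h2 : ContMDiff 𝓘(ℝ, EuclideanSpace ℝ (Fin n))
      (𝓘(ℝ, EuclideanSpace ℝ (Fin n))).tangent ∞
      (fun y : EuclideanSpace ℝ (Fin n) => (⟨y, EuclideanSpace.single i (1 : ℝ)⟩ :
        TangentBundle 𝓘(ℝ, EuclideanSpace ℝ (Fin n)) (EuclideanSpace ℝ (Fin n)))) := by
    exact contMDiff_vectorSpace_iff_contDiff.2 contDiff_const
  refine (h1.comp h2.contMDiffOn fun y hy => hy).congr fun y hy => ?_
  simp only [Function.comp, tangentMapWithin, mfderivWithin_symm_eq hy]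
  rfl

/-- The tangent vector with components `a` in the preferred chart at `x₀`. -/
def chartVec (x₀ : M) (y : EuclideanSpace ℝ (Fin n)) (a : Fin n → ℝ) :
    TangentSpace (𝓡∂ n) ((extChartAt (𝓡∂ n) x₀).symm y) :=
  ∑ i, a i • coordVec (chartAt (EuclideanHalfSpace n) x₀) i y

omit [IsManifold (𝓡∂ n) ∞ M] in
theorem chartVec_eq {x₀ : M} {y : EuclideanSpace ℝ (Fin n)} (a : EuclideanSpace ℝ (Fin n)) :
    chartVec x₀ y a =
      mfderivWithin 𝓘(ℝ, EuclideanSpace ℝ (Fin n)) (𝓡∂ n) (extChartAt (𝓡∂ n) x₀).symm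
        (range (𝓡∂ n)) y a := by
  have ha : a = ∑ i, a i • (EuclideanSpace.single i 1 : EuclideanSpace ℝ (Fin n)) := by
    ext j
    simp [Pi.single_apply]
  conv_rhs => rw [ha]
  exact ((map_sum (mfderivWithin 𝓘(ℝ, EuclideanSpace ℝ (Fin n)) (𝓡∂ n)
    (extChartAt (𝓡∂ n) x₀).symm (range (𝓡∂ n)) y) _ _).trans
    (Finset.sum_congr rfl fun i _ => map_smul _ _ _)).symm

theorem chartVec_vecCoord {x₀ : M} {y : EuclideanSpace ℝ (Fin n)}
    (hy : y ∈ (extChartAt (𝓡∂ n) x₀).target) (W : ∀ x : M, TangentSpace (𝓡∂ n) x) :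
    chartVec x₀ y (vecCoord (chartAt (EuclideanHalfSpace n) x₀) W y) = W ((extChartAt (𝓡∂ n) x₀).symm y) := by
  have : IsManifold (𝓡∂ n) 1 M := IsManifold.of_le (n := ∞) (by simp)
  have h1 := mfderivWithin_extChartAt_symm_comp_mfderiv_extChartAt (I := 𝓡∂ n) hy
  have h2 := congrArg (fun L => L (W ((extChartAt (𝓡∂ n) x₀).symm y))) h1
  exact (chartVec_eq _).trans h2

theorem pd_comp_symm {x₀ : M} {y : EuclideanSpace ℝ (Fin n)}
    (hy : y ∈ (extChartAt (𝓡∂ n) x₀).target) {u : M → ℝ}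
    (hu : ContMDiff (𝓡∂ n) 𝓘(ℝ, ℝ) ∞ u) (i : Fin n) :
    pd i (u ∘ (extChartAt (𝓡∂ n) x₀).symm) y = dirDeriv u ((extChartAt (𝓡∂ n) x₀).symm y)
      (coordVec (chartAt (EuclideanHalfSpace n) x₀) i y) := by
  have : IsManifold (𝓡∂ n) 1 M := IsManifold.of_le (n := ∞) (by simp)
  have h1 := mfderiv_comp_mfderivWithin (I := 𝓘(ℝ, EuclideanSpace ℝ (Fin n))) (I' := 𝓡∂ n)
    (I'' := 𝓘(ℝ, ℝ)) (s := range (𝓡∂ n)) (f := (extChartAt (𝓡∂ n) x₀).symm) (g := u) y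
    (hu.mdifferentiable (by simp) _)
    (mdifferentiableWithinAt_extChartAt_symm hy)
    ((𝓡∂ n).uniqueDiffOn.uniqueMDiffOn y (extChartAt_target_subset_range x₀ hy))
  rw [mfderivWithin_eq_fderivWithin] at h1
  rw [pd, h1]
  rfl

theorem dirDeriv_chartVec {x₀ : M} {y : EuclideanSpace ℝ (Fin n)}
    (hy : y ∈ (extChartAt (𝓡∂ n) x₀).target) {u : M → ℝ}
    (hu : ContMDiff (𝓡∂ n) 𝓘(ℝ, ℝ) ∞ u) (a : Fin n → ℝ) :
    dirDeriv u ((extChartAt (𝓡∂ n) x₀).symm y) (chartVec x₀ y a) =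
      ∑ i, a i * pd i (u ∘ (extChartAt (𝓡∂ n) x₀).symm) y := by
  simp only [pd_comp_symm hy hu, dirDeriv]
  exact (map_sum (mfderiv (𝓡∂ n) 𝓘(ℝ, ℝ) u _) _ _).trans
    (Finset.sum_congr rfl fun i _ => map_smul _ _ _)

theorem dirDeriv_eq_sum_vecCoord {x₀ : M} {y : EuclideanSpace ℝ (Fin n)}
    (hy : y ∈ (extChartAt (𝓡∂ n) x₀).target) {u : M → ℝ}
    (hu : ContMDiff (𝓡∂ n) 𝓘(ℝ, ℝ) ∞ u) (W : ∀ x : M, TangentSpace (𝓡∂ n) x) :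
    dirDeriv u ((extChartAt (𝓡∂ n) x₀).symm y) (W ((extChartAt (𝓡∂ n) x₀).symm y)) =
      ∑ i, vecCoord (chartAt (EuclideanHalfSpace n) x₀) W y i *
        pd i (u ∘ (extChartAt (𝓡∂ n) x₀).symm) y := by
  rw [← dirDeriv_chartVec hy hu, chartVec_vecCoord hy]

theorem contDiffOn_vecCoord (x₀ : M) {W : ∀ x : M, TangentSpace (𝓡∂ n) x}
    (hW : ContMDiffOn (𝓡∂ n) (𝓡∂ n).tangent ∞
      (fun x => (⟨x, W x⟩ : TangentBundle (𝓡∂ n) M)) ((𝓡∂ n).interior M)) (k : Fin n) :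
    ContDiffOn ℝ ∞ (fun y => vecCoord (chartAt (EuclideanHalfSpace n) x₀) W y k)
      ((extChartAt (𝓡∂ n) x₀).target ∩ {y | 0 < y 0}) := by
  set V := (extChartAt (𝓡∂ n) x₀).target ∩ {y : EuclideanSpace ℝ (Fin n) | 0 < y 0}
  have hint : ∀ y ∈ V, (extChartAt (𝓡∂ n) x₀).symm y ∈ (𝓡∂ n).interior M := fun y hy => by
    rw [isInteriorPoint_iff_pos ((extChartAt (𝓡∂ n) x₀).map_target hy.1),
      (extChartAt (𝓡∂ n) x₀).right_inv hy.1]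
    exact hy.2
  have h1 := (contMDiffOn_extChartAt (I := 𝓡∂ n) (n := ∞) (x := x₀)).contMDiffOn_tangentMapWithin
    (m := ∞) (by simp) (chartAt (EuclideanHalfSpace n) x₀).open_source.uniqueMDiffOn
  have h2 : ContMDiffOn 𝓘(ℝ, EuclideanSpace ℝ (Fin n)) (𝓡∂ n).tangent ∞
      (fun y => (⟨(extChartAt (𝓡∂ n) x₀).symm y, W ((extChartAt (𝓡∂ n) x₀).symm y)⟩ :
        TangentBundle (𝓡∂ n) M)) V :=
    hW.comp ((contMDiffOn_extChartAt_symm x₀).mono inter_subset_left) hint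
  have hsrc : ∀ y ∈ V, (extChartAt (𝓡∂ n) x₀).symm y ∈ (chartAt (EuclideanHalfSpace n) x₀).source :=
    fun y hy => by
      rw [← extChartAt_source (𝓡∂ n)]
      exact (extChartAt (𝓡∂ n) x₀).map_target hy.1
  have h3 := h1.comp h2 hsrc
  have h4 := (contMDiff_snd_tangentBundle_modelSpace (EuclideanSpace ℝ (Fin n))
    𝓘(ℝ, EuclideanSpace ℝ (Fin n)) (n := ∞)).comp_contMDiffOn h3
  rw [contMDiffOn_iff_contDiffOn] at h4
  have h5 : ContDiffOn ℝ ∞ _ V :=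
    (EuclideanSpace.proj k : EuclideanSpace ℝ (Fin n) →L[ℝ] ℝ).contDiff.comp_contDiffOn h4
  refine h5.congr fun y hy => ?_
  have h6 := mfderivWithin_of_isOpen (I := 𝓡∂ n) (I' := 𝓘(ℝ, EuclideanSpace ℝ (Fin n)))
    (f := extChartAt (𝓡∂ n) x₀) (chartAt (EuclideanHalfSpace n) x₀).open_source (hsrc y hy)
  simp only [Function.comp, tangentMapWithin, h6]
  rfl

variable [Bundle.RiemannianBundle (fun x : M => TangentSpace (𝓡∂ n) x)]

omit [IsManifold (𝓡∂ n) ∞ M] in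
theorem inner_chartVec {x₀ : M} (y : EuclideanSpace ℝ (Fin n)) (a b : Fin n → ℝ) :
    inner ℝ (chartVec x₀ y a) (chartVec x₀ y b) =
      ∑ i, ∑ j, a i * b j * gram (chartAt (EuclideanHalfSpace n) x₀) y i j := by
  have h1 : inner ℝ (∑ i, a i • coordVec (chartAt (EuclideanHalfSpace n) x₀) i y)
      (∑ i, b i • coordVec (chartAt (EuclideanHalfSpace n) x₀) i y) =
      ∑ i, ∑ j, a i * b j * gram (chartAt (EuclideanHalfSpace n) x₀) y i j := by
    simp only [sum_inner, inner_sum, real_inner_smul_left, real_inner_smul_right, gram,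
      Matrix.of_apply]
    rw [Finset.sum_comm]
    exact Finset.sum_congr rfl fun i _ => Finset.sum_congr rfl fun j _ => by ring
  exact h1

theorem posDef_gram {x₀ : M} {y : EuclideanSpace ℝ (Fin n)}
    (hy : y ∈ (extChartAt (𝓡∂ n) x₀).target) :
    (gram (chartAt (EuclideanHalfSpace n) x₀) y).PosDef := by
  have : IsManifold (𝓡∂ n) 1 M := IsManifold.of_le (n := ∞) (by simp)
  refine Matrix.PosDef.of_dotProduct_mulVec_pos ?_ fun a ha => ?_
  · ext i j
    simp only [gram, Matrix.conjTranspose_apply, Matrix.of_apply, star_trivial]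
    exact real_inner_comm _ _
  · have h1 : star a ⬝ᵥ (gram (chartAt (EuclideanHalfSpace n) x₀) y).mulVec a =
        inner ℝ (chartVec x₀ y a) (chartVec x₀ y a) := by
      rw [inner_chartVec]
      simp only [dotProduct, Matrix.mulVec, Finset.mul_sum, star_trivial]
      refine Finset.sum_congr rfl fun i _ => Finset.sum_congr rfl fun j _ => by ring
    rw [h1]
    refine real_inner_self_pos.2 fun h0 => ha ?_
    have h2 := (chartVec_eq (x₀ := x₀) (y := y) (WithLp.toLp 2 a)).symm.trans h0
    have h3 := (isInvertible_mfderivWithin_extChartAt_symm (I := 𝓡∂ n) hy).injective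
      (h2.trans (map_zero _).symm)
    funext i
    exact congrArg (fun v : EuclideanSpace ℝ (Fin n) => v i) h3

/-- The squared length of the gradient of `u`, as the squared norm of the differential. -/
def gradNormSq (u : M → ℝ) (x : M) : ℝ :=
  sInf {C : ℝ | 0 ≤ C ∧ ∀ v : TangentSpace (𝓡∂ n) x, dirDeriv u x v ^ 2 ≤ C * ‖v‖ ^ 2}

omit [IsManifold (𝓡∂ n) ∞ M] in
theorem gradNormSq_nonneg {u : M → ℝ} (x : M) : 0 ≤ gradNormSq (n := n) u x :=
  Real.sInf_nonneg fun _ hC => hC.1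

variable [IsContMDiffRiemannianBundle (𝓡∂ n) ∞ (EuclideanSpace ℝ (Fin n))
      (fun x : M => TangentSpace (𝓡∂ n) x)]

theorem metricOn_gram (x₀ : M) :
    MetricOn (extChartAt (𝓡∂ n) x₀).target (gram (chartAt (EuclideanHalfSpace n) x₀)) where
  relOpen := relOpen_target x₀
  posDef := fun _ hy => posDef_gram hy
  smooth := fun i j => by
    rw [← contMDiffOn_iff_contDiffOn]
    exact ContMDiffOn.inner_bundle (contMDiffOn_coordVec x₀ i) (contMDiffOn_coordVec x₀ j)

theorem isLeast_gradSq {x₀ : M} {y : EuclideanSpace ℝ (Fin n)}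
    (hy : y ∈ (extChartAt (𝓡∂ n) x₀).target) {u : M → ℝ}
    (hu : ContMDiff (𝓡∂ n) 𝓘(ℝ, ℝ) ∞ u) :
    IsLeast {C : ℝ | 0 ≤ C ∧ ∀ v : TangentSpace (𝓡∂ n) ((extChartAt (𝓡∂ n) x₀).symm y),
      dirDeriv u ((extChartAt (𝓡∂ n) x₀).symm y) v ^ 2 ≤ C * ‖v‖ ^ 2}
      (gradSq (gram (chartAt (EuclideanHalfSpace n) x₀)) (u ∘ (extChartAt (𝓡∂ n) x₀).symm) y) := by
  set g := gram (chartAt (EuclideanHalfSpace n) x₀)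
  set û := u ∘ (extChartAt (𝓡∂ n) x₀).symm
  have hg : MetricOn (extChartAt (𝓡∂ n) x₀).target g := metricOn_gram x₀
  set N : TangentSpace (𝓡∂ n) ((extChartAt (𝓡∂ n) x₀).symm y) :=
    chartVec x₀ y (fun i => grad g û i y) with hN
  have hpair : ∀ a : Fin n → ℝ, dirDeriv u ((extChartAt (𝓡∂ n) x₀).symm y)
      (chartVec x₀ y a) = inner ℝ (chartVec x₀ y a) N := by
    intro a
    rw [dirDeriv_chartVec hy hu, hN, inner_chartVec]
    refine Finset.sum_congr rfl fun i _ => ?_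
    rw [← hg.lower_grad (u := û) hy i, Finset.mul_sum]
    exact Finset.sum_congr rfl fun j _ => by ring
  have hNN : dirDeriv u ((extChartAt (𝓡∂ n) x₀).symm y) N = gradSq g û y := by
    rw [hN, dirDeriv_chartVec hy hu]
    exact Finset.sum_congr rfl fun i _ => mul_comm _ _
  have hNn : ‖N‖ ^ 2 = gradSq g û y := by
    rw [← hNN, ← real_inner_self_eq_norm_sq]
    exact (hpair fun i => grad g û i y).symm
  classical
  refine ⟨⟨hg.gradSq_nonneg hy, fun v => ?_⟩, fun C hC => ?_⟩
  · obtain ⟨W, hW⟩ : ∃ W : ∀ x : M, TangentSpace (𝓡∂ n) x,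
        W ((extChartAt (𝓡∂ n) x₀).symm y) = v :=
      ⟨Function.update 0 _ v, Function.update_self _ _ _⟩
    have hv := (chartVec_vecCoord hy W).trans hW
    have h1 := hpair (vecCoord (chartAt (EuclideanHalfSpace n) x₀) W y)
    rw [hv] at h1
    rw [h1, ← hNn, ← mul_pow, ← sq_abs]
    have := abs_real_inner_le_norm v N
    gcongr
    linarith
  · have h1 := hC.2 N
    rw [hNN, hNn] at h1
    rcases (hg.gradSq_nonneg (u := û) hy).eq_or_lt with h | h
    · rw [← h]; exact hC.1
    · rw [pow_two] at h1
      exact le_of_mul_le_mul_right h1 h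

theorem gradNormSq_eq {x₀ : M} {y : EuclideanSpace ℝ (Fin n)}
    (hy : y ∈ (extChartAt (𝓡∂ n) x₀).target) {u : M → ℝ}
    (hu : ContMDiff (𝓡∂ n) 𝓘(ℝ, ℝ) ∞ u) :
    gradNormSq (n := n) u ((extChartAt (𝓡∂ n) x₀).symm y) =
      gradSq (gram (chartAt (EuclideanHalfSpace n) x₀)) (u ∘ (extChartAt (𝓡∂ n) x₀).symm) y :=
  (isLeast_gradSq hy hu).csInf_eq

theorem dirDeriv_sq_le {u : M → ℝ} (hu : ContMDiff (𝓡∂ n) 𝓘(ℝ, ℝ) ∞ u) (x : M)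
    (v : TangentSpace (𝓡∂ n) x) : dirDeriv u x v ^ 2 ≤ gradNormSq (n := n) u x * ‖v‖ ^ 2 := by
  have h1 := isLeast_gradSq (mem_extChartAt_target (I := 𝓡∂ n) x) hu
  rw [extChartAt_to_inv] at h1
  rw [gradNormSq, h1.csInf_eq]
  exact h1.1.2 v

end Charts

end RiemannianGap

namespace RiemannianGap

open Set Filter Topology

/-! ### The gradient quantity `|∇u|² + a u²` -/

section Coordinates

variable {n : ℕ} [NeZero n] {T : Set (EuclideanSpace ℝ (Fin n))}
  {g : EuclideanSpace ℝ (Fin n) → Matrix (Fin n) (Fin n) ℝ}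
  {w : EuclideanSpace ℝ (Fin n) → Fin n → ℝ} {u f h : EuclideanSpace ℝ (Fin n) → ℝ}
  {y : EuclideanSpace ℝ (Fin n)}

theorem RelOpen.pd_add_const_mul (hT : RelOpen T) (hf : ContDiffOn ℝ ∞ f T)
    (hh : ContDiffOn ℝ ∞ h T) (c : ℝ) (hy : y ∈ T) (k : Fin n) :
    pd k (fun z => f z + c * h z) y = pd k f y + c * pd k h y := by
  rw [hT.pd_add hf (contDiffOn_const.mul hh) hy, hT.pd_const_mul hh _ hy]

theorem MetricOn.driftLaplacian_add_const_mul (hg : MetricOn T g) (hf : ContDiffOn ℝ ∞ f T)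
    (hh : ContDiffOn ℝ ∞ h T) (c : ℝ) (hy : y ∈ T) :
    driftLaplacian g w (fun z => f z + c * h z) y =
      driftLaplacian g w f y + c * driftLaplacian g w h y := by
  simp only [driftLaplacian, hg.laplacian_add_const_mul hf hh c hy,
    hg.relOpen.pd_add_const_mul hf hh c hy, mul_add, Finset.sum_add_distrib]
  have : ∑ k, w y k * (c * pd k h y) = c * ∑ k, w y k * pd k h y := by
    rw [Finset.mul_sum]
    exact Finset.sum_congr rfl fun k _ => by ring
  rw [this]
  ring

theorem RelOpen.pd_sq (hT : RelOpen T) (hu : ContDiffOn ℝ ∞ u T) (hy : y ∈ T) (k : Fin n) :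
    pd k (fun z => u z ^ 2) y = 2 * u y * pd k u y := by
  simp only [pow_two]
  rw [hT.pd_mul hu hu hy]
  ring

theorem MetricOn.laplacian_sq (hg : MetricOn T g) (hu : ContDiffOn ℝ ∞ u T) (hy : y ∈ T) :
    laplacian g (fun z => u z ^ 2) y = 2 * u y * laplacian g u y + 2 * gradSq g u y := by
  have hT := hg.relOpen
  have h2 : ∀ i j, pd i (pd j fun z => u z ^ 2) y =
      2 * (pd i u y * pd j u y) + 2 * u y * pd i (pd j u) y := by
    intro i j
    rw [hT.pd_congr hy (fun z hz => hT.pd_sq hu hz j) i,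
      hT.pd_mul (contDiffOn_const.mul hu) (hT.contDiffOn_pd hu j) hy, hT.pd_const_mul hu _ hy]
    ring
  simp only [laplacian, h2, hT.pd_sq hu hy, gradSq, grad, Finset.mul_sum]
  rw [← Finset.sum_add_distrib]
  refine Finset.sum_congr rfl fun i _ => ?_
  rw [← Finset.sum_add_distrib]
  refine Finset.sum_congr rfl fun j _ => ?_
  have : ∑ k, christoffel g k i j y * (2 * u y * pd k u y) =
      2 * u y * ∑ k, christoffel g k i j y * pd k u y := by
    rw [Finset.mul_sum]
    exact Finset.sum_congr rfl fun k _ => by ring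
  rw [this]
  ring

theorem MetricOn.driftLaplacian_sq (hg : MetricOn T g) (hu : ContDiffOn ℝ ∞ u T) (hy : y ∈ T) :
    driftLaplacian g w (fun z => u z ^ 2) y =
      2 * u y * driftLaplacian g w u y + 2 * gradSq g u y := by
  simp only [driftLaplacian, hg.laplacian_sq hu hy, hg.relOpen.pd_sq hu hy]
  have : ∑ k, w y k * (2 * u y * pd k u y) = 2 * u y * ∑ k, w y k * pd k u y := by
    rw [Finset.mul_sum]
    exact Finset.sum_congr rfl fun k _ => by ring
  rw [this]
  ring

/-- The differential inequality for `P = |∇u|² + a u²`, in a form without second derivatives of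
`u` and with the derivatives of `P` collected in the last sum. -/
theorem MetricOn.gradient_estimate (hg : MetricOn T g) (hu : ContDiffOn ℝ ∞ u T)
    (hw : ∀ k, ContDiffOn ℝ ∞ (fun z => w z k) T) {μ κ a : ℝ}
    (hpde : ∀ z ∈ T, driftLaplacian g w u z = -μ * u z) (hy : y ∈ T)
    (hric : ∀ v : Fin n → ℝ, 0 ≤ ∑ j, ∑ k, ricci g j k y * v j * v k)
    (hcov : ∀ v : Fin n → ℝ, κ * metricForm g v y ≤ covDerivForm g w v y) :
    gradSq g u y * (a ^ 2 * u y ^ 2 + (2 * κ - μ + a) * gradSq g u y - a * μ * u y ^ 2) ≤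
      gradSq g u y * driftLaplacian g w (fun z => gradSq g u z + a * u z ^ 2) y / 2 +
        ∑ k, a * u y * grad g u k y * pd k (fun z => gradSq g u z + a * u z ^ 2) y := by
  have hT := hg.relOpen
  have hF := hg.smooth_gradSq hu
  have hu2 : ContDiffOn ℝ ∞ (fun z => u z ^ 2) T := hu.pow 2
  have h0 := hg.gradSq_nonneg (u := u) hy
  have h1 := hg.drift_bochner hu hw hpde hy hric hcov
  have h2 := hg.quadForm_pd_gradSq_le hu hy
  rw [hg.driftLaplacian_add_const_mul hF hu2 a hy, hg.driftLaplacian_sq hu hy, hpde y hy]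
  set p : Fin n → ℝ := fun k => pd k (fun z => gradSq g u z + a * u z ^ 2) y with hp
  have h3 : ∀ k, pd k (gradSq g u) y = p k - 2 * a * u y * pd k u y := by
    intro k
    simp only [hp, hT.pd_add_const_mul hF hu2 a hy, hT.pd_sq hu hy]
    ring
  have h4 : ∑ i, ∑ j, (g y)⁻¹ i j * (pd i (gradSq g u) y / 2) * (pd j (gradSq g u) y / 2) =
      ∑ i, ∑ j, (g y)⁻¹ i j * (p i / 2) * (p j / 2) - ∑ k, a * u y * grad g u k y * p k +
        a ^ 2 * u y ^ 2 * gradSq g u y := by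
    have e1 : ∑ k, a * u y * grad g u k y * p k =
        ∑ i, ∑ j, (g y)⁻¹ i j * (a * u y) * (p i * pd j u y) := by
      simp only [grad, Finset.mul_sum, Finset.sum_mul]
      exact Finset.sum_congr rfl fun i _ => Finset.sum_congr rfl fun j _ => by ring
    have e2 : ∑ i, ∑ j, (g y)⁻¹ i j * (a * u y) * (p i * pd j u y) =
        ∑ i, ∑ j, (g y)⁻¹ i j * (a * u y) * (p j * pd i u y) := by
      rw [Finset.sum_comm]
      exact Finset.sum_congr rfl fun i _ => Finset.sum_congr rfl fun j _ => by
        rw [hg.inv_symm hy j i]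
    have e3 : a ^ 2 * u y ^ 2 * gradSq g u y =
        ∑ i, ∑ j, (g y)⁻¹ i j * (a * u y) * (a * u y) * (pd i u y * pd j u y) := by
      simp only [gradSq, grad, Finset.mul_sum]
      exact Finset.sum_congr rfl fun i _ => Finset.sum_congr rfl fun j _ => by ring
    have e4 : ∑ k, a * u y * grad g u k y * p k =
        (∑ i, ∑ j, (g y)⁻¹ i j * (a * u y) * (p i * pd j u y)) / 2 +
        (∑ i, ∑ j, (g y)⁻¹ i j * (a * u y) * (p j * pd i u y)) / 2 := by
      rw [← e2, ← e1]; ring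
    rw [e4, e3]
    simp only [Finset.sum_div, ← Finset.sum_add_distrib, ← Finset.sum_sub_distrib]
    exact Finset.sum_congr rfl fun i _ => Finset.sum_congr rfl fun j _ => by
      rw [h3 i, h3 j]; ring
  have h5 : 0 ≤ ∑ i, ∑ j, (g y)⁻¹ i j * (p i / 2) * (p j / 2) := by
    have := (hg.posDef y hy).inv.posSemidef.dotProduct_mulVec_nonneg (fun i => p i / 2)
    simp only [dotProduct, Matrix.mulVec, Finset.mul_sum, star_trivial] at this
    refine this.trans_eq ?_
    exact Finset.sum_congr rfl fun i _ => Finset.sum_congr rfl fun j _ => by ring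
  have h6 := mul_le_mul_of_nonneg_left h1 h0
  change _ ≤ _ + ∑ k, a * u y * grad g u k y * p k
  nlinarith [h2, h4, h5, h6]

theorem MetricOn.metricForm_nonneg (hg : MetricOn T g) (hy : y ∈ T) (v : Fin n → ℝ) :
    0 ≤ metricForm g v y := by
  have := (hg.posDef y hy).posSemidef.dotProduct_mulVec_nonneg v
  simp only [dotProduct, Matrix.mulVec, Finset.mul_sum, star_trivial] at this
  refine this.trans_eq ?_
  exact Finset.sum_congr rfl fun i _ => Finset.sum_congr rfl fun j _ => by ring

end Coordinates

end RiemannianGap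

namespace RiemannianGap

open Set Filter Topology

/-! ### The geometric conditions in the preferred charts -/

section Charts

variable {n : ℕ} [NeZero n] {M : Type*} [TopologicalSpace M]
  [ChartedSpace (EuclideanHalfSpace n) M]

theorem symm_mem_source {x₀ : M} {y : EuclideanSpace ℝ (Fin n)}
    (hy : y ∈ (extChartAt (𝓡∂ n) x₀).target) :
    (extChartAt (𝓡∂ n) x₀).symm y ∈ (chartAt (EuclideanHalfSpace n) x₀).source := by
  rw [← extChartAt_source (𝓡∂ n)]
  exact (extChartAt (𝓡∂ n) x₀).map_target hy

theorem extend_symm_apply {x₀ : M} {y : EuclideanSpace ℝ (Fin n)}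
    (hy : y ∈ (extChartAt (𝓡∂ n) x₀).target) :
    (chartAt (EuclideanHalfSpace n) x₀).extend (𝓡∂ n) ((extChartAt (𝓡∂ n) x₀).symm y) = y :=
  (extChartAt (𝓡∂ n) x₀).right_inv hy

variable [IsManifold (𝓡∂ n) ∞ M]

theorem symm_mem_interior {x₀ : M} {y : EuclideanSpace ℝ (Fin n)}
    (hy : y ∈ (extChartAt (𝓡∂ n) x₀).target) (hy0 : 0 < y 0) :
    (extChartAt (𝓡∂ n) x₀).symm y ∈ (𝓡∂ n).interior M := by
  rw [isInteriorPoint_iff_pos ((extChartAt (𝓡∂ n) x₀).map_target hy),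
    (extChartAt (𝓡∂ n) x₀).right_inv hy]
  exact hy0

theorem symm_mem_boundary {x₀ : M} {y : EuclideanSpace ℝ (Fin n)}
    (hy : y ∈ (extChartAt (𝓡∂ n) x₀).target) (hy0 : y 0 = 0) :
    (extChartAt (𝓡∂ n) x₀).symm y ∈ (𝓡∂ n).boundary M := by
  rw [isBoundaryPoint_iff_zero ((extChartAt (𝓡∂ n) x₀).map_target hy),
    (extChartAt (𝓡∂ n) x₀).right_inv hy]
  exact hy0

variable [Bundle.RiemannianBundle (fun x : M => TangentSpace (𝓡∂ n) x)]

theorem RicciNonneg.chart (hRic : RicciNonneg n M) {x₀ : M} {y : EuclideanSpace ℝ (Fin n)}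
    (hy : y ∈ (extChartAt (𝓡∂ n) x₀).target) (v : Fin n → ℝ) :
    0 ≤ ∑ j, ∑ k, ricci (gram (chartAt (EuclideanHalfSpace n) x₀)) j k y * v j * v k := by
  have h := hRic _ (chartAt_mem_maximalAtlas x₀) _ (symm_mem_source hy) v
  rwa [extend_symm_apply hy] at h

theorem BoundaryConvex.chart (hconv : BoundaryConvex n M) {x₀ : M} {y : EuclideanSpace ℝ (Fin n)}
    (hy : y ∈ (extChartAt (𝓡∂ n) x₀).target) (hy0 : y 0 = 0) (v : Fin n → ℝ) (hv : v 0 = 0) :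
    0 ≤ covDerivForm (gram (chartAt (EuclideanHalfSpace n) x₀))
      (outwardNormal (gram (chartAt (EuclideanHalfSpace n) x₀))) v y := by
  have h := hconv _ (chartAt_mem_maximalAtlas x₀) _ (symm_mem_source hy)
    (symm_mem_boundary hy hy0) v hv
  rwa [extend_symm_apply hy] at h

theorem NeumannCondition.chart {u : M → ℝ} (hNeu : NeumannCondition n u) {x₀ : M}
    {y : EuclideanSpace ℝ (Fin n)} (hy : y ∈ (extChartAt (𝓡∂ n) x₀).target) (hy0 : y 0 = 0) :
    ∑ k, outwardNormal (gram (chartAt (EuclideanHalfSpace n) x₀)) y k *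
      pd k (u ∘ (extChartAt (𝓡∂ n) x₀).symm) y = 0 := by
  have h := hNeu _ (chartAt_mem_maximalAtlas x₀) _ (symm_mem_source hy)
    (symm_mem_boundary hy hy0)
  rwa [extend_symm_apply hy] at h

theorem CovDerivBoundedBelow.chart {W : ∀ x : M, TangentSpace (𝓡∂ n) x} {κ : ℝ}
    (hWc : CovDerivBoundedBelow W κ) {x₀ : M} {y : EuclideanSpace ℝ (Fin n)}
    (hy : y ∈ (extChartAt (𝓡∂ n) x₀).target) (hy0 : 0 < y 0) (v : Fin n → ℝ) :
    κ * metricForm (gram (chartAt (EuclideanHalfSpace n) x₀)) v y ≤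
      covDerivForm (gram (chartAt (EuclideanHalfSpace n) x₀))
        (vecCoord (chartAt (EuclideanHalfSpace n) x₀) W) v y := by
  have h := hWc _ (chartAt_mem_maximalAtlas x₀) _ (symm_mem_source hy)
    (symm_mem_interior hy hy0) v
  rwa [extend_symm_apply hy] at h

theorem HasLaplacianAt.chart {u : M → ℝ} {W : ∀ x : M, TangentSpace (𝓡∂ n) x} {μ : ℝ}
    (hPDE : ∀ x ∈ (𝓡∂ n).interior M,
      HasLaplacianAt (n := n) u (-μ * u x + 2 * dirDeriv u x (W x)) x)
    (hu : ContMDiff (𝓡∂ n) 𝓘(ℝ, ℝ) ∞ u) {x₀ : M} {y : EuclideanSpace ℝ (Fin n)}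
    (hy : y ∈ (extChartAt (𝓡∂ n) x₀).target) (hy0 : 0 < y 0) :
    driftLaplacian (gram (chartAt (EuclideanHalfSpace n) x₀))
      (vecCoord (chartAt (EuclideanHalfSpace n) x₀) W) (u ∘ (extChartAt (𝓡∂ n) x₀).symm) y =
      -μ * (u ∘ (extChartAt (𝓡∂ n) x₀).symm) y := by
  have h := hPDE _ (symm_mem_interior hy hy0) _ (chartAt_mem_maximalAtlas x₀)
    (symm_mem_source hy)
  rw [extend_symm_apply hy, dirDeriv_eq_sum_vecCoord hy hu] at h
  have h' : laplacian (gram (chartAt (EuclideanHalfSpace n) x₀))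
      (u ∘ (extChartAt (𝓡∂ n) x₀).symm) y = _ := h
  rw [driftLaplacian, h']
  simp only [Function.comp_apply]
  ring

variable [IsContMDiffRiemannianBundle (𝓡∂ n) ∞ (EuclideanSpace ℝ (Fin n))
      (fun x : M => TangentSpace (𝓡∂ n) x)] [CompactSpace M] [Nonempty M]

/-- The maximum principle for `Δ - 2 ⟨W, ∇ ·⟩`, where `W` need not be bounded near the boundary. -/
theorem exists_max_sequence {W : ∀ x : M, TangentSpace (𝓡∂ n) x}
    (hW : ContMDiffOn (𝓡∂ n) (𝓡∂ n).tangent ∞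
      (fun x => (⟨x, W x⟩ : TangentBundle (𝓡∂ n) M)) ((𝓡∂ n).interior M))
    {κ : ℝ} (hκ : 0 ≤ κ) (hWc : CovDerivBoundedBelow W κ) {f : M → ℝ}
    (hf : ∀ x₀ : M, ContDiffOn ℝ ∞ (f ∘ (extChartAt (𝓡∂ n) x₀).symm)
      (extChartAt (𝓡∂ n) x₀).target)
    (hb : ∀ x₀ : M, ∀ y ∈ (extChartAt (𝓡∂ n) x₀).target, y 0 = 0 →
      ∑ k, outwardNormal (gram (chartAt (EuclideanHalfSpace n) x₀)) y k *
        pd k (f ∘ (extChartAt (𝓡∂ n) x₀).symm) y ≤ 0) :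
    ∃ x₀ : M, (∀ x, f x ≤ f x₀) ∧ ∃ z : ℕ → EuclideanSpace ℝ (Fin n),
      (∀ m, z m ∈ (extChartAt (𝓡∂ n) x₀).target) ∧ (∀ m, 0 < z m 0) ∧
      Tendsto z atTop (𝓝 (extChartAt (𝓡∂ n) x₀ x₀)) ∧
      (∀ k, Tendsto (fun m => pd k (f ∘ (extChartAt (𝓡∂ n) x₀).symm) (z m)) atTop (𝓝 0)) ∧
      ∀ m : ℕ, driftLaplacian (gram (chartAt (EuclideanHalfSpace n) x₀))
        (vecCoord (chartAt (EuclideanHalfSpace n) x₀) W)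
        (f ∘ (extChartAt (𝓡∂ n) x₀).symm) (z m) ≤ 1 / ((m : ℝ) + 1) := by
  have hfc : Continuous f := continuous_of_continuousOn_charts fun x₀ => (hf x₀).continuousOn
  obtain ⟨p, -, hp⟩ := isCompact_univ.exists_isMaxOn (univ_nonempty (α := M)) hfc.continuousOn
  have hp' : ∀ x, f x ≤ f p := fun x => hp (mem_univ x)
  have hpt : ∀ m : ℕ, (0 : ℝ) < 1 / ((m : ℝ) + 1) := fun m => by positivity
  by_cases hint : ∃ q ∈ (𝓡∂ n).interior M, f q = f p
  · obtain ⟨q, hq, hqp⟩ := hint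
    have hmem := mem_extChartAt_target (I := 𝓡∂ n) q
    have hq0 := (isInteriorPoint_iff_pos (mem_extChartAt_source (I := 𝓡∂ n) q)).1 hq
    have hmax : IsLocalMax (f ∘ (extChartAt (𝓡∂ n) q).symm) (extChartAt (𝓡∂ n) q q) :=
      Eventually.of_forall fun y => by
        simp only [Function.comp_apply, extChartAt_to_inv, hqp]
        exact hp' _
    have hT := relOpen_target (n := n) q
    have h1 := (hT.interior_max (hf q) hmem hq0 hmax).1
    have h2 := (metricOn_gram q).laplacian_nonpos_of_max (hf q) hmem hq0 hmax
    refine ⟨q, fun x => hqp ▸ hp' x, fun _ => extChartAt (𝓡∂ n) q q, fun _ => hmem,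
      fun _ => hq0, tendsto_const_nhds, fun k => ?_, fun m => ?_⟩
    · simp only [h1 k]
      exact tendsto_const_nhds
    · simp only [driftLaplacian, h1, mul_zero, Finset.sum_const_zero, sub_zero]
      exact h2.trans (hpt m).le
  · push Not at hint
    have hpb : p ∈ (𝓡∂ n).boundary M := by
      rw [← ModelWithCorners.compl_interior]
      exact fun h => hint p h rfl
    have hmem := mem_extChartAt_target (I := 𝓡∂ n) p
    have hp0 := (isBoundaryPoint_iff_zero (mem_extChartAt_source (I := 𝓡∂ n) p)).1 hpb
    have hg := metricOn_gram (n := n) p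
    have hmax : ∀ y ∈ (extChartAt (𝓡∂ n) p).target, (f ∘ (extChartAt (𝓡∂ n) p).symm) y ≤
        (f ∘ (extChartAt (𝓡∂ n) p).symm) (extChartAt (𝓡∂ n) p p) := fun y _ => by
      simp only [Function.comp_apply, extChartAt_to_inv]
      exact hp' _
    have hlt : ∀ y ∈ (extChartAt (𝓡∂ n) p).target, 0 < y 0 →
        (f ∘ (extChartAt (𝓡∂ n) p).symm) y <
        (f ∘ (extChartAt (𝓡∂ n) p).symm) (extChartAt (𝓡∂ n) p p) := fun y hy hy0 => by
      refine lt_of_le_of_ne (hmax y hy) ?_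
      simp only [Function.comp_apply, extChartAt_to_inv]
      exact hint _ (symm_mem_interior hy hy0)
    have hpd := hg.pd_zero_nonneg_of_boundary_max (hf p) hmem hmax (hb p _ hmem hp0)
    have hcov : ∀ y ∈ (extChartAt (𝓡∂ n) p).target, 0 < y 0 → ∀ v : Fin n → ℝ,
        0 ≤ covDerivForm (gram (chartAt (EuclideanHalfSpace n) p))
          (vecCoord (chartAt (EuclideanHalfSpace n) p) W) v y := fun y hy hy0 v =>
      (mul_nonneg hκ (hg.metricForm_nonneg hy v)).trans (hWc.chart hy hy0 v)
    choose z hz1 hz2 hz3 hz4 hz5 using fun m : ℕ =>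
      hg.boundary_max_principle hmem hp0 (contDiffOn_vecCoord p hW) hcov (hf p) hmax hlt hpd
        (hpt m)
    refine ⟨p, hp', z, hz1, hz2, ?_, fun k => ?_, fun m => (hz5 m).le⟩
    · rw [tendsto_iff_norm_sub_tendsto_zero]
      exact squeeze_zero (fun _ => norm_nonneg _) (fun m => (hz3 m).le)
        tendsto_one_div_add_atTop_nhds_zero_nat
    · exact squeeze_zero_norm (fun m => (hz4 m k).le) tendsto_one_div_add_atTop_nhds_zero_nat

end Charts

end RiemannianGap

namespace RiemannianGap

open Set Filter Topology

/-! ### Global gradient estimate -/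

theorem RelOpen.driftLaplacian_congr {n : ℕ} [NeZero n] {T : Set (EuclideanSpace ℝ (Fin n))}
    {g : EuclideanSpace ℝ (Fin n) → Matrix (Fin n) (Fin n) ℝ}
    {w : EuclideanSpace ℝ (Fin n) → Fin n → ℝ} {f h : EuclideanSpace ℝ (Fin n) → ℝ}
    {y : EuclideanSpace ℝ (Fin n)} (hT : RelOpen T) (hfh : EqOn f h T) (hy : y ∈ T) :
    driftLaplacian g w f y = driftLaplacian g w h y := by
  have h1 : ∀ k, ∀ z ∈ T, pd k f z = pd k h z := fun k z hz => hT.pd_congr hz hfh k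
  have h2 : ∀ i j, pd i (pd j f) y = pd i (pd j h) y := fun i j => hT.pd_congr hy (h1 j) i
  simp only [driftLaplacian, laplacian, h1 _ y hy, h2]

section Estimate

variable {n : ℕ} [NeZero n] {M : Type*} [TopologicalSpace M]
  [ChartedSpace (EuclideanHalfSpace n) M] [IsManifold (𝓡∂ n) ∞ M]
  [Bundle.RiemannianBundle (fun x : M => TangentSpace (𝓡∂ n) x)]
  [IsContMDiffRiemannianBundle (𝓡∂ n) ∞ (EuclideanSpace ℝ (Fin n))
      (fun x : M => TangentSpace (𝓡∂ n) x)]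

variable [CompactSpace M] [Nonempty M]
  (hRic : RicciNonneg n M) (hconv : BoundaryConvex n M) {κ : ℝ} (hκ : 0 ≤ κ)
  {W : ∀ x : M, TangentSpace (𝓡∂ n) x}
  (hW : ContMDiffOn (𝓡∂ n) (𝓡∂ n).tangent ∞
    (fun x => (⟨x, W x⟩ : TangentBundle (𝓡∂ n) M)) ((𝓡∂ n).interior M))
  (hWc : CovDerivBoundedBelow W κ)
  {u : M → ℝ} (hu : ContMDiff (𝓡∂ n) 𝓘(ℝ, ℝ) ∞ u) {μ : ℝ}
  (hPDE : ∀ x ∈ (𝓡∂ n).interior M,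
    HasLaplacianAt (n := n) u (-μ * u x + 2 * dirDeriv u x (W x)) x)
  (hNeu : NeumannCondition n u)

include hRic hconv hκ hW hWc hu hPDE hNeu

/-- At some maximum point of `|∇u|² + a u²`, either the gradient vanishes or it is controlled. -/
theorem exists_max_gradient (a : ℝ) : ∃ x₀ : M,
    (∀ x, gradNormSq (n := n) u x + a * u x ^ 2 ≤ gradNormSq (n := n) u x₀ + a * u x₀ ^ 2) ∧
    gradNormSq (n := n) u x₀ * (a ^ 2 * u x₀ ^ 2 + (2 * κ - μ + a) * gradNormSq (n := n) u x₀ -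
      a * μ * u x₀ ^ 2) ≤ 0 := by
  have heq : ∀ x₀ : M, EqOn ((fun x => gradNormSq (n := n) u x + a * u x ^ 2) ∘
      (extChartAt (𝓡∂ n) x₀).symm)
      (fun z => gradSq (gram (chartAt (EuclideanHalfSpace n) x₀))
        (u ∘ (extChartAt (𝓡∂ n) x₀).symm) z + a * (u ∘ (extChartAt (𝓡∂ n) x₀).symm) z ^ 2)
      (extChartAt (𝓡∂ n) x₀).target := fun x₀ z hz => by
    simp only [Function.comp_apply, gradNormSq_eq hz hu]
  have hf : ∀ x₀ : M, ContDiffOn ℝ ∞ ((fun x => gradNormSq (n := n) u x + a * u x ^ 2) ∘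
      (extChartAt (𝓡∂ n) x₀).symm) (extChartAt (𝓡∂ n) x₀).target := fun x₀ =>
    (((metricOn_gram x₀).smooth_gradSq (contDiffOn_comp_symm hu x₀)).add
      (contDiffOn_const.mul ((contDiffOn_comp_symm hu x₀).pow 2))).congr (heq x₀)
  obtain ⟨x₀, hmax, z, hz, hz0, hzt, hpd, hL⟩ := exists_max_sequence hW hκ hWc hf
    fun x₀ y hy hy0 => by
      have hg := metricOn_gram (n := n) x₀
      have hû := contDiffOn_comp_symm hu x₀
      have h1 := hg.normal_pd_gradSq_nonpos hû hy hy0 (fun z hz hz0 => hNeu.chart hz hz0)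
        (hconv.chart hy hy0)
      have h2 := hNeu.chart hy hy0
      have h3 : ∀ k, pd k ((fun x => gradNormSq (n := n) u x + a * u x ^ 2) ∘
          (extChartAt (𝓡∂ n) x₀).symm) y =
          pd k (gradSq (gram (chartAt (EuclideanHalfSpace n) x₀))
            (u ∘ (extChartAt (𝓡∂ n) x₀).symm)) y +
          a * (2 * (u ∘ (extChartAt (𝓡∂ n) x₀).symm) y *
            pd k (u ∘ (extChartAt (𝓡∂ n) x₀).symm) y) := fun k => by
        rw [hg.relOpen.pd_congr hy (heq x₀), hg.relOpen.pd_add_const_mul (hg.smooth_gradSq hû)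
          (hû.pow 2) a hy, hg.relOpen.pd_sq hû hy]
      have h4 : ∑ k, outwardNormal (gram (chartAt (EuclideanHalfSpace n) x₀)) y k *
          (a * (2 * (u ∘ (extChartAt (𝓡∂ n) x₀).symm) y *
            pd k (u ∘ (extChartAt (𝓡∂ n) x₀).symm) y)) = 0 := by
        have : ∑ k, outwardNormal (gram (chartAt (EuclideanHalfSpace n) x₀)) y k *
          (a * (2 * (u ∘ (extChartAt (𝓡∂ n) x₀).symm) y *
            pd k (u ∘ (extChartAt (𝓡∂ n) x₀).symm) y)) =
          2 * a * (u ∘ (extChartAt (𝓡∂ n) x₀).symm) y *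
          ∑ k, outwardNormal (gram (chartAt (EuclideanHalfSpace n) x₀)) y k *
            pd k (u ∘ (extChartAt (𝓡∂ n) x₀).symm) y := by
          rw [Finset.mul_sum]
          exact Finset.sum_congr rfl fun k _ => by ring
        rw [this, h2, mul_zero]
      simp only [h3, mul_add, Finset.sum_add_distrib]
      rw [h4, add_zero]
      exact h1
  refine ⟨x₀, hmax, ?_⟩
  set T := (extChartAt (𝓡∂ n) x₀).target with hTdef
  set g := gram (chartAt (EuclideanHalfSpace n) x₀) with hgdef
  set û := u ∘ (extChartAt (𝓡∂ n) x₀).symm with hûdef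
  set p := extChartAt (𝓡∂ n) x₀ x₀ with hpdef
  set w := vecCoord (chartAt (EuclideanHalfSpace n) x₀) W with hwdef
  have hg : MetricOn T g := metricOn_gram x₀
  have hT := hg.relOpen
  have hû : ContDiffOn ℝ ∞ û T := contDiffOn_comp_symm hu x₀
  have hgV := hg.mono hT.pos inter_subset_left
  have hp : p ∈ T := mem_extChartAt_target x₀
  have hzT : Tendsto z atTop (𝓝[T] p) :=
    tendsto_nhdsWithin_iff.2 ⟨hzt, Eventually.of_forall hz⟩
  have hlim : ∀ {f : EuclideanSpace ℝ (Fin n) → ℝ}, ContDiffOn ℝ ∞ f T →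
      Tendsto (fun m => f (z m)) atTop (𝓝 (f p)) := fun hf =>
    (hf.continuousOn p hp).tendsto.comp hzT
  have hF := hlim (hg.smooth_gradSq hû)
  have hU := hlim hû
  have hG := fun k => hlim (hg.smooth_grad hû k)
  have hest : ∀ m, gradSq g û (z m) * (a ^ 2 * û (z m) ^ 2 +
      (2 * κ - μ + a) * gradSq g û (z m) - a * μ * û (z m) ^ 2) ≤
      gradSq g û (z m) * (1 / ((m : ℝ) + 1)) / 2 +
        ∑ k, a * û (z m) * grad g û k (z m) * pd k ((fun x => gradNormSq (n := n) u x +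
          a * u x ^ 2) ∘ (extChartAt (𝓡∂ n) x₀).symm) (z m) := by
    intro m
    have hzV : z m ∈ T ∩ {y | 0 < y 0} := ⟨hz m, hz0 m⟩
    have h1 := hgV.gradient_estimate (a := a) (hû.mono inter_subset_left)
      (contDiffOn_vecCoord x₀ hW)
      (fun z hz => HasLaplacianAt.chart hPDE hu hz.1 hz.2) hzV (hRic.chart (hz m))
      (hWc.chart (hz m) (hz0 m))
    have h2 := hL m
    rw [hT.driftLaplacian_congr (heq x₀) (hz m)] at h2
    simp only [hT.pd_congr (hz m) (heq x₀)]
    have h3 := mul_le_mul_of_nonneg_left h2 (hg.gradSq_nonneg (u := û) (hz m))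
    refine h1.trans ?_
    linarith
  have hr : Tendsto (fun m => gradSq g û (z m) * (1 / ((m : ℝ) + 1)) / 2 +
        ∑ k, a * û (z m) * grad g û k (z m) * pd k ((fun x => gradNormSq (n := n) u x +
          a * u x ^ 2) ∘ (extChartAt (𝓡∂ n) x₀).symm) (z m)) atTop
      (𝓝 (gradSq g û p * 0 / 2 + ∑ k, a * û p * grad g û k p * 0)) :=
    ((hF.mul tendsto_one_div_add_atTop_nhds_zero_nat).div_const 2).add
      (tendsto_finsetSum _ fun k _ => ((hU.const_mul a).mul (hG k)).mul (hpd k))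
  have hl : Tendsto (fun m => gradSq g û (z m) * (a ^ 2 * û (z m) ^ 2 +
      (2 * κ - μ + a) * gradSq g û (z m) - a * μ * û (z m) ^ 2)) atTop
      (𝓝 (gradSq g û p * (a ^ 2 * û p ^ 2 +
      (2 * κ - μ + a) * gradSq g û p - a * μ * û p ^ 2))) :=
    hF.mul ((((hU.pow 2).const_mul _).add (hF.const_mul _)).sub ((hU.pow 2).const_mul _))
  have hfin := le_of_tendsto_of_tendsto' hl hr hest
  have e1 : û p = u x₀ := congrArg u (extChartAt_to_inv x₀)
  have e2 : gradSq g û p = gradNormSq (n := n) u x₀ := by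
    have := gradNormSq_eq hp hu
    rw [hpdef, extChartAt_to_inv] at this
    exact this.symm
  rw [e1, e2] at hfin
  simpa using hfin

omit hRic hconv in
/-- For a positive eigenvalue, an eigenfunction (`c = 0`) and its negative (`c = -2`) take
nonnegative values. -/
theorem exists_const_mul_nonneg (hμ : 0 < μ) (c : ℝ) : ∃ x, 0 ≤ u x + c * u x := by
  have heq : ∀ x₀ : M, (fun x => u x + c * u x) ∘ (extChartAt (𝓡∂ n) x₀).symm =
      fun z => (u ∘ (extChartAt (𝓡∂ n) x₀).symm) z + c * (u ∘ (extChartAt (𝓡∂ n) x₀).symm) z :=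
    fun x₀ => rfl
  have hû := fun x₀ : M => contDiffOn_comp_symm hu x₀
  obtain ⟨x₀, hmax, z, hz, hz0, hzt, -, hL⟩ := exists_max_sequence hW hκ hWc
    (f := fun x => u x + c * u x)
    (fun x₀ => by
      rw [heq]
      exact (hû x₀).add (contDiffOn_const.mul (hû x₀)))
    fun x₀ y hy hy0 => by
      rw [heq]
      have h2 := hNeu.chart hy hy0
      simp only [(relOpen_target x₀).pd_add_const_mul (hû x₀) (hû x₀) c hy]
      have : ∑ k, outwardNormal (gram (chartAt (EuclideanHalfSpace n) x₀)) y k *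
          (pd k (u ∘ (extChartAt (𝓡∂ n) x₀).symm) y +
            c * pd k (u ∘ (extChartAt (𝓡∂ n) x₀).symm) y) =
          (1 + c) * ∑ k, outwardNormal (gram (chartAt (EuclideanHalfSpace n) x₀)) y k *
            pd k (u ∘ (extChartAt (𝓡∂ n) x₀).symm) y := by
        rw [Finset.mul_sum]
        exact Finset.sum_congr rfl fun k _ => by ring
      rw [this, h2, mul_zero]
  refine ⟨x₀, ?_⟩
  have hg := metricOn_gram (n := n) x₀
  have h1 : ∀ m : ℕ, -μ * ((u ∘ (extChartAt (𝓡∂ n) x₀).symm) (z m) +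
      c * (u ∘ (extChartAt (𝓡∂ n) x₀).symm) (z m)) ≤ 1 / ((m : ℝ) + 1) := by
    intro m
    have h2 := hL m
    rw [heq, hg.driftLaplacian_add_const_mul (hû x₀) (hû x₀) c (hz m),
      HasLaplacianAt.chart hPDE hu (hz m) (hz0 m)] at h2
    linarith
  have hU : Tendsto (fun m => (u ∘ (extChartAt (𝓡∂ n) x₀).symm) (z m)) atTop (𝓝 (u x₀)) := by
    have hzT : Tendsto z atTop (𝓝[(extChartAt (𝓡∂ n) x₀).target] (extChartAt (𝓡∂ n) x₀ x₀)) :=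
      tendsto_nhdsWithin_iff.2 ⟨hzt, Eventually.of_forall hz⟩
    have := ((hû x₀).continuousOn _ (mem_extChartAt_target x₀)).tendsto.comp hzT
    rw [Function.comp_apply (f := u), extChartAt_to_inv] at this
    exact this
  have h3 := le_of_tendsto_of_tendsto' ((hU.add (hU.const_mul c)).const_mul (-μ))
    tendsto_one_div_add_atTop_nhds_zero_nat h1
  nlinarith

end Estimate

/-! ### Lipschitz bounds from bounds on the differential -/

section Lipschitz

variable {n : ℕ} [NeZero n] {M : Type*} [MetricSpace M]
  [ChartedSpace (EuclideanHalfSpace n) M]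
  [Bundle.RiemannianBundle (fun x : M => TangentSpace (𝓡∂ n) x)]
  [IsRiemannianManifold (𝓡∂ n) M]

open MeasureTheory in
theorem abs_sub_le_of_dirDeriv_le {ψ : M → ℝ} (hψ : ContMDiff (𝓡∂ n) 𝓘(ℝ, ℝ) 1 ψ) {k : ℝ}
    (hk : 0 ≤ k) (h : ∀ (x : M) (v : TangentSpace (𝓡∂ n) x), |dirDeriv ψ x v| ≤ k * ‖v‖)
    (x y : M) : |ψ x - ψ y| ≤ k * dist x y := by
  have key : ∀ r : ℝ, dist x y < r → |ψ x - ψ y| ≤ k * r := by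
    intro r hr
    have hr0 : 0 < r := dist_nonneg.trans_lt hr
    have h1 : Manifold.riemannianEDist (𝓡∂ n) x y < ENNReal.ofReal r := by
      rw [← IsRiemannianManifold.out (I := 𝓡∂ n) x y, edist_dist]
      exact (ENNReal.ofReal_lt_ofReal_iff hr0).2 hr
    obtain ⟨γ, γ0, γ1, hγ, hlen, -, -⟩ :=
      Manifold.exists_lt_locally_constant_of_riemannianEDist_lt h1 zero_lt_one
    have hD : ContDiff ℝ 1 (ψ ∘ γ) := by
      rw [← contMDiff_iff_contDiff]
      exact hψ.comp hγ
    have h2 := enorm_sub_le_lintegral_deriv_of_contDiffOn_Icc hD.contDiffOn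
      (zero_le_one (α := ℝ))
    have h3 : ∀ t : ℝ, ‖deriv (ψ ∘ γ) t‖ₑ ≤ ENNReal.ofReal k *
        ‖mfderiv 𝓘(ℝ, ℝ) (𝓡∂ n) γ t 1‖ₑ := by
      intro t
      have h4 : deriv (ψ ∘ γ) t = dirDeriv ψ (γ t) (mfderiv 𝓘(ℝ, ℝ) (𝓡∂ n) γ t 1) := by
        have h5 := mfderiv_comp (I := 𝓘(ℝ, ℝ)) (I' := 𝓡∂ n) (I'' := 𝓘(ℝ, ℝ)) t
          (hψ.mdifferentiable one_ne_zero (γ t)) (hγ.mdifferentiable one_ne_zero t)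
        rw [mfderiv_eq_fderiv] at h5
        exact congrArg (fun L : ℝ →L[ℝ] ℝ => L 1) h5
      rw [h4, Real.enorm_eq_ofReal_abs, ← ofReal_norm, ← ENNReal.ofReal_mul hk]
      exact ENNReal.ofReal_le_ofReal (h _ _)
    have h6 : ‖(ψ ∘ γ) 1 - (ψ ∘ γ) 0‖ₑ ≤ ENNReal.ofReal k * ENNReal.ofReal r := by
      refine h2.trans ((lintegral_mono fun t => h3 t).trans ?_)
      rw [lintegral_const_mul' _ _ ENNReal.ofReal_ne_top,
        ← Manifold.pathELength_eq_lintegral_mfderiv_Icc]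
      gcongr
    rw [← ENNReal.ofReal_mul hk, Real.enorm_eq_ofReal_abs,
      ENNReal.ofReal_le_ofReal_iff (by positivity)] at h6
    simpa [γ0, γ1, abs_sub_comm] using h6
  have h7 : Tendsto (fun r : ℝ => k * r) (𝓝[>] dist x y) (𝓝 (k * dist x y)) :=
    ((continuous_const.mul continuous_id).tendsto _).mono_left nhdsWithin_le_nhds
  refine ge_of_tendsto h7 ?_
  filter_upwards [self_mem_nhdsWithin] with r hr using key r hr

end Lipschitz

end RiemannianGap

namespace RiemannianGap

open Set Filter Topology

/-! ### The eigenvalue estimates -/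

section Gap

variable {n : ℕ} [NeZero n] {M : Type*} [MetricSpace M] [CompactSpace M] [ConnectedSpace M]
  [ChartedSpace (EuclideanHalfSpace n) M] [IsManifold (𝓡∂ n) ∞ M]
  [Bundle.RiemannianBundle (fun x : M => TangentSpace (𝓡∂ n) x)]
  [IsContMDiffRiemannianBundle (𝓡∂ n) ∞ (EuclideanSpace ℝ (Fin n))
      (fun x : M => TangentSpace (𝓡∂ n) x)]
  [IsRiemannianManifold (𝓡∂ n) M]

omit [CompactSpace M] [ConnectedSpace M] in
theorem eq_of_gradNormSq_eq_zero {u : M → ℝ} (hu : ContMDiff (𝓡∂ n) 𝓘(ℝ, ℝ) ∞ u)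
    (h : ∀ x, gradNormSq (n := n) u x ≤ 0) (x y : M) : u x = u y := by
  have h1 := abs_sub_le_of_dirDeriv_le (hu.of_le (by simp)) le_rfl (fun z v => by
    have h2 := dirDeriv_sq_le hu z v
    have h3 := mul_nonpos_of_nonpos_of_nonneg (h z) (sq_nonneg ‖v‖)
    have h4 : dirDeriv u z v = 0 := by
      have : dirDeriv u z v ^ 2 = 0 := le_antisymm (h2.trans h3) (sq_nonneg _)
      simpa using this
    simp [h4]) x y
  rw [zero_mul] at h1
  exact sub_eq_zero.1 (abs_eq_zero.1 (le_antisymm h1 (abs_nonneg _)))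

omit [CompactSpace M] [ConnectedSpace M] [IsManifold (𝓡∂ n) ∞ M] [IsContMDiffRiemannianBundle (𝓡∂ n) ∞
  (EuclideanSpace ℝ (Fin n)) (fun x : M => TangentSpace (𝓡∂ n) x)] in
theorem abs_arcsin_sub_arcsin_le {u : M → ℝ} (hu : ContMDiff (𝓡∂ n) 𝓘(ℝ, ℝ) ∞ u) {a b : ℝ}
    (ha : 0 ≤ a) (hlt : ∀ x, (b * u x) ^ 2 < 1)
    (h : ∀ (x : M) (v : TangentSpace (𝓡∂ n) x),
      b ^ 2 * dirDeriv u x v ^ 2 ≤ a * (1 - (b * u x) ^ 2) * ‖v‖ ^ 2) (x y : M) :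
    |Real.arcsin (b * u x) - Real.arcsin (b * u y)| ≤ √a * dist x y := by
  have hne : ∀ x, b * u x ≠ -1 ∧ b * u x ≠ 1 := fun x =>
    ⟨fun e => by have := hlt x; rw [e] at this; norm_num at this,
      fun e => by have := hlt x; rw [e] at this; norm_num at this⟩
  have hbu : ContMDiff (𝓡∂ n) 𝓘(ℝ, ℝ) 1 u := hu.of_le (by simp)
  have hd : ∀ x, HasDerivAt (fun t => Real.arcsin (b * t)) (1 / √(1 - (b * u x) ^ 2) * b) (u x) :=
    fun x => by
      have h1 : HasDerivAt (fun t => b * t) b (u x) := by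
        simpa using (hasDerivAt_id (u x)).const_mul b
      exact (Real.hasDerivAt_arcsin (hne x).1 (hne x).2).comp (u x) h1
  have hψ : ContMDiff (𝓡∂ n) 𝓘(ℝ, ℝ) 1 ((fun t => Real.arcsin (b * t)) ∘ u) := fun x => by
    refine ContDiffAt.comp_contMDiffAt ?_ (hbu x)
    have h1 : ContDiffAt ℝ 1 Real.arcsin (b * u x) := Real.contDiffAt_arcsin (hne x).1 (hne x).2
    have h2 : ContDiffAt ℝ 1 (fun t : ℝ => b * t) (u x) := contDiffAt_const.mul contDiffAt_id
    exact h1.comp (u x) h2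
  refine abs_sub_le_of_dirDeriv_le hψ (Real.sqrt_nonneg a) (fun x v => ?_) x y
  have h1 : dirDeriv ((fun t => Real.arcsin (b * t)) ∘ u) x v =
      1 / √(1 - (b * u x) ^ 2) * b * dirDeriv u x v := by
    have h2 := (hd x).hasFDerivAt.hasMFDerivAt.comp x
      (hbu.mdifferentiable one_ne_zero x).hasMFDerivAt
    rw [dirDeriv, h2.mfderiv]
    exact mul_comm _ _
  have hpos : 0 < 1 - (b * u x) ^ 2 := sub_pos.2 (hlt x)
  rw [h1]
  refine abs_le_of_sq_le_sq ?_ (by positivity)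
  rw [mul_pow √a, Real.sq_sqrt ha, mul_pow _ (dirDeriv u x v), mul_pow _ b, div_pow,
    Real.sq_sqrt hpos.le, one_pow, mul_assoc, one_div_mul_eq_div, div_le_iff₀ hpos]
  linarith [h x v]


theorem two_mul_le_eigenvalue (hRic : RicciNonneg n M) (hconv : BoundaryConvex n M) {κ : ℝ}
    (hκ : 0 ≤ κ) {W : ∀ x : M, TangentSpace (𝓡∂ n) x}
    (hW : ContMDiffOn (𝓡∂ n) (𝓡∂ n).tangent ∞
      (fun x => (⟨x, W x⟩ : TangentBundle (𝓡∂ n) M)) ((𝓡∂ n).interior M))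
    (hWc : CovDerivBoundedBelow W κ) {u : M → ℝ} (hu : ContMDiff (𝓡∂ n) 𝓘(ℝ, ℝ) ∞ u) {μ : ℝ}
    (hPDE : ∀ x ∈ (𝓡∂ n).interior M,
      HasLaplacianAt (n := n) u (-μ * u x + 2 * dirDeriv u x (W x)) x)
    (hNeu : NeumannCondition n u) (hu_ne : ∃ x y : M, u x ≠ u y) : 2 * κ ≤ μ := by
  obtain ⟨x₀, hmax, hx₀⟩ := exists_max_gradient hRic hconv hκ hW hWc hu hPDE hNeu 0
  simp only [zero_mul, add_zero, ne_eq, OfNat.ofNat_ne_zero, not_false_eq_true, zero_pow,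
    zero_add, sub_zero] at hmax hx₀
  obtain ⟨x, y, hxy⟩ := hu_ne
  have hF : 0 < gradNormSq (n := n) u x₀ := by
    by_contra h
    exact hxy (eq_of_gradNormSq_eq_zero hu (fun z => (hmax z).trans (not_lt.1 h)) x y)
  by_contra! h
  have : 0 < gradNormSq (n := n) u x₀ * ((2 * κ - μ) * gradNormSq (n := n) u x₀) :=
    mul_pos hF (mul_pos (by linarith) hF)
  linarith

theorem theta_sq_div_diam_sq_le (hRic : RicciNonneg n M) (hconv : BoundaryConvex n M) {κ : ℝ}
    (hκ : 0 < κ) {W : ∀ x : M, TangentSpace (𝓡∂ n) x}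
    (hW : ContMDiffOn (𝓡∂ n) (𝓡∂ n).tangent ∞
      (fun x => (⟨x, W x⟩ : TangentBundle (𝓡∂ n) M)) ((𝓡∂ n).interior M))
    (hWc : CovDerivBoundedBelow W κ) {u : M → ℝ} (hu : ContMDiff (𝓡∂ n) 𝓘(ℝ, ℝ) ∞ u) {μ : ℝ}
    (hPDE : ∀ x ∈ (𝓡∂ n).interior M,
      HasLaplacianAt (n := n) u (-μ * u x + 2 * dirDeriv u x (W x)) x)
    (hNeu : NeumannCondition n u) (hu_ne : ∃ x y : M, u x ≠ u y) {s : ℝ} (hs0 : 0 < s)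
    (hs1 : s < 1) (hμ : 2 * κ ≤ μ) :
    Real.arcsin √(1 - s) ^ 2 / Metric.diam (univ : Set M) ^ 2 ≤ μ - 2 * s * κ := by
  set a := μ - 2 * s * κ with ha
  have ha0 : 0 < a := by nlinarith
  have huc : Continuous u := hu.continuous
  obtain ⟨x₁, -, hx₁⟩ := isCompact_univ.exists_isMaxOn (univ_nonempty (α := M))
    (huc.pow 2).continuousOn
  have hmax1 : ∀ x, u x ^ 2 ≤ u x₁ ^ 2 := fun x => hx₁ (mem_univ x)
  have hU : 0 < u x₁ ^ 2 := by
    obtain ⟨x, y, hxy⟩ := hu_ne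
    by_contra! h
    have h0 : ∀ z, u z = 0 := fun z => by
      have : u z ^ 2 = 0 := le_antisymm ((hmax1 z).trans h) (sq_nonneg _)
      simpa using this
    exact hxy ((h0 x).trans (h0 y).symm)
  obtain ⟨x₂, hx₂⟩ : ∃ x, u x = 0 := by
    obtain ⟨y, hy⟩ := exists_const_mul_nonneg hκ.le hW hWc hu hPDE hNeu (by linarith) 0
    obtain ⟨z, hz⟩ := exists_const_mul_nonneg hκ.le hW hWc hu hPDE hNeu (by linarith) (-2)
    exact mem_range_of_exists_le_of_exists_ge huc ⟨z, by linarith⟩ ⟨y, by linarith⟩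
  have hs : 0 < 1 - s := sub_pos.2 hs1
  have hP : ∀ x, (1 - s) * (gradNormSq (n := n) u x + a * u x ^ 2) ≤ a * u x₁ ^ 2 := by
    intro x
    obtain ⟨x₀, hmax, hx₀⟩ := exists_max_gradient hRic hconv hκ.le hW hWc hu hPDE hNeu a
    have h1 : (1 - s) * (gradNormSq (n := n) u x₀ + a * u x₀ ^ 2) ≤ a * u x₀ ^ 2 := by
      rcases (gradNormSq_nonneg (n := n) (u := u) x₀).eq_or_lt with h | h
      · rw [← h]
        nlinarith [mul_nonneg (mul_nonneg ha0.le (sq_nonneg (u x₀))) hs0.le]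
      · have h2 := nonpos_of_mul_nonpos_right hx₀ h
        have h3 : 2 * κ * ((1 - s) * (gradNormSq (n := n) u x₀ + a * u x₀ ^ 2)) ≤
            2 * κ * (a * u x₀ ^ 2) := by
          have e : μ = a + 2 * s * κ := by rw [ha]; ring
          rw [e] at h2
          linarith
        exact le_of_mul_le_mul_left h3 (by linarith)
    have h4 := mul_le_mul_of_nonneg_left (hmax x) hs.le
    have h5 := mul_le_mul_of_nonneg_left (hmax1 x₀) ha0.le
    linarith
  set b := √(1 - s) / |u x₁| with hb
  have hU' : 0 < |u x₁| := abs_pos.2 fun h => by rw [h] at hU; norm_num at hU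
  have hb2 : b ^ 2 * u x₁ ^ 2 = 1 - s := by
    rw [hb, div_pow, Real.sq_sqrt hs.le, sq_abs, div_mul_cancel₀ _ hU.ne']
  have hb0 : 0 ≤ b ^ 2 := sq_nonneg b
  have hlt : ∀ x, (b * u x) ^ 2 < 1 := fun x => by
    rw [mul_pow]
    have := mul_le_mul_of_nonneg_left (hmax1 x) hb0
    linarith
  have hgrad : ∀ x, b ^ 2 * gradNormSq (n := n) u x ≤ a * (1 - (b * u x) ^ 2) := fun x => by
    have h1 := mul_le_mul_of_nonneg_left (hP x) hb0
    have h2 : (1 - s) * (b ^ 2 * gradNormSq (n := n) u x) ≤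
        (1 - s) * (a * (1 - (b * u x) ^ 2)) := by
      rw [mul_pow]
      linear_combination h1 + a * hb2
    exact le_of_mul_le_mul_left h2 hs
  have hL := abs_arcsin_sub_arcsin_le hu ha0.le hlt (fun x v => by
    have h1 := mul_le_mul_of_nonneg_left (dirDeriv_sq_le hu x v) hb0
    have h2 := mul_le_mul_of_nonneg_right (hgrad x) (sq_nonneg ‖v‖)
    linarith) x₁ x₂
  rw [hx₂, mul_zero, Real.arcsin_zero, sub_zero] at hL
  have hθ : |Real.arcsin (b * u x₁)| = |Real.arcsin √(1 - s)| := by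
    rcases abs_choice (u x₁) with h | h
    · have : b * u x₁ = √(1 - s) := by
        calc b * u x₁ = b * |u x₁| := by rw [h]
          _ = √(1 - s) := by rw [hb, div_mul_cancel₀ _ hU'.ne']
      rw [this]
    · have : b * u x₁ = -√(1 - s) := by
        calc b * u x₁ = -(b * |u x₁|) := by rw [h]; ring
          _ = -√(1 - s) := by rw [hb, div_mul_cancel₀ _ hU'.ne']
      rw [this, Real.arcsin_neg, abs_neg]
  have hd : dist x₁ x₂ ≤ Metric.diam (univ : Set M) :=
    Metric.dist_le_diam_of_mem isCompact_univ.isBounded (mem_univ _) (mem_univ _)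
  rw [hθ] at hL
  have h1 := hL.trans (mul_le_mul_of_nonneg_left hd (Real.sqrt_nonneg a))
  have h2 := pow_le_pow_left₀ (abs_nonneg _) h1 2
  rw [sq_abs, mul_pow, Real.sq_sqrt ha0.le] at h2
  exact div_le_of_le_mul₀ (sq_nonneg _) ha0.le h2

end Gap

end RiemannianGap

end

theorem mainTheorem1 {n : ℕ} [NeZero n] {M : Type*} [MetricSpace M] [CompactSpace M]
    [ConnectedSpace M] [ChartedSpace (EuclideanHalfSpace n) M] [IsManifold (𝓡∂ n) ∞ M]
    [Bundle.RiemannianBundle (fun x : M => TangentSpace (𝓡∂ n) x)]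
    [IsContMDiffRiemannianBundle (𝓡∂ n) ∞ (EuclideanSpace ℝ (Fin n))
      (fun x : M => TangentSpace (𝓡∂ n) x)]
    [IsRiemannianManifold (𝓡∂ n) M]
    (hRic : RiemannianGap.RicciNonneg n M) (hconv : RiemannianGap.BoundaryConvex n M)
    (lam₁ lam₂ c : ℝ) (hc : 0 < √(c / 2))
    (W : ∀ x : M, TangentSpace (𝓡∂ n) x)
    (hW : ContMDiffOn (𝓡∂ n) (𝓡∂ n).tangent ∞
      (fun x => (⟨x, W x⟩ : TangentBundle (𝓡∂ n) M)) ((𝓡∂ n).interior M))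
    (hWc : RiemannianGap.CovDerivBoundedBelow W (√(c / 2)))
    (u : M → ℝ) (hu : ContMDiff (𝓡∂ n) 𝓘(ℝ, ℝ) ∞ u) (hu_ne : ∃ x y : M, u x ≠ u y)
    (hPDE : ∀ x ∈ (𝓡∂ n).interior M, RiemannianGap.HasLaplacianAt (n := n) u
      (-(lam₂ - lam₁) * u x + 2 * RiemannianGap.dirDeriv u x (W x)) x)
    (hNeu : RiemannianGap.NeumannCondition n u) :
    (∀ β : ℝ, 0 < β → β < √2 →
      lam₂ - lam₁ ≥
        RiemannianGap.theta β ^ 2 / Metric.diam (Set.univ : Set M) ^ 2 + β * √c) ∧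
    lam₂ - lam₁ ≥ √(2 * c) := by
  have hK : 2 * √(c / 2) ≤ lam₂ - lam₁ :=
    RiemannianGap.two_mul_le_eigenvalue hRic hconv hc.le hW hWc hu hPDE hNeu hu_ne
  have hc2 : √c = √2 * √(c / 2) := by
    rw [← Real.sqrt_mul (by norm_num)]
    congr 1
    ring
  have h2 : √2 * √2 = (2 : ℝ) := Real.mul_self_sqrt (by norm_num)
  refine ⟨fun β hβ hβ2 => ?_, ?_⟩
  · have hs2 : (0 : ℝ) < √2 := by positivity
    have hs : β / √2 < 1 := (div_lt_one hs2).2 hβ2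
    have h := RiemannianGap.theta_sq_div_diam_sq_le hRic hconv hc hW hWc hu hPDE hNeu hu_ne
      (div_pos hβ hs2) hs hK
    have e1 : RiemannianGap.theta β = Real.arcsin √(1 - β / √2) := by
      have h3 : √2 - β ≠ 0 := (sub_pos.2 hβ2).ne'
      rw [RiemannianGap.theta, one_div, ← Real.sqrt_inv]
      congr 2
      field_simp
      ring
    have e2 : β * √c = 2 * (β / √2) * √(c / 2) := by
      rw [hc2]
      field_simp
      linear_combination h2
    rw [e1, e2]
    linarith
  · have e3 : √(2 * c) = 2 * √(c / 2) := by
      rw [Real.sqrt_mul (by norm_num), hc2, ← mul_assoc, h2]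
    rw [e3]
    exact hK
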